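/- Let $G$ be a (finite-dimensional, real) Lie group, $H\subset G$ a closed subgroup, $\pi:G\to G/H$ the canonical projection, and suppose that $G/H$ is a pseudo-Riemannian symmetric space: there is a symmetric decomposition $\mathfrak g=\mathfrak h\oplus\mathfrak m$, where $\mathfrak h$ is the Lie algebra of $H$, $\mathrm{Ad}(H)\mathfrak m\subset\mathfrak m$ and $[\mathfrak m,\mathfrak m]\subset\mathfrak h$, and $h$ is a $G$-invariant pseudo-Riemannian metric on $G/H$ with Levi-Civita connection $\nabla^h$. Let $(M,J)$ be a complex manifold, $f:M\to G/H$ a smooth map and $F:M\to G$ a framing of $f$, i.e. a smooth map with $f=\pi\circ F$. Let $\theta$ be the left Maurer-Cartan form of $G$, put $\alpha=F^*\theta=\alpha_{\mathfrak h}+\alpha_{\mathfrak m}$ according to $\mathfrak g=\mathfrak h\oplus\mathfrak m$, and let $\alpha'_{\mathfrak m}$ be the $(1,0)$-part of $\alpha_{\mathfrak m}$ and $\alpha''_{\mathfrak h}$ the $(0,1)$-part of $\alpha_{\mathfrak h}$ (forms with values in $\mathfrak g\otimes\mathbb C$). Then $f$ is pluriharmonic if and only if $$\bar\partial\alpha'_{\mathfrak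 m}+[\alpha''_{\mathfrak h}\wedge\alpha'_{\mathfrak m}]=0,$$ where $[a\wedge b](X,Y)=[a(X),b(Y)]-[a(Y),b(X)]$. Here pluriharmonic means that $f\circ\iota:\Sigma\to G/H$ is harmonic for every Riemann surface $\Sigma$ (with any Riemannian metric in its conformal class) and every holomorphic immersion $\iota:\Sigma\to M$. The equivalence also holds if pluriharmonic is understood as $(\nabla df)^{1,1}=0$, where $\nabla$ is the connection on $T^*M\otimes f^*T(G/H)$ induced by $\nabla^h$ and by any connection $D$ on $TM$ with $DJ=0$ whose torsion satisfies $T^{1,1}=0$. -/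

import Mathlib

open scoped Manifold ContDiff Bundle Topology
open Bundle FiberBundle VectorField

noncomputable section

/-! ### Pseudo-Riemannian metrics, Levi-Civita connections, second fundamental form of a map

All real manifolds are finite-dimensional and without boundary, modelled on a real normed space. -/

section Real

variable {A : Type*} [NormedAddCommGroup A] [NormedSpace ℝ A]
  {S : Type*} [TopologicalSpace S] [ChartedSpace A S] [IsManifold 𝓘(ℝ, A) ∞ S]
  {B : Type*} [NormedAddCommGroup B] [NormedSpace ℝ B]
  {N : Type*} [TopologicalSpace N] [ChartedSpace B N] [IsManifold 𝓘(ℝ, B) ∞ N]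

variable (B N) in
/-- A smooth pseudo-Riemannian metric on `N`. -/
structure PseudoRiemannianMetric where
  /-- The scalar product on each tangent space. -/
  inner (x : N) : TangentSpace 𝓘(ℝ, B) x →L[ℝ] TangentSpace 𝓘(ℝ, B) x →L[ℝ] ℝ
  symm (x : N) (u v : TangentSpace 𝓘(ℝ, B) x) : inner x u v = inner x v u
  nondegenerate (x : N) (u : TangentSpace 𝓘(ℝ, B) x) (hu : ∀ v, inner x u v = 0) : u = 0
  contMDiff : ContMDiff 𝓘(ℝ, B) (𝓘(ℝ, B).prod 𝓘(ℝ, B →L[ℝ] B →L[ℝ] ℝ)) ∞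
    (fun x ↦ TotalSpace.mk' (B →L[ℝ] B →L[ℝ] ℝ)
      (E := fun x : N ↦ TangentSpace 𝓘(ℝ, B) x →L[ℝ] TangentSpace 𝓘(ℝ, B) x →L[ℝ] ℝ) x (inner x))

/-- The metric is Riemannian, i.e. positive definite. -/
def PseudoRiemannianMetric.IsRiemannian (g : PseudoRiemannianMetric B N) : Prop :=
  ∀ (x : N) (u : TangentSpace 𝓘(ℝ, B) x), u ≠ 0 → 0 < g.inner x u u

/-- `nabla` is the Levi-Civita connection of `g`: it is torsion-free and
`X (g (Y, Z)) = g (∇_X Y, Z) + g (Y, ∇_X Z)`. Recall that `nabla Y x u` is `(∇_u Y)(x)`. -/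
structure IsLeviCivita [FiniteDimensional ℝ B] (g : PseudoRiemannianMetric B N)
    (nabla : CovariantDerivative 𝓘(ℝ, B) B (TangentSpace 𝓘(ℝ, B) : N → Type _)) : Prop where
  torsion_eq_zero : nabla.torsion = 0
  metric : ∀ (x : N) (u : TangentSpace 𝓘(ℝ, B) x) (Y Z : Π y : N, TangentSpace 𝓘(ℝ, B) y),
    MDifferentiableAt 𝓘(ℝ, B) 𝓘(ℝ, B).tangent (fun y ↦ (⟨y, Y y⟩ : TangentBundle 𝓘(ℝ, B) N)) x →
    MDifferentiableAt 𝓘(ℝ, B) 𝓘(ℝ, B).tangent (fun y ↦ (⟨y, Z y⟩ : TangentBundle 𝓘(ℝ, B) N)) x →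
      mvfderiv 𝓘(ℝ, B) (fun y ↦ g.inner y (Y y) (Z y)) x u =
        g.inner x (nabla Y x u) (Z x) + g.inner x (Y x) (nabla Z x u)

/-- The pull-back connection `φ^*∇` on `φ^*TN`. In the local frame `E_i` of `TN` around `φ x`
given by the trivialization of `TN` at `φ x`, a section `s` of `φ^*TN` is `∑ s^i (E_i ∘ φ)` and
`(φ^*∇)_u s = ∑ (u s^i) E_i + ∑ s^i ∇_{dφ u} E_i`; the vector field `∑ s^i(x) E_i` is
`extend B (s x)`. -/
def pullbackConnection
    (nabla : CovariantDerivative 𝓘(ℝ, B) B (TangentSpace 𝓘(ℝ, B) : N → Type _)) (φ : S → N)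
    (s : Π x : S, TangentSpace 𝓘(ℝ, B) (φ x)) (x : S) (u : TangentSpace 𝓘(ℝ, A) x) :
    TangentSpace 𝓘(ℝ, B) (φ x) :=
  (trivializationAt B (TangentSpace 𝓘(ℝ, B) : N → Type _) (φ x)).symm (φ x)
      (mvfderiv 𝓘(ℝ, A) (fun y ↦ ((trivializationAt B (TangentSpace 𝓘(ℝ, B) : N → Type _) (φ x))
        ⟨φ y, s y⟩).2) x u) +
    nabla (extend B (s x)) (φ x) (mfderiv 𝓘(ℝ, A) 𝓘(ℝ, B) φ x u)

/-- The tensor `∇dφ (u, v) = (φ^*∇)_u (dφ V) - dφ (D_u V)`, where `V` is a local vector field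
extending `v`. Here `∇` is the connection on `T^*S ⊗ φ^*TN` induced by `D` and `nabla`. -/
def nablaDiff (D : CovariantDerivative 𝓘(ℝ, A) A (TangentSpace 𝓘(ℝ, A) : S → Type _))
    (nabla : CovariantDerivative 𝓘(ℝ, B) B (TangentSpace 𝓘(ℝ, B) : N → Type _)) (φ : S → N)
    (x : S) (u v : TangentSpace 𝓘(ℝ, A) x) : TangentSpace 𝓘(ℝ, B) (φ x) :=
  pullbackConnection nabla φ (fun y ↦ mfderiv 𝓘(ℝ, A) 𝓘(ℝ, B) φ y (extend A v y)) x u -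
    mfderiv 𝓘(ℝ, A) 𝓘(ℝ, B) φ x (D (extend A v) x u)

/-- The harmonic map equation `Tr_g ∇dφ = 0` for a map from a Riemannian manifold `(S, g)` with
Levi-Civita connection `D`; the trace is taken over `g`-orthonormal bases. -/
def IsHarmonicMap (g : PseudoRiemannianMetric A S)
    (D : CovariantDerivative 𝓘(ℝ, A) A (TangentSpace 𝓘(ℝ, A) : S → Type _))
    (nabla : CovariantDerivative 𝓘(ℝ, B) B (TangentSpace 𝓘(ℝ, B) : N → Type _))
    (φ : S → N) : Prop :=
  ∀ (x : S) (e : Module.Basis (Fin (Module.finrank ℝ A)) ℝ (TangentSpace 𝓘(ℝ, A) x)),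
    (∀ i j, g.inner x (e i) (e j) = if i = j then 1 else 0) →
      ∑ i, nablaDiff D nabla φ x (e i) (e i) = 0

end Real

/-! ### Complex manifolds and pluriharmonic maps -/

section Complex

variable {E : Type*} [NormedAddCommGroup E] [NormedSpace ℂ E]
  {M : Type*} [TopologicalSpace M] [ChartedSpace E M]

/-- The real manifold underlying a complex manifold. -/
instance isManifold_real_of_complex [h : IsManifold 𝓘(ℂ, E) ω M] : IsManifold 𝓘(ℝ, E) ∞ M := by
  refine isManifold_of_contDiffOn 𝓘(ℝ, E) ∞ M fun e e' he he' ↦ ?_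
  have h1 := (contDiffGroupoid ω 𝓘(ℂ, E)).compatible he he'
  rw [contDiffGroupoid, mem_groupoid_of_pregroupoid] at h1
  have h2 : ContDiffOn ℂ ω _ _ := h1.1
  exact (h2.restrict_scalars ℝ).of_le (by simp)

/-- The complex structure `J` on the real tangent spaces of a complex manifold:
multiplication by `i` in a holomorphic chart. -/
def complexStructure (x : M) : TangentSpace 𝓘(ℝ, E) x →L[ℝ] TangentSpace 𝓘(ℝ, E) x :=
  ((Complex.I • ContinuousLinearMap.id ℂ E).restrictScalars ℝ : E →L[ℝ] E)

/-- The `(1,1)`-part of a bilinear form on the real tangent space with values in a real or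
complex vector space: `ω^{1,1}(u, v) = (ω(u, v) + ω(Ju, Jv)) / 2`. (On complexified vectors this is
`0` on `T^{1,0} × T^{1,0}` and `T^{0,1} × T^{0,1}`, and `ω` on the mixed pairs.) -/
def oneOnePart {V : Type*} [AddCommGroup V] [Module ℝ V] {x : M}
    (b : TangentSpace 𝓘(ℝ, E) x → TangentSpace 𝓘(ℝ, E) x → V)
    (u v : TangentSpace 𝓘(ℝ, E) x) : V :=
  (1 / 2 : ℝ) • (b u v + b (complexStructure x u) (complexStructure x v))

variable {B : Type*} [NormedAddCommGroup B] [NormedSpace ℝ B]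
  {N : Type*} [TopologicalSpace N] [ChartedSpace B N] [IsManifold 𝓘(ℝ, B) ∞ N]

/-- `ψ` is harmonic for every Riemannian metric `g` on the complex manifold `M` with
`g(Ju, Jv) = g(u, v)`. If `M` is a Riemann surface, these are the metrics in the conformal class
given by the complex structure. -/
def IsHarmonicForHermitianMetrics [FiniteDimensional ℂ E] [IsManifold 𝓘(ℂ, E) ω M]
    (nabla : CovariantDerivative 𝓘(ℝ, B) B (TangentSpace 𝓘(ℝ, B) : N → Type _))
    (ψ : M → N) : Prop :=
  ∀ (g : PseudoRiemannianMetric E M)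
    (D : CovariantDerivative 𝓘(ℝ, E) E (TangentSpace 𝓘(ℝ, E) : M → Type _)),
    g.IsRiemannian →
    (∀ x u v, g.inner x (complexStructure x u) (complexStructure x v) = g.inner x u v) →
    IsLeviCivita g D →
    IsHarmonicMap g D nabla ψ

/-- A map `φ` from a complex manifold `M` to `N`, with connection `nabla`, is pluriharmonic if its
restriction `φ ∘ ι` to every Riemann surface `ι : Σ → M` (a holomorphic immersion) is harmonic,
where `Σ` carries any Riemannian metric in the conformal class of its complex structure. -/
def IsPluriharmonic [IsManifold 𝓘(ℂ, E) ω M]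
    (nabla : CovariantDerivative 𝓘(ℝ, B) B (TangentSpace 𝓘(ℝ, B) : N → Type _))
    (φ : M → N) : Prop :=
  ∀ (S : Type) [TopologicalSpace S] [T2Space S] [SecondCountableTopology S] [ChartedSpace ℂ S]
    [IsManifold 𝓘(ℂ, ℂ) ω S] (ι : S → M),
    ContMDiff 𝓘(ℂ, ℂ) 𝓘(ℂ, E) ω ι →
    (∀ z, Function.Injective (mfderiv 𝓘(ℂ, ℂ) 𝓘(ℂ, E) ι z)) →
    IsHarmonicForHermitianMetrics (E := ℂ) nabla (φ ∘ ι)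

/-- `D` is a complex connection of Nijenhuis type on `TM`: `DJ = 0` and its torsion `T` satisfies
`T^{1,1} = 0`. (Torsion-free complex connections are a special case.) -/
structure IsNijenhuisType [FiniteDimensional ℂ E] [IsManifold 𝓘(ℂ, E) ω M]
    (D : CovariantDerivative 𝓘(ℝ, E) E (TangentSpace 𝓘(ℝ, E) : M → Type _)) : Prop where
  complex : ∀ (x : M) (u : TangentSpace 𝓘(ℝ, E) x) (Y : Π y : M, TangentSpace 𝓘(ℝ, E) y),
    MDifferentiableAt 𝓘(ℝ, E) 𝓘(ℝ, E).tangent (fun y ↦ (⟨y, Y y⟩ : TangentBundle 𝓘(ℝ, E) M)) x →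
      D (fun y ↦ complexStructure y (Y y)) x u = complexStructure x (D Y x u)
  torsion : ∀ (x : M) (u v : TangentSpace 𝓘(ℝ, E) x),
    oneOnePart (fun u v ↦ D.torsion x u v) u v = 0

/-- The pluriharmonic map equation `(∇dφ)^{1,1} = 0`. -/
def IsGeneralizedPluriharmonic [IsManifold 𝓘(ℂ, E) ω M]
    (D : CovariantDerivative 𝓘(ℝ, E) E (TangentSpace 𝓘(ℝ, E) : M → Type _))
    (nabla : CovariantDerivative 𝓘(ℝ, B) B (TangentSpace 𝓘(ℝ, B) : N → Type _))
    (φ : M → N) : Prop :=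
  ∀ (x : M) (u v : TangentSpace 𝓘(ℝ, E) x), oneOnePart (nablaDiff D nabla φ x) u v = 0

/-! ### Complex-valued differential forms

The complexification of a real vector space `V` is `V × V`, where `(a, b)` stands for `a + i b`. -/

/-- Multiplication by `i` on the complexification `V × V` of `V`. -/
def iMul {V : Type*} [AddCommGroup V] [Module ℝ V] : (V × V) →ₗ[ℝ] V × V :=
  (-LinearMap.snd ℝ V V).prod (LinearMap.fst ℝ V V)

variable {V : Type*} [NormedAddCommGroup V] [NormedSpace ℝ V]

/-- A real one-form regarded as a complex-valued one. -/
def complexForm (a : Π x : M, TangentSpace 𝓘(ℝ, E) x →ₗ[ℝ] V) (x : M) :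
    TangentSpace 𝓘(ℝ, E) x →ₗ[ℝ] V × V :=
  LinearMap.inl ℝ V V ∘ₗ a x

/-- The `(1,0)`-part `a' = (a - i a ∘ J) / 2` of a complex-valued one-form `a`. -/
def oneZeroPart (a : Π x : M, TangentSpace 𝓘(ℝ, E) x →ₗ[ℝ] V × V) (x : M) :
    TangentSpace 𝓘(ℝ, E) x →ₗ[ℝ] V × V :=
  (1 / 2 : ℝ) • (a x - iMul ∘ₗ a x ∘ₗ (complexStructure x).toLinearMap)

/-- The `(0,1)`-part `a'' = (a + i a ∘ J) / 2` of a complex-valued one-form `a`. -/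
def zeroOnePart (a : Π x : M, TangentSpace 𝓘(ℝ, E) x →ₗ[ℝ] V × V) (x : M) :
    TangentSpace 𝓘(ℝ, E) x →ₗ[ℝ] V × V :=
  (1 / 2 : ℝ) • (a x + iMul ∘ₗ a x ∘ₗ (complexStructure x).toLinearMap)

/-- The exterior derivative `da (u, v) = u (a V) - v (a U) - a [U, V]` of a one-form with values in
a normed space, where `U`, `V` are local vector fields extending `u`, `v`. -/
def extDerivOneForm {W : Type*} [NormedAddCommGroup W] [NormedSpace ℝ W]
    [IsManifold 𝓘(ℂ, E) ω M] (a : Π x : M, TangentSpace 𝓘(ℝ, E) x →ₗ[ℝ] W)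
    (x : M) (u v : TangentSpace 𝓘(ℝ, E) x) : W :=
  mvfderiv 𝓘(ℝ, E) (fun y ↦ a y (extend E v y)) x u -
    mvfderiv 𝓘(ℝ, E) (fun y ↦ a y (extend E u y)) x v -
    a x (mlieBracket 𝓘(ℝ, E) (extend E u) (extend E v) x)

/-- `∂̄ a` for a form `a` of type `(1,0)`: the `(1,1)`-part of `da`. -/
def dbar [IsManifold 𝓘(ℂ, E) ω M] (a : Π x : M, TangentSpace 𝓘(ℝ, E) x →ₗ[ℝ] V × V)
    (x : M) (u v : TangentSpace 𝓘(ℝ, E) x) : V × V :=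
  oneOnePart (extDerivOneForm a x) u v

end Complex

/-! ### Lie groups, homogeneous spaces and framings -/

section Homogeneous

variable {A : Type*} [NormedAddCommGroup A] [NormedSpace ℝ A]
  {G : Type*} [TopologicalSpace G] [ChartedSpace A G] [Group G]

/-- The adjoint representation: `Ad g` is the differential at `1` of `k ↦ g k g⁻¹`. -/
def adjointMap (g : G) (X : GroupLieAlgebra 𝓘(ℝ, A) G) : GroupLieAlgebra 𝓘(ℝ, A) G :=
  mfderiv 𝓘(ℝ, A) 𝓘(ℝ, A) (fun k : G ↦ g * k * g⁻¹) 1 X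

/-- The Lie algebra of a closed subgroup `H` as a subset of the Lie algebra of `G`: the velocities
at time `0` of the curves in `H` that start at `1`. -/
def subgroupLieAlgebra (H : Subgroup G) : Set (GroupLieAlgebra 𝓘(ℝ, A) G) :=
  {X | ∃ γ : ℝ → G, γ 0 = 1 ∧ (∀ t, γ t ∈ H) ∧
    HasMFDerivAt 𝓘(ℝ, ℝ) 𝓘(ℝ, A) γ 0
      (ContinuousLinearMap.toSpanSingleton ℝ (X : A) : ℝ →L[ℝ] A)}

/-- `𝔤 = 𝔥 ⊕ 𝔪` is a symmetric decomposition for `G/H`: `𝔥` is the Lie algebra of `H`,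
the decomposition is reductive (`Ad(H) 𝔪 ⊆ 𝔪`), and `[𝔪, 𝔪] ⊆ 𝔥`. If `H` is an open subgroup of
the fixed group of an involution of `G`, the `±1`-eigenspaces of its differential at `1` form such
a decomposition. -/
structure IsSymmetricDecomposition (H : Subgroup G)
    (𝔥 𝔪 : Submodule ℝ (GroupLieAlgebra 𝓘(ℝ, A) G)) : Prop where
  lieAlgebra : (𝔥 : Set (GroupLieAlgebra 𝓘(ℝ, A) G)) = subgroupLieAlgebra H
  isCompl : IsCompl 𝔥 𝔪
  reductive : ∀ g ∈ H, ∀ X ∈ 𝔪, adjointMap g X ∈ 𝔪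
  symmetric : ∀ X ∈ 𝔪, ∀ Y ∈ 𝔪, ⁅X, Y⁆ ∈ 𝔥

/-- The left Maurer-Cartan form `θ_g (v) = d(L_{g⁻¹}) v`. -/
def maurerCartan (g : G) : TangentSpace 𝓘(ℝ, A) g →ₗ[ℝ] GroupLieAlgebra 𝓘(ℝ, A) G :=
  (mfderiv 𝓘(ℝ, A) 𝓘(ℝ, A) (fun k : G ↦ g⁻¹ * k) g : A →L[ℝ] A).toLinearMap

/-- The Lie algebra of `G` is, as a vector space, the model space of `G`. -/
def lieToModel : GroupLieAlgebra 𝓘(ℝ, A) G ≃ₗ[ℝ] A where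
  toFun X := X
  invFun X := X
  map_add' _ _ := rfl
  map_smul' _ _ := rfl

variable (G) in
/-- The complex bilinear extension of the Lie bracket of `𝔤` to `𝔤 ⊗ ℂ`:
`[a + i b, c + i d] = ([a, c] - [b, d]) + i ([a, d] + [b, c])`. -/
def complexBracket (p q : A × A) : A × A :=
  let br (X Y : A) : A :=
    lieToModel (G := G) ⁅lieToModel (G := G).symm X, lieToModel (G := G).symm Y⁆
  (br p.1 q.1 - br p.2 q.2, br p.1 q.2 + br p.2 q.1)

variable {E : Type*} [NormedAddCommGroup E] [NormedSpace ℂ E]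
  {M : Type*} [TopologicalSpace M] [ChartedSpace E M]

/-- The pull-back `α = F^*θ` of the Maurer-Cartan form. -/
def framingForm (F : M → G) (x : M) :
    TangentSpace 𝓘(ℝ, E) x →ₗ[ℝ] GroupLieAlgebra 𝓘(ℝ, A) G :=
  maurerCartan (F x) ∘ₗ (mfderiv 𝓘(ℝ, E) 𝓘(ℝ, A) F x).toLinearMap

/-- The component in `𝔭` of `α = F^*θ` along a decomposition `𝔤 = 𝔭 ⊕ 𝔮`, as a form with values
in `𝔤 ⊗ ℂ`. -/
def framingComponent (F : M → G) {𝔭 𝔮 : Submodule ℝ (GroupLieAlgebra 𝓘(ℝ, A) G)}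
    (h : IsCompl 𝔭 𝔮) : Π x : M, TangentSpace 𝓘(ℝ, E) x →ₗ[ℝ] A × A :=
  complexForm fun x ↦ lieToModel.toLinearMap ∘ₗ 𝔭.projection 𝔮 h ∘ₗ framingForm F x

variable (G) in
/-- `[a ∧ b] (u, v) = [a u, b v] - [a v, b u]` for one-forms with values in `𝔤 ⊗ ℂ`. -/
def bracketWedge (a b : Π x : M, TangentSpace 𝓘(ℝ, E) x →ₗ[ℝ] A × A)
    (x : M) (u v : TangentSpace 𝓘(ℝ, E) x) : A × A :=
  complexBracket G (a x u) (b x v) - complexBracket G (a x v) (b x u)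

/-- The equation `∂̄ α'_𝔪 + [α''_𝔥 ∧ α'_𝔪] = 0` for `α = F^*θ`, as an equality of two-forms on `M`
with values in `𝔤 ⊗ ℂ`; here `h` is the decomposition `𝔤 = 𝔥 ⊕ 𝔪`. -/
def FramingEquation [IsManifold 𝓘(ℂ, E) ω M] (F : M → G)
    {𝔥 𝔪 : Submodule ℝ (GroupLieAlgebra 𝓘(ℝ, A) G)} (h : IsCompl 𝔥 𝔪) : Prop :=
  ∀ (x : M) (u v : TangentSpace 𝓘(ℝ, E) x),
    dbar (oneZeroPart (framingComponent F h.symm)) x u v +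
      bracketWedge G (zeroOnePart (framingComponent F h))
        (oneZeroPart (framingComponent F h.symm)) x u v = 0

variable {B : Type*} [NormedAddCommGroup B] [NormedSpace ℝ B] {H : Subgroup G}
  [ChartedSpace B (G ⧸ H)] [IsManifold 𝓘(ℝ, B) ∞ (G ⧸ H)]

/-- A metric on `G/H` is `G`-invariant if every translation of `G/H` is an isometry. -/
def PseudoRiemannianMetric.IsInvariant (h : PseudoRiemannianMetric B (G ⧸ H)) : Prop :=
  ∀ (g : G) (p : G ⧸ H) (u v : TangentSpace 𝓘(ℝ, B) p),
    h.inner (g • p) (mfderiv 𝓘(ℝ, B) 𝓘(ℝ, B) (fun q : G ⧸ H ↦ g • q) p u)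
      (mfderiv 𝓘(ℝ, B) 𝓘(ℝ, B) (fun q : G ⧸ H ↦ g • q) p v) = h.inner p u v

end Homogeneous

end

/-! Everything is reduced to the bilinear form `secondDiff`, S(u, v) = (φ^*∇)_u (dφ V) with V the
coordinate field extending v. It involves no connection on the source, and it is symmetric because ∇
is torsion-free.

Both notions of pluriharmonicity say S(u, v) + S(Ju, Jv) = 0. If DJ = 0 and T^{1,1} = 0, the
Christoffel symbols of D have no (1,1)-part, so the correction dφ(D_u V) drops out of (∇dφ)^{1,1}
(`isGeneralizedPluriharmonic_iff`). On a Riemann surface with a conformal metric, the trace of ∇dψ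
is S(e, e) + S(Je, Je) for a unit vector e. Composition with a holomorphic curve adds nothing to
this sum, since the second derivative of a holomorphic map is complex bilinear. Complex lines in
charts realise every tangent direction, and polarization recovers the whole form
(`isPluriharmonic_iff`).

On the side of G/H, each X in 𝔤 gives a section g ↦ d/dt g exp(tX) H of π^*T(G/H) (`orbitDeriv`),
zero exactly for X in 𝔥. Torsion-freeness reads ∇_X Y - ∇_Y X = π_*[X, Y], so ∇_X Y = π_*[X, Y] for
X in 𝔥. For arguments in 𝔪 the expression ⟨∇_X Y, Z⟩ is symmetric in X, Y because [𝔪, 𝔪] ⊆ 𝔥, and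
skew in Y, Z because the metric is invariant and parallel; hence it vanishes
(`IsLeviCivita.orbitSecond_eq_zero`). Along a framing this gives S(u, v) = π_* P(u, v) with P(u, v)
= u(α_𝔪 V) + [α_𝔥 u, α_𝔪 v] (`IsLeviCivita.secondDiff_mk_comp`).

Differentiating Ad(H)𝔪 ⊆ 𝔪 gives [𝔥, 𝔪] ⊆ 𝔪, so P takes values in 𝔪, where π_* is injective. Thus P
inherits the symmetry of S, and f is pluriharmonic iff P(u, v) + P(Ju, Jv) = 0. Expanding the
framing equation in terms of P, its real part vanishes by symmetry and its imaginary part at (u, Jv)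
is half of P(u, v) + P(Ju, Jv) (`framingEquation_iff`). -/

set_option linter.unusedSectionVars false

noncomputable section

/-! ### Coordinate vector fields and derivatives in the preferred charts. -/

section TangentCharts

variable {A : Type*} [NormedAddCommGroup A] [NormedSpace ℝ A]
  {S : Type*} [TopologicalSpace S] [ChartedSpace A S] [IsManifold 𝓘(ℝ, A) ∞ S]
  {B : Type*} [NormedAddCommGroup B] [NormedSpace ℝ B]
  {N : Type*} [TopologicalSpace N] [ChartedSpace B N] [IsManifold 𝓘(ℝ, B) ∞ N]
  {W : Type*} [NormedAddCommGroup W] [NormedSpace ℝ W]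

lemma trivializationAt_snd_eq_mfderiv {p q : N} (hq : q ∈ (chartAt B p).source)
    (w : TangentSpace 𝓘(ℝ, B) q) :
    ((trivializationAt B (TangentSpace 𝓘(ℝ, B) : N → Type _) p) ⟨q, w⟩).2 =
      mvfderiv 𝓘(ℝ, B) (extChartAt 𝓘(ℝ, B) p) q w := by
  have h := congrArg (fun T ↦ T w)
    (TangentBundle.continuousLinearMapAt_trivializationAt (I := 𝓘(ℝ, B)) hq)
  refine Eq.trans ?_ h
  exact (congrFun (Trivialization.coe_linearMapAt_of_mem (R := ℝ)
    (trivializationAt B (TangentSpace 𝓘(ℝ, B) : N → Type _) p) hq) w).symm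

lemma trivializationAt_symm_self (p : N) (w : B) :
    (trivializationAt B (TangentSpace 𝓘(ℝ, B) : N → Type _) p).symm p w = w := by
  have h := congrArg (fun T ↦ T w)
    (TangentBundle.symmL_trivializationAt (I := 𝓘(ℝ, B)) (mem_chart_source B p))
  rw [mfderivWithin_range_extChartAt_symm] at h
  exact (Trivialization.symmL_apply (R := ℝ) _ (mem_chart_source B p) w).symm.trans h

/-- Thus `extend` is the coordinate vector field with constant coefficients `v` in the chart at `x`,
which turns the invariant definitions into coordinate formulas. -/
lemma extend_eq_mfderiv_symm {x y : S} (hy : y ∈ (chartAt A x).source)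
    (v : TangentSpace 𝓘(ℝ, A) x) :
    (extend A v y : TangentSpace 𝓘(ℝ, A) y) =
      mfderiv 𝓘(ℝ, A) 𝓘(ℝ, A) (extChartAt 𝓘(ℝ, A) x).symm (extChartAt 𝓘(ℝ, A) x y) v := by
  have h := congrArg (fun T ↦ T v) (TangentBundle.symmL_trivializationAt (I := 𝓘(ℝ, A)) hy)
  have h1 : ((trivializationAt A (TangentSpace 𝓘(ℝ, A)) x) ⟨x, v⟩).2 = v := by
    rw [trivializationAt_snd_eq_mfderiv (mem_chart_source A x), mvfderiv, mfderiv_extChartAt_self]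
    rfl
  rw [modelWithCornersSelf_coe, Set.range_id, mfderivWithin_univ] at h
  unfold extend
  rw [h1]
  exact (Trivialization.symmL_apply (R := ℝ)
    (trivializationAt A (TangentSpace 𝓘(ℝ, A) : S → Type _) x) hy v).symm.trans h

lemma mfderiv_extChartAt_extend {x y : S} (hy : y ∈ (chartAt A x).source)
    (v : TangentSpace 𝓘(ℝ, A) x) :
    mvfderiv 𝓘(ℝ, A) (extChartAt 𝓘(ℝ, A) x) y (extend A v y) = v := by
  rw [extend_eq_mfderiv_symm hy]
  have h := mfderiv_extChartAt_comp_mfderivWithin_extChartAt_symm' (I := 𝓘(ℝ, A)) (x := x) (y := y)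
    (by simpa using hy)
  rw [modelWithCornersSelf_coe, Set.range_id, mfderivWithin_univ] at h
  exact congrArg (fun T ↦ T v) h

lemma mdifferentiableAt_extChartAt_symm {x y : S} (hy : y ∈ (chartAt A x).source) :
    MDifferentiableAt 𝓘(ℝ, A) 𝓘(ℝ, A) (extChartAt 𝓘(ℝ, A) x).symm (extChartAt 𝓘(ℝ, A) x y) := by
  have h := mdifferentiableWithinAt_extChartAt_symm (I := 𝓘(ℝ, A)) (x := x)
    (z := extChartAt 𝓘(ℝ, A) x y) ((extChartAt 𝓘(ℝ, A) x).map_source (by simpa using hy))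
  rwa [modelWithCornersSelf_coe, Set.range_id, mdifferentiableWithinAt_univ] at h

lemma mvfderiv_extend {x y : S} (hy : y ∈ (chartAt A x).source) {ψ : S → W}
    (hψ : MDifferentiableAt 𝓘(ℝ, A) 𝓘(ℝ, W) ψ y) (v : TangentSpace 𝓘(ℝ, A) x) :
    mvfderiv 𝓘(ℝ, A) ψ y (extend A v y) =
      fderiv ℝ (ψ ∘ (extChartAt 𝓘(ℝ, A) x).symm) (extChartAt 𝓘(ℝ, A) x y) v := by
  have hy' : y ∈ (extChartAt 𝓘(ℝ, A) x).source := by simpa using hy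
  have h := mfderiv_comp_of_eq (I := 𝓘(ℝ, A)) (I' := 𝓘(ℝ, A)) (I'' := 𝓘(ℝ, W)) hψ
    (mdifferentiableAt_extChartAt_symm hy) ((extChartAt 𝓘(ℝ, A) x).left_inv hy')
  rw [← mfderiv_eq_fderiv, h, extend_eq_mfderiv_symm hy]
  have e := (extChartAt 𝓘(ℝ, A) x).left_inv hy'
  unfold mvfderiv
  rw [e]
  rfl

lemma mvfderiv_eq_fderiv_comp_symm {x : S} {ψ : S → W}
    (hψ : MDifferentiableAt 𝓘(ℝ, A) 𝓘(ℝ, W) ψ x) :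
    (mvfderiv 𝓘(ℝ, A) ψ x : A →L[ℝ] W) =
      fderiv ℝ (ψ ∘ (extChartAt 𝓘(ℝ, A) x).symm) (extChartAt 𝓘(ℝ, A) x x) := by
  have h := hψ.mvfderiv
  rw [modelWithCornersSelf_coe, Set.range_id, fderivWithin_univ] at h
  exact h

lemma mvfderiv_comp_extChartAt {x : S} {h : A → W}
    (hh : DifferentiableAt ℝ h (extChartAt 𝓘(ℝ, A) x x)) :
    (mvfderiv 𝓘(ℝ, A) (fun y ↦ h (extChartAt 𝓘(ℝ, A) x y)) x : A →L[ℝ] W) =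
      fderiv ℝ h (extChartAt 𝓘(ℝ, A) x x) := by
  have := mfderiv_comp (I := 𝓘(ℝ, A)) (I' := 𝓘(ℝ, A)) (I'' := 𝓘(ℝ, W)) x
    hh.mdifferentiableAt (mdifferentiableAt_extChartAt (I := 𝓘(ℝ, A)) (mem_chart_source A x))
  rw [mfderiv_extChartAt_self, mfderiv_eq_fderiv] at this
  exact this

lemma Filter.EventuallyEq.mvfderiv_eq {x : S} {ψ ψ' : S → W} (h : ψ =ᶠ[𝓝 x] ψ') :
    (mvfderiv 𝓘(ℝ, A) ψ x : A →L[ℝ] W) = mvfderiv 𝓘(ℝ, A) ψ' x :=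
  h.mfderiv_eq

lemma lieBracketWithin_univ_eq_zero_of_eventuallyEq_const {z u v : A} {U V : A → A}
    (hU : U =ᶠ[𝓝 z] fun _ ↦ u) (hV : V =ᶠ[𝓝 z] fun _ ↦ v) :
    lieBracketWithin ℝ U V Set.univ z = 0 := by
  rw [lieBracketWithin_univ, hU.lieBracket_vectorField_eq hV]
  simp [lieBracket]

/-- Pulled back to the chart, both fields are constant near the point. For this reason the torsion
is the antisymmetrized Christoffel symbol and the bracket term of `extDerivOneForm` disappears. -/
lemma mlieBracket_extend (x : S) (u v : TangentSpace 𝓘(ℝ, A) x) :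
    mlieBracket 𝓘(ℝ, A) (extend A u) (extend A v) x = 0 := by
  have key (w : TangentSpace 𝓘(ℝ, A) x) :
      mpullbackWithin 𝓘(ℝ, A) 𝓘(ℝ, A) (extChartAt 𝓘(ℝ, A) x).symm
        (fun y ↦ extend A w y) (Set.range 𝓘(ℝ, A)) =ᶠ[𝓝 (extChartAt 𝓘(ℝ, A) x x)] fun _ ↦ w := by
    filter_upwards [extChartAt_target_mem_nhds (I := 𝓘(ℝ, A)) x] with z hz
    have hz' : (extChartAt 𝓘(ℝ, A) x).symm z ∈ (chartAt A x).source := by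
      simpa using (extChartAt 𝓘(ℝ, A) x).map_target hz
    rw [mpullbackWithin_apply, extend_eq_mfderiv_symm hz', (extChartAt 𝓘(ℝ, A) x).right_inv hz]
    have h := isInvertible_mfderivWithin_extChartAt_symm (I := 𝓘(ℝ, A)) hz
    rw [modelWithCornersSelf_coe, Set.range_id, mfderivWithin_univ] at h ⊢
    exact congrArg (fun T ↦ T w) h.inverse_comp_self
  rw [← mlieBracketWithin_univ, mlieBracketWithin_apply]
  simp only [Set.preimage_univ, Set.univ_inter]
  have hu := key u
  have hv := key v
  rw [modelWithCornersSelf_coe, Set.range_id] at hu hv ⊢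
  have hb := lieBracketWithin_univ_eq_zero_of_eventuallyEq_const hu hv
  exact (congrArg _ hb).trans (map_zero _)

end TangentCharts

lemma two_le_infty : (2 : ℕ∞ω) ≤ ∞ := WithTop.coe_le_coe.2 le_top

/-! ### Christoffel symbols and the second differential of a map. -/

section SecondDifferential

variable {A : Type*} [NormedAddCommGroup A] [NormedSpace ℝ A]
  {S : Type*} [TopologicalSpace S] [ChartedSpace A S] [IsManifold 𝓘(ℝ, A) ∞ S]
  {B : Type*} [NormedAddCommGroup B] [NormedSpace ℝ B]
  {N : Type*} [TopologicalSpace N] [ChartedSpace B N] [IsManifold 𝓘(ℝ, B) ∞ N]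

/-- The Christoffel symbol `∇_v W` of the coordinate vector field `W` extending `w`. -/
def christoffel (nabla : CovariantDerivative 𝓘(ℝ, B) B (TangentSpace 𝓘(ℝ, B) : N → Type _))
    (p : N) (v w : B) : B :=
  nabla (extend (x := p) B w) p v

variable (A B) in
/-- The differential of `φ` at `x` as a map between the model spaces. -/
def modelDeriv (φ : S → N) (x : S) : A →L[ℝ] B :=
  mfderiv 𝓘(ℝ, A) 𝓘(ℝ, B) φ x

/-- `(φ^*∇)_u (dφ V)` for the coordinate vector field `V` extending `v`. -/
def secondDiff (nabla : CovariantDerivative 𝓘(ℝ, B) B (TangentSpace 𝓘(ℝ, B) : N → Type _))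
    (φ : S → N) (x : S) (u v : A) : B :=
  pullbackConnection nabla φ (fun y ↦ mfderiv 𝓘(ℝ, A) 𝓘(ℝ, B) φ y (extend (x := x) A v y)) x u

variable (nabla : CovariantDerivative 𝓘(ℝ, B) B (TangentSpace 𝓘(ℝ, B) : N → Type _))

lemma extend_add_eventuallyEq {x : S} (v w : TangentSpace 𝓘(ℝ, A) x) :
    ∀ᶠ y in 𝓝 x, (extend A v + extend A w : Π y : S, TangentSpace 𝓘(ℝ, A) y) y =
      extend A (v + w) y := by
  filter_upwards [(chartAt A x).open_source.mem_nhds (mem_chart_source A x)] with y hy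
  simp only [Pi.add_apply, extend_eq_mfderiv_symm hy]
  exact (map_add _ _ _).symm

lemma extend_smul_eventuallyEq {x : S} (c : ℝ) (v : TangentSpace 𝓘(ℝ, A) x) :
    ∀ᶠ y in 𝓝 x, (c • extend A v : Π y : S, TangentSpace 𝓘(ℝ, A) y) y = extend A (c • v) y := by
  filter_upwards [(chartAt A x).open_source.mem_nhds (mem_chart_source A x)] with y hy
  simp only [Pi.smul_apply, extend_eq_mfderiv_symm hy]
  exact (map_smul _ _ _).symm

lemma CovariantDerivative.congr_of_eventuallyEq {σ σ' : Π y : N, TangentSpace 𝓘(ℝ, B) y} {p : N}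
    (hσ' : MDifferentiableAt 𝓘(ℝ, B) 𝓘(ℝ, B).tangent
      (fun y ↦ (⟨y, σ' y⟩ : TangentBundle 𝓘(ℝ, B) N)) p)
    (h : ∀ᶠ y in 𝓝 p, σ y = σ' y) : nabla σ p = nabla σ' p := by
  refine nabla.isCovariantDerivativeOnUniv.congr_of_eventuallyEq ?_ hσ' Filter.univ_mem h
  refine hσ'.congr_of_eventuallyEq ?_
  filter_upwards [h] with y hy
  rw [hy]

lemma christoffel_add_left (p : N) (v v' w : B) :
    christoffel nabla p (v + v') w = christoffel nabla p v w + christoffel nabla p v' w :=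
  map_add (nabla (extend (x := p) B w) p) v v'

lemma christoffel_smul_left (p : N) (c : ℝ) (v w : B) :
    christoffel nabla p (c • v) w = c • christoffel nabla p v w :=
  map_smul (nabla (extend (x := p) B w) p) c v

/-- A connection is not tensorial in this slot, but near `p` the coordinate field depends linearly
on `w`, and a connection is local. -/
lemma christoffel_add_right (p : N) (v w w' : B) :
    christoffel nabla p v (w + w') = christoffel nabla p v w + christoffel nabla p v w' := by
  have h := nabla.isCovariantDerivativeOnUniv.add (x := p)
    (mdifferentiableAt_extend (x := p) 𝓘(ℝ, B) B w)
    (mdifferentiableAt_extend (x := p) 𝓘(ℝ, B) B w')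
  have h' := nabla.congr_of_eventuallyEq (mdifferentiableAt_extend 𝓘(ℝ, B) B _)
    (extend_add_eventuallyEq (x := p) w w')
  exact congrArg (fun T ↦ T v) (h'.symm.trans h)

lemma christoffel_smul_right (p : N) (c : ℝ) (v w : B) :
    christoffel nabla p v (c • w) = c • christoffel nabla p v w := by
  have h := nabla.isCovariantDerivativeOnUniv.smul_const (x := p) c
    (mdifferentiableAt_extend (x := p) 𝓘(ℝ, B) B w)
  have h' := nabla.congr_of_eventuallyEq (mdifferentiableAt_extend 𝓘(ℝ, B) B _)
    (extend_smul_eventuallyEq (x := p) c w)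
  exact congrArg (fun T ↦ T v) (h'.symm.trans h)

lemma christoffel_zero_right (p : N) (v : B) : christoffel nabla p v 0 = 0 := by
  have := christoffel_smul_right nabla p 0 v 0
  rwa [zero_smul, zero_smul] at this

lemma torsion_eq_christoffel [FiniteDimensional ℝ B] (p : N) (v w : B) :
    (nabla.torsion p : B →L[ℝ] B →L[ℝ] B) v w = christoffel nabla p v w - christoffel nabla p w v := by
  have h := nabla.torsion_apply_eq_extend (x := p) v w
  have h1 : mlieBracket 𝓘(ℝ, B) (extend (x := p) B v) (extend (x := p) B w) p = 0 :=
    mlieBracket_extend p v w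
  have h2 : nabla (extend (x := p) B w) p (extend (x := p) B v p) =
      nabla (extend (x := p) B w) p v := congrArg _ (extend_apply_self ..)
  have h3 : nabla (extend (x := p) B v) p (extend (x := p) B w p) =
      nabla (extend (x := p) B v) p w := congrArg _ (extend_apply_self ..)
  refine h.trans ((congrArg (_ - ·) h1).trans ((sub_zero _).trans ?_))
  exact congrArg₂ (· - ·) h2 h3

lemma christoffel_symm [FiniteDimensional ℝ B] (h : nabla.torsion = 0) (p : N)
    (v w : B) : christoffel nabla p v w = christoffel nabla p w v := by
  have := torsion_eq_christoffel nabla p v w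
  rw [h] at this
  exact (sub_eq_zero.1 this.symm)

lemma pullbackConnection_eq (φ : S → N) (s : Π x : S, TangentSpace 𝓘(ℝ, B) (φ x)) (x : S)
    (u : A) :
    (pullbackConnection nabla φ s x u : B) =
      (mvfderiv 𝓘(ℝ, A) (fun y ↦ ((trivializationAt B (TangentSpace 𝓘(ℝ, B) : N → Type _) (φ x))
        ⟨φ y, s y⟩).2) x : A →L[ℝ] B) u +
      christoffel nabla (φ x) (modelDeriv A B φ x u) (s x) :=
  congrArg (· + _) (trivializationAt_symm_self (φ x) _)

variable (A B) in
/-- The expression of `φ` in the preferred charts at `x` and `φ x`. -/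
def chartRep (φ : S → N) (x : S) : A → B :=
  extChartAt 𝓘(ℝ, B) (φ x) ∘ φ ∘ (extChartAt 𝓘(ℝ, A) x).symm

lemma contDiffAt_chartRep {φ : S → N} (hφ : ContMDiff 𝓘(ℝ, A) 𝓘(ℝ, B) ∞ φ) (x : S) :
    ContDiffAt ℝ ∞ (chartRep A B φ x) (extChartAt 𝓘(ℝ, A) x x) := by
  have h := ((contMDiffAt_iff (f := φ) (x := x)).1 hφ.contMDiffAt).2
  rw [modelWithCornersSelf_coe, Set.range_id, contDiffWithinAt_univ] at h
  exact h

lemma modelDeriv_eq_fderiv_chartRep {φ : S → N} (hφ : ContMDiff 𝓘(ℝ, A) 𝓘(ℝ, B) ∞ φ) (x : S) :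
    modelDeriv A B φ x =
      fderiv ℝ (chartRep A B φ x) (extChartAt 𝓘(ℝ, A) x x) := by
  have h := (hφ.contMDiffAt (x := x)).mdifferentiableAt (by simp) |>.mfderiv
  rw [modelWithCornersSelf_coe, Set.range_id, fderivWithin_univ] at h
  exact h

lemma eventually_mem_chart_source (x : S) : ∀ᶠ y in 𝓝 x, y ∈ (chartAt A x).source :=
  (chartAt A x).open_source.mem_nhds (mem_chart_source A x)

/-- The identity holds on a neighbourhood of `x` and not only at `x`, so both sides may be
differentiated once more. -/
lemma trivializationAt_mfderiv_extend {φ : S → N} (hφ : ContMDiff 𝓘(ℝ, A) 𝓘(ℝ, B) ∞ φ) (x : S)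
    (v : TangentSpace 𝓘(ℝ, A) x) :
    (fun y ↦ ((trivializationAt B (TangentSpace 𝓘(ℝ, B) : N → Type _) (φ x))
        ⟨φ y, mfderiv 𝓘(ℝ, A) 𝓘(ℝ, B) φ y (extend A v y)⟩).2) =ᶠ[𝓝 x]
      fun y ↦ fderiv ℝ (chartRep A B φ x) (extChartAt 𝓘(ℝ, A) x y) v := by
  filter_upwards [eventually_mem_chart_source (A := A) x,
    hφ.continuous.continuousAt (x := x) |>.eventually (eventually_mem_chart_source (A := B) (φ x))]
    with y hy hy'
  rw [trivializationAt_snd_eq_mfderiv hy']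
  have h1 := mdifferentiableAt_extChartAt (I := 𝓘(ℝ, B)) hy'
  have h2 := (hφ.contMDiffAt (x := y)).mdifferentiableAt (by simp)
  have h := mvfderiv_extend hy (h1.comp y h2) v
  rw [Function.comp_assoc] at h
  refine Eq.trans ?_ h
  exact congrArg (fun T ↦ T (extend A v y)) (mfderiv_comp y h1 h2).symm

/-- The classical ∂²φ + Γ(dφ, dφ). Both summands are symmetric in `u`, `v` once the torsion
vanishes. -/
lemma secondDiff_eq {φ : S → N} (hφ : ContMDiff 𝓘(ℝ, A) 𝓘(ℝ, B) ∞ φ) (x : S)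
    (u v : A) :
    secondDiff nabla φ x u v =
      (fderiv ℝ (fderiv ℝ (chartRep A B φ x)) (extChartAt 𝓘(ℝ, A) x x) u v) +
      christoffel nabla (φ x) (modelDeriv A B φ x u) (modelDeriv A B φ x v) := by
  refine (pullbackConnection_eq nabla φ _ x u).trans ?_
  refine congrArg₂ (fun a b ↦ a + christoffel nabla (φ x) (modelDeriv A B φ x u) b) ?_
    (congrArg (modelDeriv A B φ x) (extend_apply_self A
      (E := (TangentSpace 𝓘(ℝ, A) : S → Type _)) (x := x) v))
  refine (congrArg (fun T : A →L[ℝ] B ↦ T u)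
    (trivializationAt_mfderiv_extend hφ x v).mvfderiv_eq).trans ?_
  have hd : DifferentiableAt ℝ (fderiv ℝ (chartRep A B φ x)) (extChartAt 𝓘(ℝ, A) x x) :=
    ((contDiffAt_chartRep hφ x).fderiv_right (m := 1) (WithTop.coe_le_coe.2 le_top)).differentiableAt
      (by simp)
  have h := mvfderiv_comp_extChartAt (x := x)
    (h := fun z ↦ fderiv ℝ (chartRep A B φ x) z v) (hd.clm_apply (differentiableAt_const _))
  refine (congrArg (fun T ↦ T u) h).trans ?_
  rw [fderiv_clm_apply hd (differentiableAt_const _)]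
  simp only [fderiv_fun_const, Pi.zero_apply, ContinuousLinearMap.comp_zero, zero_add]
  rfl

lemma secondDiff_symm [FiniteDimensional ℝ B] (h : nabla.torsion = 0) {φ : S → N}
    (hφ : ContMDiff 𝓘(ℝ, A) 𝓘(ℝ, B) ∞ φ) (x : S) (u v : A) :
    secondDiff nabla φ x u v = secondDiff nabla φ x v u := by
  rw [secondDiff_eq nabla hφ x u v, secondDiff_eq nabla hφ x v u, christoffel_symm nabla h]
  congr 1
  exact ((contDiffAt_chartRep hφ x).isSymmSndFDerivAt
    (by simpa using two_le_infty)).eq u v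

end SecondDifferential

/-! ### Complex manifolds, connections of Nijenhuis type, composition with holomorphic maps. -/

section ComplexManifold

variable {E : Type*} [NormedAddCommGroup E] [NormedSpace ℂ E]
  {M : Type*} [TopologicalSpace M] [ChartedSpace E M]
  {E' : Type*} [NormedAddCommGroup E'] [NormedSpace ℂ E']
  {S : Type*} [TopologicalSpace S] [ChartedSpace E' S]
  {B : Type*} [NormedAddCommGroup B] [NormedSpace ℝ B]
  {N : Type*} [TopologicalSpace N] [ChartedSpace B N] [IsManifold 𝓘(ℝ, B) ∞ N]

lemma HasMFDerivAt.restrictScalars_real {φ : S → M} {z : S} {φ' : E' →L[ℂ] E}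
    (h : HasMFDerivAt 𝓘(ℂ, E') 𝓘(ℂ, E) φ z φ') :
    HasMFDerivAt 𝓘(ℝ, E') 𝓘(ℝ, E) φ z (φ'.restrictScalars ℝ : E' →L[ℝ] E) :=
  ⟨h.1, HasFDerivWithinAt.restrictScalars (𝕜 := ℝ) (𝕜' := ℂ) (f' := φ') h.2⟩

lemma ContMDiff.restrictScalars_real {φ : S → M} (h : ContMDiff 𝓘(ℂ, E') 𝓘(ℂ, E) ω φ) :
    ContMDiff 𝓘(ℝ, E') 𝓘(ℝ, E) ∞ φ := by
  intro x
  have h1 := (contMDiffAt_iff (f := φ) (x := x)).1 h.contMDiffAt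
  refine contMDiffAt_iff.2 ⟨h1.1, ?_⟩
  have h2 : ContDiffWithinAt ℝ ω _ _ _ := h1.2.restrict_scalars ℝ
  exact h2.of_le (by simp)

lemma modelDeriv_I_smul_of_mdifferentiableAt {φ : S → M} {z : S}
    (h : MDifferentiableAt 𝓘(ℂ, E') 𝓘(ℂ, E) φ z) (v : E') :
    modelDeriv E' E φ z (Complex.I • v) = Complex.I • modelDeriv E' E φ z v := by
  have h1 : modelDeriv E' E φ z =
      (mfderiv 𝓘(ℂ, E') 𝓘(ℂ, E) φ z : E' →L[ℂ] E).restrictScalars ℝ :=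
    (HasMFDerivAt.restrictScalars_real h.hasMFDerivAt).mfderiv
  rw [h1]
  exact map_smul (mfderiv 𝓘(ℂ, E') 𝓘(ℂ, E) φ z : E' →L[ℂ] E) Complex.I v

lemma modelDeriv_symm_I_smul [IsManifold 𝓘(ℂ, E) ω M] {x y : M} (hy : y ∈ (chartAt E x).source)
    (v : E) :
    modelDeriv E E (extChartAt 𝓘(ℝ, E) x).symm (extChartAt 𝓘(ℝ, E) x y) (Complex.I • v) =
      Complex.I • modelDeriv E E (extChartAt 𝓘(ℝ, E) x).symm (extChartAt 𝓘(ℝ, E) x y) v := by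
  have : IsManifold 𝓘(ℂ, E) 1 M := IsManifold.of_le (n := ω) le_top
  have h := mdifferentiableWithinAt_extChartAt_symm (I := 𝓘(ℂ, E)) (x := x)
    (z := extChartAt 𝓘(ℂ, E) x y) ((extChartAt 𝓘(ℂ, E) x).map_source (by simpa using hy))
  rw [modelWithCornersSelf_coe, Set.range_id, mdifferentiableWithinAt_univ] at h
  exact modelDeriv_I_smul_of_mdifferentiableAt h v

variable [IsManifold 𝓘(ℂ, E) ω M] [IsManifold 𝓘(ℂ, E') ω S]

/-- The inverse of a holomorphic chart has complex linear differential, so J takes coordinate fields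
to coordinate fields. -/
lemma extend_complexStructure {x y : M} (hy : y ∈ (chartAt E x).source)
    (v : TangentSpace 𝓘(ℝ, E) x) :
    (extend E (complexStructure x v) y : TangentSpace 𝓘(ℝ, E) y) =
      complexStructure y (extend E v y) := by
  rw [extend_eq_mfderiv_symm hy, extend_eq_mfderiv_symm hy]
  exact modelDeriv_symm_I_smul hy v

lemma christoffel_I_smul [FiniteDimensional ℂ E]
    {D : CovariantDerivative 𝓘(ℝ, E) E (TangentSpace 𝓘(ℝ, E) : M → Type _)}
    (hD : IsNijenhuisType D) (x : M) (u v : E) :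
    christoffel D x u (Complex.I • v) = Complex.I • christoffel D x u v := by
  have h1 := hD.complex x u (extend (x := x) E v) (mdifferentiableAt_extend 𝓘(ℝ, E) E _)
  refine Eq.trans ?_ h1
  have h2 := CovariantDerivative.congr_of_eventuallyEq D (p := x)
    (σ := fun y ↦ complexStructure y (extend (x := x) E v y))
    (σ' := extend (x := x) E (complexStructure x v))
    (mdifferentiableAt_extend 𝓘(ℝ, E) E _) (by
      filter_upwards [eventually_mem_chart_source (A := E) x] with y hy
      exact (extend_complexStructure hy v).symm)
  exact (congrArg (fun T ↦ T u) h2).symm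

omit [IsManifold 𝓘(ℂ, E) ω M] in
lemma I_smul_I_smul (v : E) : Complex.I • Complex.I • v = -v := by
  rw [smul_smul, Complex.I_mul_I, neg_one_smul]

/-- Call the left side S(u, v). It is symmetric by T^{1,1} = 0, and DJ = 0 makes it complex linear
in v and antilinear in u. Moving J from one slot to the other gives JS = -JS. -/
lemma IsNijenhuisType.christoffel_oneOne [FiniteDimensional ℂ E]
    {D : CovariantDerivative 𝓘(ℝ, E) E (TangentSpace 𝓘(ℝ, E) : M → Type _)}
    (hD : IsNijenhuisType D) (x : M) (u v : E) :
    christoffel D x u v + christoffel D x (Complex.I • u) (Complex.I • v) = 0 := by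
  have : FiniteDimensional ℝ E := FiniteDimensional.complexToReal E
  set S : E → E → E := fun u v ↦
    christoffel D x u v + christoffel D x (Complex.I • u) (Complex.I • v) with hS
  have hneg (u v : E) : christoffel D x (-u) v = -christoffel D x u v := by
    simpa using christoffel_smul_left D x (-1) u v
  have hsymm (u v : E) : S u v = S v u := by
    have h := hD.torsion x u v
    have h1 := torsion_eq_christoffel D x u v
    have h2 := torsion_eq_christoffel D x (Complex.I • u) (Complex.I • v)
    have h3 : (1 / 2 : ℝ) • ((D.torsion x : E →L[ℝ] E →L[ℝ] E) u v +
      (D.torsion x : E →L[ℝ] E →L[ℝ] E) (Complex.I • u) (Complex.I • v)) = 0 := h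
    rw [h1, h2, smul_eq_zero_iff_right (by norm_num)] at h3
    simp only [hS]
    rw [← sub_eq_zero]
    refine Eq.trans ?_ h3
    abel
  have hr (u v : E) : S u (Complex.I • v) = Complex.I • S u v := by
    simp only [hS]
    rw [christoffel_I_smul hD, christoffel_I_smul hD _ _ (Complex.I • v), smul_add]
  have hl (u v : E) : S (Complex.I • u) v = -(Complex.I • S u v) := by
    simp only [hS, christoffel_I_smul hD]
    rw [I_smul_I_smul, hneg, smul_add, I_smul_I_smul, smul_neg]
    abel
  have h1 : Complex.I • S u v = -(Complex.I • S u v) :=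
    (hr u v).symm.trans ((hsymm _ _).trans ((hl v u).trans (by rw [hsymm v u])))
  have h2 : Complex.I • S u v = 0 := by
    have h3 : (2 : ℝ) • (Complex.I • S u v) = 0 := by
      rw [two_smul]
      exact add_eq_zero_iff_eq_neg.2 h1
    exact (smul_eq_zero_iff_right two_ne_zero).1 h3
  exact (smul_eq_zero_iff_right Complex.I_ne_zero).1 h2

lemma nablaDiff_eq (D : CovariantDerivative 𝓘(ℝ, E) E (TangentSpace 𝓘(ℝ, E) : M → Type _))
    (nabla : CovariantDerivative 𝓘(ℝ, B) B (TangentSpace 𝓘(ℝ, B) : N → Type _)) (φ : M → N) (x : M)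
    (u v : E) : (nablaDiff D nabla φ x u v : B) =
      secondDiff nabla φ x u v - modelDeriv E B φ x (christoffel D x u v) :=
  rfl

/-- The right side does not mention `D`: its contribution is the image under dφ of a vanishing
(1,1)-part. -/
lemma isGeneralizedPluriharmonic_iff [FiniteDimensional ℂ E]
    {D : CovariantDerivative 𝓘(ℝ, E) E (TangentSpace 𝓘(ℝ, E) : M → Type _)}
    (hD : IsNijenhuisType D)
    (nabla : CovariantDerivative 𝓘(ℝ, B) B (TangentSpace 𝓘(ℝ, B) : N → Type _)) (φ : M → N) :
    IsGeneralizedPluriharmonic D nabla φ ↔ ∀ (x : M) (u v : E),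
      secondDiff nabla φ x u v + secondDiff nabla φ x (Complex.I • u) (Complex.I • v) = 0 := by
  refine forall_congr' fun x ↦ forall_congr' fun (u : E) ↦ forall_congr' fun (v : E) ↦ ?_
  have h1 : (oneOnePart (nablaDiff D nabla φ x) u v : B) = (1 / 2 : ℝ) •
    ((secondDiff nabla φ x u v - modelDeriv E B φ x (christoffel D x u v)) +
     (secondDiff nabla φ x (Complex.I • u : E) (Complex.I • v : E) -
      modelDeriv E B φ x (christoffel D x (Complex.I • u : E) (Complex.I • v : E)))) := rfl
  have h2 : ((secondDiff nabla φ x u v - modelDeriv E B φ x (christoffel D x u v)) +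
     (secondDiff nabla φ x (Complex.I • u : E) (Complex.I • v : E) -
      modelDeriv E B φ x (christoffel D x (Complex.I • u : E) (Complex.I • v : E)))) =
      secondDiff nabla φ x u v + secondDiff nabla φ x (Complex.I • u : E) (Complex.I • v : E) := by
    have h3 := congrArg (modelDeriv E B φ x) (hD.christoffel_oneOne x u v)
    rw [map_add, map_zero] at h3
    rw [sub_add_sub_comm, h3, sub_zero]
  rw [h2] at h1
  constructor
  · intro h
    have h4 := h1.symm.trans h
    exact (smul_eq_zero_iff_right (by norm_num)).1 h4
  · intro h
    refine h1.trans ?_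
    rw [h, smul_zero]
    rfl

/-! ### Holomorphic maps -/

lemma fderiv_fderiv_comp {X Y Z : Type*} [NormedAddCommGroup X] [NormedSpace ℝ X]
    [NormedAddCommGroup Y] [NormedSpace ℝ Y] [NormedAddCommGroup Z] [NormedSpace ℝ Z]
    {g : Y → Z} {k : X → Y} {z : X} (hg : ContDiffAt ℝ ∞ g (k z)) (hk : ContDiffAt ℝ ∞ k z)
    (u v : X) :
    fderiv ℝ (fderiv ℝ (g ∘ k)) z u v =
      fderiv ℝ (fderiv ℝ g) (k z) (fderiv ℝ k z u) (fderiv ℝ k z v) +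
        fderiv ℝ g (k z) (fderiv ℝ (fderiv ℝ k) z u v) := by
  have one_le : (1 : ℕ∞ω) + 1 ≤ ∞ := by simpa [one_add_one_eq_two] using two_le_infty
  have h1 : fderiv ℝ (g ∘ k) =ᶠ[𝓝 z] fun y ↦ (fderiv ℝ g (k y)).comp (fderiv ℝ k y) := by
    have hg' := (hg.of_le two_le_infty).eventually (by simp)
    have hk' := (hk.of_le two_le_infty).eventually (by simp)
    filter_upwards [hk.continuousAt.eventually hg', hk'] with y h1 h2
    exact fderiv_comp y (h1.differentiableAt (by simp)) (h2.differentiableAt (by simp))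
  have hdg : DifferentiableAt ℝ (fderiv ℝ g) (k z) :=
    (hg.fderiv_right (m := 1) one_le).differentiableAt (by simp)
  have hdk : DifferentiableAt ℝ (fderiv ℝ k) z :=
    (hk.fderiv_right (m := 1) one_le).differentiableAt (by simp)
  have hk1 : DifferentiableAt ℝ k z := hk.differentiableAt (by simp)
  have h2 := (hdg.hasFDerivAt.comp z hk1.hasFDerivAt).clm_comp hdk.hasFDerivAt
  rw [h1.fderiv_eq, show fderiv ℝ (fun y ↦ (fderiv ℝ g (k y)).comp (fderiv ℝ k y)) z = _ from
    h2.fderiv]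
  simp [add_comm]

/-- The real second derivative of a holomorphic map is complex linear in one slot, hence by symmetry
in both, and i² = -1. -/
lemma fderiv_fderiv_I_smul {k : E' → E} {z : E'} (hk : ContDiffAt ℂ ω k z) (u : E') :
    fderiv ℝ (fderiv ℝ k) z (Complex.I • u) (Complex.I • u) = -fderiv ℝ (fderiv ℝ k) z u u := by
  have one_le : (1 : ℕ∞ω) + 1 ≤ ω := le_top
  have hkR : ContDiffAt ℝ ω k z := hk.restrict_scalars ℝ
  have hd : DifferentiableAt ℝ (fderiv ℝ k) z :=
    (hkR.fderiv_right (m := 1) one_le).differentiableAt (by simp)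
  have h1 (w : E') : (fun y ↦ fderiv ℝ k y (Complex.I • w)) =ᶠ[𝓝 z]
      fun y ↦ Complex.I • fderiv ℝ k y w := by
    filter_upwards [hk.eventually (by simp)] with y hy
    have := (hy.differentiableAt (by simp)).fderiv_restrictScalars ℝ
    simp [this]
  have h2 (a w : E') : fderiv ℝ (fderiv ℝ k) z a (Complex.I • w) =
      Complex.I • fderiv ℝ (fderiv ℝ k) z a w := by
    have h3 := congrArg (fun T ↦ T a) ((h1 w).fderiv_eq (𝕜 := ℝ))
    rw [fderiv_clm_apply hd (differentiableAt_const _), fderiv_fun_const_smul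
      (hd.clm_apply (differentiableAt_const _)), fderiv_clm_apply hd (differentiableAt_const _)] at h3
    simpa using h3
  have hs := (hkR.isSymmSndFDerivAt (by simp)).eq
  rw [h2, hs, h2, I_smul_I_smul]

lemma contDiffAt_chartRep_complex {ι : S → M} (hι : ContMDiff 𝓘(ℂ, E') 𝓘(ℂ, E) ω ι) (z : S) :
    ContDiffAt ℂ ω (chartRep E' E ι z) (extChartAt 𝓘(ℝ, E') z z) := by
  have h := ((contMDiffAt_iff (f := ι) (x := z)).1 hι.contMDiffAt).2
  rw [modelWithCornersSelf_coe, Set.range_id, contDiffWithinAt_univ] at h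
  exact h

lemma modelDeriv_I_smul {ι : S → M} (hι : ContMDiff 𝓘(ℂ, E') 𝓘(ℂ, E) ω ι) (z : S) (u : E') :
    modelDeriv E' E ι z (Complex.I • u) = Complex.I • modelDeriv E' E ι z u :=
  modelDeriv_I_smul_of_mdifferentiableAt (hι.contMDiffAt.mdifferentiableAt (by simp)) u

lemma chartRep_comp {ι : S → M} (hι : Continuous ι) (φ : M → N) (z : S) :
    chartRep E' B (φ ∘ ι) z =ᶠ[𝓝 (extChartAt 𝓘(ℝ, E') z z)]
      chartRep E B φ (ι z) ∘ chartRep E' E ι z := by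
  have h1 : ContinuousAt (ι ∘ (extChartAt 𝓘(ℝ, E') z).symm) (extChartAt 𝓘(ℝ, E') z z) :=
    hι.continuousAt.comp (continuousAt_extChartAt_symm z)
  have h2 : ∀ᶠ y in 𝓝 (extChartAt 𝓘(ℝ, E') z z),
      (ι ∘ (extChartAt 𝓘(ℝ, E') z).symm) y ∈ (extChartAt 𝓘(ℝ, E) (ι z)).source := by
    refine h1.eventually (p := fun y ↦ y ∈ (extChartAt 𝓘(ℝ, E) (ι z)).source) ?_
    simp only [Function.comp_apply, extChartAt_to_inv]
    exact extChartAt_source_mem_nhds (I := 𝓘(ℝ, E)) (ι z)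
  filter_upwards [h2] with y hy
  simp only [chartRep, Function.comp_apply] at hy ⊢
  rw [(extChartAt 𝓘(ℝ, E) (ι z)).left_inv hy]

lemma modelDeriv_comp {ι : S → M} (hι : ContMDiff 𝓘(ℝ, E') 𝓘(ℝ, E) ∞ ι) {φ : M → N}
    (hφ : ContMDiff 𝓘(ℝ, E) 𝓘(ℝ, B) ∞ φ) (z : S) (u : E') :
    modelDeriv E' B (φ ∘ ι) z u = modelDeriv E B φ (ι z) (modelDeriv E' E ι z u) :=
  congrArg (fun T : E' →L[ℝ] B ↦ T u) (mfderiv_comp z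
    ((hφ.contMDiffAt (x := ι z)).mdifferentiableAt (by simp))
    ((hι.contMDiffAt (x := z)).mdifferentiableAt (by simp)))

/-- The second-order chain rule has the extra term dφ(D²ι(a, a)), and its values at a = u and a = iu
cancel by `fderiv_fderiv_I_smul`. -/
lemma secondDiff_comp_holomorphic
    (nabla : CovariantDerivative 𝓘(ℝ, B) B (TangentSpace 𝓘(ℝ, B) : N → Type _))
    {ι : S → M} (hι : ContMDiff 𝓘(ℂ, E') 𝓘(ℂ, E) ω ι) {φ : M → N}
    (hφ : ContMDiff 𝓘(ℝ, E) 𝓘(ℝ, B) ∞ φ) (z : S) (u : E') :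
    secondDiff nabla (φ ∘ ι) z u u +
      secondDiff nabla (φ ∘ ι) z (Complex.I • u) (Complex.I • u) =
    secondDiff nabla φ (ι z) (modelDeriv E' E ι z u) (modelDeriv E' E ι z u) +
      secondDiff nabla φ (ι z) (Complex.I • modelDeriv E' E ι z u)
        (Complex.I • modelDeriv E' E ι z u) := by
  have hιR := hι.restrictScalars_real
  have hk := contDiffAt_chartRep_complex hι z
  have hkz : chartRep E' E ι z (extChartAt 𝓘(ℝ, E') z z) = extChartAt 𝓘(ℝ, E) (ι z) (ι z) := by
    simp [chartRep]
  have hg := contDiffAt_chartRep hφ (ι z)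
  rw [← hkz] at hg
  have key (a : E') : secondDiff nabla (φ ∘ ι) z a a =
      secondDiff nabla φ (ι z) (modelDeriv E' E ι z a) (modelDeriv E' E ι z a) +
      fderiv ℝ (chartRep E B φ (ι z)) (extChartAt 𝓘(ℝ, E) (ι z) (ι z))
        (fderiv ℝ (fderiv ℝ (chartRep E' E ι z)) (extChartAt 𝓘(ℝ, E') z z) a a) := by
    rw [secondDiff_eq nabla (hφ.comp hιR), secondDiff_eq nabla hφ, modelDeriv_comp hιR hφ]
    have h1 := ((chartRep_comp (E := E) (E' := E') (B := B) hι.continuous φ z).fderiv (𝕜 := ℝ)).fderiv_eq (𝕜 := ℝ)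
    rw [h1, fderiv_fderiv_comp hg (contDiffAt_chartRep hιR z), hkz,
      modelDeriv_eq_fderiv_chartRep hιR]
    exact add_right_comm _ _ _
  rw [key, key, modelDeriv_I_smul hι, fderiv_fderiv_I_smul hk, map_neg]
  abel

end ComplexManifold

/-! ### Harmonic maps from Riemann surfaces with conformal metrics. -/

section RiemannSurface

variable {E : Type*} [NormedAddCommGroup E] [NormedSpace ℂ E]
  {S : Type*} [TopologicalSpace S] [ChartedSpace E S] [IsManifold 𝓘(ℂ, E) ω S]
  {B : Type*} [NormedAddCommGroup B] [NormedSpace ℝ B]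
  {N : Type*} [TopologicalSpace N] [ChartedSpace B N] [IsManifold 𝓘(ℝ, B) ∞ N]

/-- The scalar product of a metric at `x` as a bilinear form on the model space. -/
def PseudoRiemannianMetric.modelInner {A : Type*} [NormedAddCommGroup A] [NormedSpace ℝ A]
    {S : Type*} [TopologicalSpace S] [ChartedSpace A S] [IsManifold 𝓘(ℝ, A) ∞ S]
    (g : PseudoRiemannianMetric A S) (x : S) : A →L[ℝ] A →L[ℝ] ℝ :=
  g.inner x

lemma IsLeviCivita.mvfderiv_inner_extend {A : Type*} [NormedAddCommGroup A] [NormedSpace ℝ A]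
    [FiniteDimensional ℝ A]
    {S : Type*} [TopologicalSpace S] [ChartedSpace A S] [IsManifold 𝓘(ℝ, A) ∞ S]
    {g : PseudoRiemannianMetric A S}
    {D : CovariantDerivative 𝓘(ℝ, A) A (TangentSpace 𝓘(ℝ, A) : S → Type _)}
    (hD : IsLeviCivita g D) (x : S) (u v w : A) :
    (mvfderiv 𝓘(ℝ, A) (fun y ↦ g.inner y (extend (x := x) A v y) (extend (x := x) A w y)) x :
      A →L[ℝ] ℝ) u =
      g.modelInner x (christoffel D x u v) w + g.modelInner x v (christoffel D x u w) := by
  have h := hD.metric x u (extend (x := x) A v) (extend (x := x) A w)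
    (mdifferentiableAt_extend 𝓘(ℝ, A) A _) (mdifferentiableAt_extend 𝓘(ℝ, A) A _)
  have hv := extend_apply_self A (E := (TangentSpace 𝓘(ℝ, A) : S → Type _)) (x := x) v
  have hw := extend_apply_self A (E := (TangentSpace 𝓘(ℝ, A) : S → Type _)) (x := x) w
  exact h.trans (congrArg₂ (· + ·) (congrArg (g.modelInner x (christoffel D x u v)) hw)
    (congrArg (fun a : A ↦ g.modelInner x a (christoffel D x u w)) hv))

lemma exists_eq_smul_add_smul_I (hE : Module.finrank ℂ E = 1) {u : E} (hu : u ≠ 0) (w : E) :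
    ∃ a b : ℝ, w = a • u + b • (Complex.I • u) := by
  obtain ⟨c, rfl⟩ := (finrank_eq_one_iff_of_nonzero' u hu).1 hE w
  refine ⟨c.re, c.im, ?_⟩
  rw [← Complex.coe_smul, ← Complex.coe_smul, smul_smul, ← add_smul, Complex.re_add_im]

variable [FiniteDimensional ℂ E]

/-- A holomorphic coordinate is isothermal, and isothermal coordinates are harmonic. The coordinate
fields u and Ju are orthogonal of equal length at every point near `x`; differentiating these
relations along u and Ju shows that the sum is orthogonal to u, and likewise to Ju. -/
lemma IsLeviCivita.christoffel_oneOne (hE : Module.finrank ℂ E = 1)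
    {g : PseudoRiemannianMetric E S}
    {D : CovariantDerivative 𝓘(ℝ, E) E (TangentSpace 𝓘(ℝ, E) : S → Type _)}
    (hg : g.IsRiemannian)
    (hJ : ∀ x u v, g.inner x (complexStructure x u) (complexStructure x v) = g.inner x u v)
    (hD : IsLeviCivita g D) (x : S) (u : E) :
    christoffel D x u u + christoffel D x (Complex.I • u) (Complex.I • u) = 0 := by
  by_cases hu : u = 0
  · simp [hu, christoffel_zero_right]
  set G := g.modelInner x with hG
  have hGs (a b : E) : G a b = G b a := g.symm x a b
  have hGJ (a b : E) : G (Complex.I • a) (Complex.I • b) = G a b := hJ x a b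
  have hself (y : S) (a : TangentSpace 𝓘(ℝ, E) y) : g.inner y (complexStructure y a) a = 0 := by
    have h1 := hJ y (complexStructure y a) a
    have h2 : complexStructure y (complexStructure y a) = -a := I_smul_I_smul (E := E) a
    rw [h2, g.symm y (complexStructure y a) a, map_neg, neg_apply] at h1
    rw [g.symm]
    linarith
  set q : E → E → E → ℝ := fun a v w ↦
    (mvfderiv 𝓘(ℝ, E) (fun y ↦ g.inner y (extend (x := x) E v y) (extend (x := x) E w y)) x :
      E →L[ℝ] ℝ) a with hq
  have hqe (a v w : E) : q a v w = G (christoffel D x a v) w + G v (christoffel D x a w) :=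
    hD.mvfderiv_inner_extend x a v w
  have hqJ (a v w : E) : q a (Complex.I • v) (Complex.I • w) = q a v w := by
    refine congrArg (fun T : E →L[ℝ] ℝ ↦ T a) (Filter.EventuallyEq.mvfderiv_eq ?_)
    filter_upwards [eventually_mem_chart_source (A := E) x] with y hy
    refine Eq.trans ?_ (hJ y _ _)
    exact congrArg₂ (fun a b ↦ g.inner y a b) (extend_complexStructure hy v)
      (extend_complexStructure hy w)
  have hq0 (a v : E) : q a (Complex.I • v) v = 0 := by
    have h1 : (fun y ↦ g.inner y (extend (x := x) E (Complex.I • v) y) (extend (x := x) E v y))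
        =ᶠ[𝓝 x] fun _ ↦ (0 : ℝ) := by
      filter_upwards [eventually_mem_chart_source (A := E) x] with y hy
      refine Eq.trans ?_ (hself y (extend (x := x) E v y))
      exact congrArg (fun a ↦ g.inner y a _) (extend_complexStructure hy v)
    refine (congrArg (fun T : E →L[ℝ] ℝ ↦ T a) h1.mvfderiv_eq).trans ?_
    rw [mvfderiv_const]
    rfl
  have : FiniteDimensional ℝ E := FiniteDimensional.complexToReal E
  have key (a : E) :
      G (christoffel D x a a + christoffel D x (Complex.I • a) (Complex.I • a)) a = 0 := by
    have h1 := hqe a a a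
    have h2 := hqe (Complex.I • a) (Complex.I • a) a
    have h3 := hqe a (Complex.I • a) (Complex.I • a)
    rw [hq0, christoffel_symm D hD.torsion_eq_zero x (Complex.I • a) a] at h2
    rw [hqJ, h1] at h3
    rw [map_add, add_apply]
    rw [hGs a] at h3
    rw [hGs (christoffel D x a (Complex.I • a))] at h3
    linarith
  have hneg : christoffel D x (-u) (-u) = christoffel D x u u := by
    have h1 := christoffel_smul_left D x (-1) u (-u)
    have h2 := christoffel_smul_right D x (-1) u u
    simp only [neg_smul, one_smul] at h1 h2
    rw [h1, h2, neg_neg]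
  -- Replacing u by Ju only permutes the two summands, so their sum is orthogonal to Ju as well.
  have key2 := key (Complex.I • u)
  rw [I_smul_I_smul, hneg, add_comm] at key2
  obtain ⟨a, b, hab⟩ := exists_eq_smul_add_smul_I hE hu
    (christoffel D x u u + christoffel D x (Complex.I • u) (Complex.I • u))
  by_contra hne
  have hpos : 0 < G _ _ := hg x _ hne
  have h0 : G (christoffel D x u u + christoffel D x (Complex.I • u) (Complex.I • u))
      (christoffel D x u u + christoffel D x (Complex.I • u) (Complex.I • u)) = 0 := by
    conv_lhs => rw [hab]
    rw [hGs, ← hab]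
    nth_rw 2 [hab]
    rw [map_add, map_smul, map_smul, key, key2]
    simp
  exact hpos.ne' h0

variable (nabla : CovariantDerivative 𝓘(ℝ, B) B (TangentSpace 𝓘(ℝ, B) : N → Type _))

lemma secondDiff_smul_smul {A : Type*} [NormedAddCommGroup A] [NormedSpace ℝ A]
    {S : Type*} [TopologicalSpace S] [ChartedSpace A S] [IsManifold 𝓘(ℝ, A) ∞ S]
    {ψ : S → N} (hψ : ContMDiff 𝓘(ℝ, A) 𝓘(ℝ, B) ∞ ψ) (x : S) (c : ℝ) (u : A) :
    secondDiff nabla ψ x (c • u) (c • u) = (c * c) • secondDiff nabla ψ x u u := by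
  rw [secondDiff_eq nabla hψ, secondDiff_eq nabla hψ]
  simp only [map_smul, smul_apply, christoffel_smul_left,
    christoffel_smul_right, smul_add, smul_smul]

lemma nablaDiff_add_nablaDiff_I (hE : Module.finrank ℂ E = 1)
    {g : PseudoRiemannianMetric E S}
    {D : CovariantDerivative 𝓘(ℝ, E) E (TangentSpace 𝓘(ℝ, E) : S → Type _)}
    (hg : g.IsRiemannian)
    (hJ : ∀ x u v, g.inner x (complexStructure x u) (complexStructure x v) = g.inner x u v)
    (hD : IsLeviCivita g D) (ψ : S → N) (x : S) (u : E) :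
    (nablaDiff D nabla ψ x u u + nablaDiff D nabla ψ x (Complex.I • u : E) (Complex.I • u : E) : B) =
      secondDiff nabla ψ x u u + secondDiff nabla ψ x (Complex.I • u) (Complex.I • u) := by
  have h := congrArg (modelDeriv E B ψ x) (hD.christoffel_oneOne hE hg hJ x u)
  rw [map_add, map_zero] at h
  refine (congrArg₂ (· + ·) (nablaDiff_eq D nabla ψ x u u)
    (nablaDiff_eq D nabla ψ x (Complex.I • u) (Complex.I • u))).trans ?_
  have key (a b c d : B) (h : b + d = 0) : a - b + (c - d) = a + c := by
    rw [sub_add_sub_comm, h, sub_zero]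
  exact key _ _ _ _ h

/-- An orthonormal basis of the real tangent plane has the form e, ±Je. The sign does not matter for
a quadratic expression, so the trace is S(e, e) + S(Je, Je). -/
lemma isHarmonicForHermitianMetrics_of_secondDiff (hE : Module.finrank ℂ E = 1)
    {ψ : S → N} (hψ : ContMDiff 𝓘(ℝ, E) 𝓘(ℝ, B) ∞ ψ)
    (h : ∀ (x : S) (u : E),
      secondDiff nabla ψ x u u + secondDiff nabla ψ x (Complex.I • u) (Complex.I • u) = 0) :
    IsHarmonicForHermitianMetrics (E := E) nabla ψ := by
  intro g D hg hJ hD x e he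
  have h2 : Module.finrank ℝ E = 2 := by rw [finrank_real_of_complex, hE]
  -- The basis is indexed by `Fin (finrank ℝ E)`, which equals `Fin 2` only propositionally.
  set f : Fin 2 → E := fun i ↦ e ((finCongr h2).symm i) with hf
  have hsum : (∑ i, nablaDiff D nabla ψ x (e i) (e i) : B) =
      ∑ i : Fin 2, (nablaDiff D nabla ψ x (f i) (f i) : B) :=
    ((finCongr h2).symm.sum_comp (fun i ↦ (nablaDiff D nabla ψ x (e i) (e i) : B))).symm
  refine hsum.trans ?_
  set G := g.modelInner x with hG
  have hfG (i j : Fin 2) : G (f i) (f j) = if i = j then 1 else 0 := by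
    refine (he _ _).trans ?_
    simp
  have hGs (a b : E) : G a b = G b a := g.symm x a b
  have hGJ (a b : E) : G (Complex.I • a) (Complex.I • b) = G a b := hJ x a b
  have h00 : G (f 0) (f 0) = 1 := by simpa using hfG 0 0
  have h01 : G (f 0) (f 1) = 0 := by simpa using hfG 0 1
  have h11 : G (f 1) (f 1) = 1 := by simpa using hfG 1 1
  have h0 : f 0 ≠ 0 := by
    intro h
    rw [h, map_zero] at h00
    simp at h00
  have hJ0 : G (f 0) (Complex.I • f 0) = 0 := by
    have h1 := hGJ (f 0) (Complex.I • f 0)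
    rw [I_smul_I_smul, map_neg, hGs] at h1
    linarith
  obtain ⟨a, b, hab⟩ := exists_eq_smul_add_smul_I hE h0 (f 1)
  have ha : a = 0 := by
    have h1 := h01
    rw [hab, map_add, map_smul, map_smul, h00, hJ0] at h1
    simpa using h1
  rw [ha, zero_smul, zero_add] at hab
  have hb : b * b = 1 := by
    have h1 := h11
    have h4 (w : E) : G (b • w) (b • w) = b * b * G w w := by
      rw [(G (b • w)).map_smul, hGs, (G w).map_smul, smul_eq_mul, smul_eq_mul, mul_assoc]
    rwa [hab, h4, hGJ, h00, mul_one] at h1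
  rw [Fin.sum_univ_two]
  have h3 : (nablaDiff D nabla ψ x (f 1) (f 1) : B) =
      nablaDiff D nabla ψ x (Complex.I • f 0 : E) (Complex.I • f 0 : E) := by
    refine (nablaDiff_eq D nabla ψ x (f 1) (f 1)).trans
      (Eq.trans ?_ (nablaDiff_eq D nabla ψ x (Complex.I • f 0) (Complex.I • f 0)).symm)
    rw [hab, secondDiff_smul_smul nabla hψ, christoffel_smul_left, christoffel_smul_right, smul_smul,
      hb, one_smul, one_smul]
  refine (congrArg (_ + ·) h3).trans ?_
  exact (nablaDiff_add_nablaDiff_I nabla hE hg hJ hD ψ x (f 0)).trans (h x (f 0))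

end RiemannSurface

/-! ### The flat metric and connection on a manifold with one global chart. -/

section FlatChart

variable {A : Type*} [NormedAddCommGroup A] [NormedSpace ℝ A]
  {S : Type*} [TopologicalSpace S] [ChartedSpace A S] [IsManifold 𝓘(ℝ, A) ∞ S]

lemma MDifferentiableAt.differentiableAt_comp_symm {W : Type*} [NormedAddCommGroup W]
    [NormedSpace ℝ W] {ψ : S → W} {x : S} (hψ : MDifferentiableAt 𝓘(ℝ, A) 𝓘(ℝ, W) ψ x) :
    DifferentiableAt ℝ (ψ ∘ (extChartAt 𝓘(ℝ, A) x).symm) (extChartAt 𝓘(ℝ, A) x x) := by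
  have h := ((mdifferentiableAt_iff (I := 𝓘(ℝ, A)) (I' := 𝓘(ℝ, W)) ψ x).1 hψ).2
  rw [modelWithCornersSelf_coe, Set.range_id, differentiableWithinAt_univ] at h
  exact h

lemma mvfderiv_clm_apply₂ {W W' W'' : Type*} [NormedAddCommGroup W] [NormedSpace ℝ W]
    [NormedAddCommGroup W'] [NormedSpace ℝ W'] [NormedAddCommGroup W''] [NormedSpace ℝ W'']
    (b : W →L[ℝ] W' →L[ℝ] W'') {Y : S → W} {Z : S → W'} {x : S}
    (hY : MDifferentiableAt 𝓘(ℝ, A) 𝓘(ℝ, W) Y x) (hZ : MDifferentiableAt 𝓘(ℝ, A) 𝓘(ℝ, W') Z x)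
    (u : A) :
    (mvfderiv 𝓘(ℝ, A) (fun y ↦ b (Y y) (Z y)) x : A →L[ℝ] W'') u =
      b ((mvfderiv 𝓘(ℝ, A) Y x : A →L[ℝ] W) u) (Z x) +
        b (Y x) ((mvfderiv 𝓘(ℝ, A) Z x : A →L[ℝ] W') u) := by
  have hY' := hY.differentiableAt_comp_symm
  have hZ' := hZ.differentiableAt_comp_symm
  have hb : MDifferentiableAt 𝓘(ℝ, A) 𝓘(ℝ, W'') (fun y ↦ b (Y y) (Z y)) x :=
    ((b.contMDiff (n := 1)).mdifferentiable (by simp) (Y x) |>.comp x hY).clm_apply hZ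
  rw [mvfderiv_eq_fderiv_comp_symm hY, mvfderiv_eq_fderiv_comp_symm hZ,
    mvfderiv_eq_fderiv_comp_symm hb]
  have h := (b.hasFDerivAt.comp _ hY'.hasFDerivAt).clm_apply hZ'.hasFDerivAt
  refine (congrArg (fun T : A →L[ℝ] W'' ↦ T u) h.fderiv).trans ?_
  refine Eq.trans ?_ (add_comm _ _)
  simp only [Function.comp_apply, extChartAt_to_inv]
  rfl

/-- The hypothesis `hc` encodes a single global chart. All tangent trivializations are then the
identity of the model space, and vector fields are plain functions. -/
lemma trivializationAt_snd_of_chartAt_eq (hc : ∀ x y : S, chartAt A x = chartAt A y) (p q : S)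
    (w : A) : ((trivializationAt A (TangentSpace 𝓘(ℝ, A) : S → Type _) p) ⟨q, w⟩).2 = w := by
  have hq : q ∈ (chartAt A p).source := hc q p ▸ mem_chart_source A q
  have h : extChartAt 𝓘(ℝ, A) p = extChartAt 𝓘(ℝ, A) q := by
    rw [extChartAt, extChartAt, hc p q]
  refine (trivializationAt_snd_eq_mfderiv hq w).trans ?_
  rw [h, mvfderiv, mfderiv_extChartAt_self]
  rfl

lemma extend_of_chartAt_eq (hc : ∀ x y : S, chartAt A x = chartAt A y) (p q : S) (w : A) :
    (extend (x := p) A w : Π q : S, TangentSpace 𝓘(ℝ, A) q) q = w := by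
  have hq : q ∈ (chartAt A p).source := hc q p ▸ mem_chart_source A q
  refine (trivializationAt_snd_of_chartAt_eq hc p q _).symm.trans ?_
  exact (trivializationAt_snd_eq_mfderiv hq _).trans (mfderiv_extChartAt_extend hq w)

lemma symmL_of_chartAt_eq (hc : ∀ x y : S, chartAt A x = chartAt A y) (p q : S) (w : A) :
    ((trivializationAt A (TangentSpace 𝓘(ℝ, A) : S → Type _) p).symmL ℝ q : A →L[ℝ] A) w = w := by
  have hq : q ∈ (chartAt A p).source := hc q p ▸ mem_chart_source A q
  refine (trivializationAt_snd_of_chartAt_eq hc p q _).symm.trans ?_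
  refine Eq.trans ?_ (congrArg Prod.snd
    ((trivializationAt A (TangentSpace 𝓘(ℝ, A) : S → Type _) p).apply_mk_symm hq w))
  exact congrArg (fun a : TangentSpace 𝓘(ℝ, A) q ↦
    ((trivializationAt A (TangentSpace 𝓘(ℝ, A) : S → Type _) p) ⟨q, a⟩).2)
      (Trivialization.symmL_apply (R := ℝ) _ hq w)

lemma mdifferentiableAt_of_chartAt_eq (hc : ∀ x y : S, chartAt A x = chartAt A y)
    {σ : Π y : S, TangentSpace 𝓘(ℝ, A) y} {x : S}
    (h : MDifferentiableAt 𝓘(ℝ, A) 𝓘(ℝ, A).tangent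
      (fun y ↦ (⟨y, σ y⟩ : TangentBundle 𝓘(ℝ, A) S)) x) :
    MDifferentiableAt 𝓘(ℝ, A) 𝓘(ℝ, A) (fun y ↦ (σ y : A)) x := by
  have h1 := (mdifferentiableAt_section 𝓘(ℝ, A) σ).1 h
  refine h1.congr_of_eventuallyEq (.of_forall fun y ↦ ?_)
  exact (trivializationAt_snd_of_chartAt_eq hc x y _).symm

/-- The connection for which the coordinate vector fields of a global chart are parallel. -/
def flatConnection (hc : ∀ x y : S, chartAt A x = chartAt A y) :
    CovariantDerivative 𝓘(ℝ, A) A (TangentSpace 𝓘(ℝ, A) : S → Type _) where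
  toFun σ x := mvfderiv 𝓘(ℝ, A) (fun y ↦ (σ y : A)) x
  isCovariantDerivativeOnUniv :=
    { add := fun hσ hσ' _ ↦ mvfderiv_add (mdifferentiableAt_of_chartAt_eq hc hσ)
        (mdifferentiableAt_of_chartAt_eq hc hσ')
      leibniz := fun hσ hg _ ↦ mvfderiv_smul hg (mdifferentiableAt_of_chartAt_eq hc hσ) }

lemma christoffel_flatConnection (hc : ∀ x y : S, chartAt A x = chartAt A y) (p : S) (v w : A) :
    christoffel (flatConnection hc) p v w = 0 := by
  have h : (fun y ↦ (extend (x := p) A w : Π q : S, TangentSpace 𝓘(ℝ, A) q) y : S → A) =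
    fun _ ↦ w := funext fun y ↦ extend_of_chartAt_eq hc p y w
  have h1 := congrArg (fun k : S → A ↦ (mvfderiv 𝓘(ℝ, A) k p : A →L[ℝ] A) v) h
  exact h1.trans (congrArg (fun T : A →L[ℝ] A ↦ T v) (mvfderiv_const w))

lemma contMDiff_of_chartAt_eq (hc : ∀ x y : S, chartAt A x = chartAt A y)
    (b : A →L[ℝ] A →L[ℝ] ℝ)
    {s : Π x : S, TangentSpace 𝓘(ℝ, A) x →L[ℝ] TangentSpace 𝓘(ℝ, A) x →L[ℝ] ℝ}
    (hs : ∀ x u v, s x u v = b u v) :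
    ContMDiff 𝓘(ℝ, A) (𝓘(ℝ, A).prod 𝓘(ℝ, A →L[ℝ] A →L[ℝ] ℝ)) ∞
    (fun x ↦ TotalSpace.mk' (A →L[ℝ] A →L[ℝ] ℝ)
      (E := fun x : S ↦ TangentSpace 𝓘(ℝ, A) x →L[ℝ] TangentSpace 𝓘(ℝ, A) x →L[ℝ] ℝ) x (s x)) := by
  intro x
  rw [contMDiffAt_section]
  refine (contMDiffAt_const (c := b)).congr_of_eventuallyEq (.of_forall fun y ↦ ?_)
  have hy : y ∈ (trivializationAt A (TangentSpace 𝓘(ℝ, A) : S → Type _) x).baseSet :=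
    show y ∈ (chartAt A x).source from hc y x ▸ mem_chart_source A y
  ext v w
  simp only [hom_trivializationAt_apply, ContinuousLinearMap.inCoordinates,
    ContinuousLinearMap.comp_apply, Trivialization.continuousLinearMapAt_apply]
  have hy' : y ∈ (trivializationAt (A →L[ℝ] ℝ)
      (fun x : S ↦ TangentSpace 𝓘(ℝ, A) x →L[ℝ] ℝ) x).baseSet := by
    rw [hom_trivializationAt_baseSet]
    exact ⟨hy, trivial⟩
  rw [Trivialization.coe_linearMapAt_of_mem _ hy']
  simp only [hom_trivializationAt_apply, ContinuousLinearMap.inCoordinates]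
  simp
  exact (hs y _ _).trans (congrArg₂ (fun v w ↦ b v w) (symmL_of_chartAt_eq hc x y v)
    (symmL_of_chartAt_eq hc x y w))

/-- The metric whose coefficients in a global chart are constant. -/
def flatMetric (hc : ∀ x y : S, chartAt A x = chartAt A y) (b : A →L[ℝ] A →L[ℝ] ℝ)
    (hsymm : ∀ u v, b u v = b v u) (hpos : ∀ u, u ≠ 0 → 0 < b u u) :
    PseudoRiemannianMetric A S where
  inner _ := b
  symm _ := hsymm
  nondegenerate x u h := by
    by_contra hu
    exact (hpos u hu).ne' (h u)
  contMDiff := contMDiff_of_chartAt_eq hc b fun _ _ _ ↦ rfl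

lemma isLeviCivita_flatConnection [FiniteDimensional ℝ A]
    (hc : ∀ x y : S, chartAt A x = chartAt A y) (b : A →L[ℝ] A →L[ℝ] ℝ)
    (hsymm : ∀ u v, b u v = b v u) (hpos : ∀ u, u ≠ 0 → 0 < b u u) :
    IsLeviCivita (flatMetric hc b hsymm hpos) (flatConnection hc) where
  torsion_eq_zero := by
    refine funext fun x ↦ ContinuousLinearMap.ext fun (u : A) ↦
      ContinuousLinearMap.ext fun (v : A) ↦ ?_
    refine (torsion_eq_christoffel (flatConnection hc) x u v).trans ?_
    rw [christoffel_flatConnection, christoffel_flatConnection, sub_zero]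
    rfl
  metric x u Y Z hY hZ :=
    (mvfderiv_clm_apply₂ b (mdifferentiableAt_of_chartAt_eq hc hY)
      (mdifferentiableAt_of_chartAt_eq hc hZ) u)

end FlatChart

/-! ### Complex lines in a chart as holomorphic curves. -/

section HolomorphicDisc

variable {E : Type*} [NormedAddCommGroup E] [NormedSpace ℂ E]
  {M : Type*} [TopologicalSpace M] [ChartedSpace E M]

/-- The domain of the complex line `z ↦ x + z u` in the preferred chart at `x`. -/
def discDomain (x : M) (u : E) : TopologicalSpace.Opens ℂ where
  carrier := (fun z : ℂ ↦ chartAt E x x + z • u) ⁻¹' (chartAt E x).target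
  is_open' := (chartAt E x).open_target.preimage (by fun_prop)

/-- The complex line `z ↦ x + z u` in the preferred chart at `x`. -/
def disc (x : M) (u : E) (z : discDomain x u) : M :=
  (chartAt E x).symm (chartAt E x x + (z : ℂ) • u)

/-- The centre of the disc. -/
def discZero (x : M) (u : E) : discDomain x u :=
  ⟨0, by simp [discDomain]⟩

lemma disc_discZero (x : M) (u : E) : disc x u (discZero x u) = x := by
  simp [disc, discZero]

variable [IsManifold 𝓘(ℂ, E) ω M]

lemma contMDiff_disc (x : M) (u : E) : ContMDiff 𝓘(ℂ, ℂ) 𝓘(ℂ, E) ω (disc x u) := by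
  have h := contMDiffOn_chart_symm (I := 𝓘(ℂ, E)) (n := ω) (x := x)
  have h1 : ContMDiff 𝓘(ℂ, ℂ) 𝓘(ℂ, E) ω
      (fun z : discDomain x u ↦ chartAt E x x + (z : ℂ) • u) := by
    have h2 : ContDiff ℂ ω (fun z : ℂ ↦ chartAt E x x + z • u) := by fun_prop
    exact h2.contMDiff.comp contMDiff_subtype_val
  exact h.comp_contMDiff h1 fun z ↦ z.2

/-- In the chart the disc is the affine map z ↦ x + z u. This gives both the immersion property for
u ≠ 0 and the velocity u at the centre. -/
lemma mfderiv_chart_disc (x : M) (u : E) (z : discDomain x u) (w : ℂ) :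
    (mfderiv 𝓘(ℂ, E) 𝓘(ℂ, E) (chartAt E x) (disc x u z) : E →L[ℂ] E)
      ((mfderiv 𝓘(ℂ, ℂ) 𝓘(ℂ, E) (disc x u) z : ℂ →L[ℂ] E) w) = w • u := by
  have hz : disc x u z ∈ (chartAt E x).source := (chartAt E x).map_target z.2
  have h1 : MDifferentiableAt 𝓘(ℂ, E) 𝓘(ℂ, E) (chartAt E x) (disc x u z) :=
    (contMDiffAt_of_mem_maximalAtlas (n := ω)
      (IsManifold.chart_mem_maximalAtlas x) hz).mdifferentiableAt (by simp)
  have h2 := (contMDiff_disc x u z).mdifferentiableAt (by simp)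
  have h3 : (chartAt E x) ∘ disc x u = fun z : discDomain x u ↦ chartAt E x x + (z : ℂ) • u :=
    funext fun z ↦ (chartAt E x).right_inv z.2
  have h4 : HasMFDerivAt 𝓘(ℂ, ℂ) 𝓘(ℂ, ℂ) (Subtype.val : discDomain x u → ℂ) z
      (ContinuousLinearMap.id ℂ ℂ) := by
    have h5 : MDifferentiableAt 𝓘(ℂ, ℂ) 𝓘(ℂ, ℂ) (Subtype.val : discDomain x u → ℂ) z :=
      (contMDiff_subtype_val (n := ω) z).mdifferentiableAt (by simp)
    have h6 := h5.hasMFDerivAt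
    -- The preferred chart of an open subset of ℂ is the inclusion, so this is the identity
    -- differential of a chart at its own base point.
    have h7 : mfderiv 𝓘(ℂ, ℂ) 𝓘(ℂ, ℂ) (Subtype.val : discDomain x u → ℂ) z =
        ContinuousLinearMap.id ℂ ℂ := 
      mfderiv_extChartAt_self (I := 𝓘(ℂ, ℂ)) (x := z)
    rwa [h7] at h6
  have h8 : HasFDerivAt (fun z : ℂ ↦ chartAt E x x + z • u)
      (ContinuousLinearMap.toSpanSingleton ℂ u) (z : ℂ) := by
    exact (ContinuousLinearMap.toSpanSingleton ℂ u).hasFDerivAt.const_add (chartAt E x x)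
  have h9 := (h8.hasMFDerivAt.comp z h4).mfderiv
  have h10 := mfderiv_comp z h1 h2
  rw [h3] at h10
  refine (congrArg (fun T : ℂ →L[ℂ] E ↦ T w) (h10.symm.trans h9)).trans ?_
  rfl

lemma mfderiv_disc_injective (x : M) {u : E} (hu : u ≠ 0) (z : discDomain x u) :
    Function.Injective (mfderiv 𝓘(ℂ, ℂ) 𝓘(ℂ, E) (disc x u) z) := by
  intro (w : ℂ) (w' : ℂ) h
  have h1 := congrArg (mfderiv 𝓘(ℂ, E) 𝓘(ℂ, E) (chartAt E x) (disc x u z) : E →L[ℂ] E) h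
  exact smul_left_injective ℂ hu
    ((mfderiv_chart_disc x u z w).symm.trans (h1.trans (mfderiv_chart_disc x u z w')))

lemma modelDeriv_disc (x : M) (u : E) :
    modelDeriv ℂ E (disc x u) (discZero x u) 1 = u := by
  have h := ((contMDiff_disc x u (discZero x u)).mdifferentiableAt (by simp)).hasMFDerivAt
  have h1 : modelDeriv ℂ E (disc x u) (discZero x u) = _ :=
    (HasMFDerivAt.restrictScalars_real h).mfderiv
  rw [h1]
  have h2 := mfderiv_chart_disc x u (discZero x u) 1
  rw [one_smul] at h2
  refine Eq.trans ?_ h2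
  have h3 : (mfderiv 𝓘(ℂ, E) 𝓘(ℂ, E) (chartAt E x) (disc x u (discZero x u)) : E →L[ℂ] E) =
      ContinuousLinearMap.id ℂ E := by
    rw [disc_discZero]
    have : IsManifold 𝓘(ℂ, E) 1 M := IsManifold.of_le (n := ω) le_top
    exact mfderiv_extChartAt_self (I := 𝓘(ℂ, E)) (x := x)
  rw [h3]
  rfl

lemma chartAt_discDomain (x : M) (u : E) (z w : discDomain x u) : chartAt ℂ z = chartAt ℂ w :=
  rfl

end HolomorphicDisc

/-! ### Pluriharmonicity as the vanishing of the (1,1)-part of the second differential. -/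

section Pluriharmonic

variable {E : Type*} [NormedAddCommGroup E] [NormedSpace ℂ E]
  {M : Type*} [TopologicalSpace M] [ChartedSpace E M] [IsManifold 𝓘(ℂ, E) ω M]
  {B : Type*} [NormedAddCommGroup B] [NormedSpace ℝ B]
  {N : Type*} [TopologicalSpace N] [ChartedSpace B N] [IsManifold 𝓘(ℝ, B) ∞ N]
  {nabla : CovariantDerivative 𝓘(ℝ, B) B (TangentSpace 𝓘(ℝ, B) : N → Type _)}

/-- Harmonicity is tested on the disc through `x` in direction `u`, with the flat metric and the
orthonormal basis 1, i: the Christoffel symbols are zero there and only `secondDiff` remains. -/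
lemma IsPluriharmonic.secondDiff_disc {φ : M → N} (hφ : ContMDiff 𝓘(ℝ, E) 𝓘(ℝ, B) ∞ φ)
    (h : IsPluriharmonic (E := E) nabla φ) (x : M) {u : E} (hu : u ≠ 0) :
    secondDiff nabla φ x u u + secondDiff nabla φ x (Complex.I • u) (Complex.I • u) = 0 := by
  have hc := chartAt_discDomain x u
  let b : ℂ →L[ℝ] ℂ →L[ℝ] ℝ := innerSL ℝ
  have hsymm (u v : ℂ) : b u v = b v u := real_inner_comm v u
  have hpos (u : ℂ) (hu : u ≠ 0) : 0 < b u u := real_inner_self_pos.2 hu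
  have h1 := h (discDomain x u) (disc x u) (contMDiff_disc x u) (mfderiv_disc_injective x hu)
    (flatMetric hc b hsymm hpos) (flatConnection hc) (fun _ ↦ hpos) (fun _ (v : ℂ) (w : ℂ) ↦ by
      change inner ℝ (Complex.I • v) (Complex.I • w) = inner ℝ v w
      simp [Complex.inner]) (isLeviCivita_flatConnection hc b hsymm hpos)
    (discZero x u)
  have h2 : Module.finrank ℝ ℂ = 2 := Complex.finrank_real_complex
  have h3 := h1 (Complex.basisOneI.reindex (finCongr h2.symm)) (by
    intro i j
    change inner ℝ (Complex.basisOneI.reindex (finCongr h2.symm) i)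
      (Complex.basisOneI.reindex (finCongr h2.symm) j) = _
    obtain ⟨i, rfl⟩ := (finCongr h2.symm).surjective i
    obtain ⟨j, rfl⟩ := (finCongr h2.symm).surjective j
    simp only [Module.Basis.reindex_apply, Equiv.symm_apply_apply, EmbeddingLike.apply_eq_iff_eq]
    fin_cases i <;> fin_cases j <;> simp [Complex.inner])
  have h4 (v : ℂ) : (nablaDiff (flatConnection hc) nabla (φ ∘ disc x u) (discZero x u) v v : B) =
      secondDiff nabla (φ ∘ disc x u) (discZero x u) v v := by
    refine (nablaDiff_eq (flatConnection hc) nabla (φ ∘ disc x u) (discZero x u) v v).trans ?_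
    rw [christoffel_flatConnection, map_zero, sub_zero]
  have h5 : secondDiff nabla (φ ∘ disc x u) (discZero x u) (1 : ℂ) (1 : ℂ) +
      secondDiff nabla (φ ∘ disc x u) (discZero x u) (Complex.I • (1 : ℂ)) (Complex.I • (1 : ℂ)) = 0 := by
    refine Eq.trans ?_ h3
    refine Eq.trans ?_ ((finCongr h2.symm).sum_comp (fun i ↦
      (nablaDiff (flatConnection hc) nabla (φ ∘ disc x u) (discZero x u)
        (Complex.basisOneI.reindex (finCongr h2.symm) i : ℂ)
        (Complex.basisOneI.reindex (finCongr h2.symm) i : ℂ) : B)))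
    refine Eq.trans ?_ (Finset.sum_congr rfl fun i _ ↦ (h4 _).symm)
    refine Eq.trans ?_ (Fin.sum_univ_two (M := B) _).symm
    simp
  rw [secondDiff_comp_holomorphic nabla (contMDiff_disc x u) hφ, modelDeriv_disc] at h5
  rwa [disc_discZero] at h5

/-- Complex curves see only the diagonal of the form; symmetry, which comes from torsion-freeness,
recovers the rest. -/
lemma secondDiff_polarization [FiniteDimensional ℝ B] (ht : nabla.torsion = 0) {φ : M → N}
    (hφ : ContMDiff 𝓘(ℝ, E) 𝓘(ℝ, B) ∞ φ) (x : M)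
    (h : ∀ u : E,
      secondDiff nabla φ x u u + secondDiff nabla φ x (Complex.I • u) (Complex.I • u) = 0)
    (u v : E) :
    secondDiff nabla φ x u v + secondDiff nabla φ x (Complex.I • u) (Complex.I • v) = 0 := by
  have hadd (a b : E) : secondDiff nabla φ x (a + b) (a + b) = secondDiff nabla φ x a a +
      secondDiff nabla φ x b b + (2 : ℝ) • secondDiff nabla φ x a b := by
    have h1 := secondDiff_symm nabla ht hφ x b a
    simp only [secondDiff_eq nabla hφ] at h1 ⊢
    simp only [map_add, add_apply, christoffel_add_left, christoffel_add_right]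
    rw [two_smul]
    nth_rewrite 2 [← h1]
    abel
  have h1 := h (u + v)
  have hu := h u
  have hv := h v
  rw [smul_add, hadd, hadd] at h1
  have h2 : (2 : ℝ) • (secondDiff nabla φ x u v +
      secondDiff nabla φ x (Complex.I • u) (Complex.I • v)) = 0 := by
    have key (a b c d e f : B) (h : a + b + (2 : ℝ) • c + (d + e + (2 : ℝ) • f) = 0)
        (h1 : a + d = 0) (h2 : b + e = 0) : (2 : ℝ) • (c + f) = 0 := by
      rw [← h, smul_add, eq_neg_of_add_eq_zero_left h1, eq_neg_of_add_eq_zero_left h2]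
      abel
    exact key _ _ _ _ _ _ h1 hu hv
  exact (smul_eq_zero.1 h2).resolve_left two_ne_zero

lemma isPluriharmonic_iff [FiniteDimensional ℝ B] (ht : nabla.torsion = 0) {φ : M → N}
    (hφ : ContMDiff 𝓘(ℝ, E) 𝓘(ℝ, B) ∞ φ) :
    IsPluriharmonic (E := E) nabla φ ↔ ∀ (x : M) (u v : E),
      secondDiff nabla φ x u v + secondDiff nabla φ x (Complex.I • u) (Complex.I • v) = 0 := by
  refine ⟨fun h x ↦ secondDiff_polarization ht hφ x fun u ↦ ?_, fun h ↦ ?_⟩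
  · by_cases hu : u = 0
    · have := secondDiff_smul_smul nabla hφ x 0 u
      simp only [zero_smul, mul_zero] at this
      rw [hu, smul_zero, this, add_zero]
    · exact h.secondDiff_disc hφ x hu
  · intro S _ _ _ _ _ ι hι _
    refine isHarmonicForHermitianMetrics_of_secondDiff nabla (Module.finrank_self ℂ)
      (hφ.comp hι.restrictScalars_real) fun z w ↦ ?_
    rw [secondDiff_comp_holomorphic nabla hι hφ]
    exact h _ _ _

end Pluriharmonic

/-! ### The Lie bracket of vector fields as a commutator of derivations. -/

section Commutator

variable {A : Type*} [NormedAddCommGroup A] [NormedSpace ℝ A]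
  {S : Type*} [TopologicalSpace S] [ChartedSpace A S] [IsManifold 𝓘(ℝ, A) ∞ S]
  {W : Type*} [NormedAddCommGroup W] [NormedSpace ℝ W]

/-- The coefficients of a vector field with respect to the preferred chart at `x`. -/
def fieldRep (Y : Π y : S, TangentSpace 𝓘(ℝ, A) y) (x y : S) : A :=
  (mvfderiv 𝓘(ℝ, A) (extChartAt 𝓘(ℝ, A) x) y : A →L[ℝ] A) (Y y)

lemma fieldRep_self (Y : Π y : S, TangentSpace 𝓘(ℝ, A) y) (x : S) : fieldRep Y x x = Y x := by
  rw [fieldRep, mvfderiv, mfderiv_extChartAt_self]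
  rfl

lemma extend_mvfderiv_extChartAt {x y : S} (hy : y ∈ (chartAt A x).source)
    (w : TangentSpace 𝓘(ℝ, A) y) :
    (extend (x := x) A (mvfderiv 𝓘(ℝ, A) (extChartAt 𝓘(ℝ, A) x) y w) y :
      TangentSpace 𝓘(ℝ, A) y) = w := by
  refine (extend_eq_mfderiv_symm hy _).trans ?_
  have h := mfderivWithin_extChartAt_symm_comp_mfderiv_extChartAt' (I := 𝓘(ℝ, A)) (x := x) (y := y)
    (by simpa using hy)
  rw [modelWithCornersSelf_coe, Set.range_id, mfderivWithin_univ] at h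
  exact congrArg (fun T ↦ T w) h

lemma mvfderiv_apply_field {x y : S} (hy : y ∈ (chartAt A x).source) {ψ : S → W}
    (hψ : MDifferentiableAt 𝓘(ℝ, A) 𝓘(ℝ, W) ψ y) (Y : Π y : S, TangentSpace 𝓘(ℝ, A) y) :
    (mvfderiv 𝓘(ℝ, A) ψ y : A →L[ℝ] W) (Y y) =
      fderiv ℝ (ψ ∘ (extChartAt 𝓘(ℝ, A) x).symm) (extChartAt 𝓘(ℝ, A) x y) (fieldRep Y x y) := by
  refine Eq.trans ?_ (mvfderiv_extend (A := A) hy hψ (fieldRep (A := A) Y x y))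
  exact congrArg (mvfderiv 𝓘(ℝ, A) ψ y : A →L[ℝ] W) (extend_mvfderiv_extChartAt hy (Y y)).symm

lemma mdifferentiableAt_fieldRep {Y : Π y : S, TangentSpace 𝓘(ℝ, A) y} {x : S}
    (hY : MDifferentiableAt 𝓘(ℝ, A) 𝓘(ℝ, A).tangent
      (fun y ↦ (⟨y, Y y⟩ : TangentBundle 𝓘(ℝ, A) S)) x) :
    MDifferentiableAt 𝓘(ℝ, A) 𝓘(ℝ, A) (fieldRep Y x) x := by
  refine ((mdifferentiableAt_section 𝓘(ℝ, A) Y).1 hY).congr_of_eventuallyEq ?_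
  filter_upwards [eventually_mem_chart_source (A := A) x] with y hy
  exact (trivializationAt_snd_eq_mfderiv hy (Y y)).symm

/-- The preferred chart at `x` has identity differential at `x`, so no Jacobian enters the
coordinate formula. -/
lemma mlieBracket_eq_fieldRep {X Y : Π y : S, TangentSpace 𝓘(ℝ, A) y} {x : S}
    (hX : MDifferentiableAt 𝓘(ℝ, A) 𝓘(ℝ, A).tangent
      (fun y ↦ (⟨y, X y⟩ : TangentBundle 𝓘(ℝ, A) S)) x)
    (hY : MDifferentiableAt 𝓘(ℝ, A) 𝓘(ℝ, A).tangent
      (fun y ↦ (⟨y, Y y⟩ : TangentBundle 𝓘(ℝ, A) S)) x) :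
    (mlieBracket 𝓘(ℝ, A) X Y x : A) =
      (mvfderiv 𝓘(ℝ, A) (fieldRep Y x) x : A →L[ℝ] A) (X x) -
        (mvfderiv 𝓘(ℝ, A) (fieldRep X x) x : A →L[ℝ] A) (Y x) := by
  have key (Z : Π y : S, TangentSpace 𝓘(ℝ, A) y) :
      mpullbackWithin 𝓘(ℝ, A) 𝓘(ℝ, A) (extChartAt 𝓘(ℝ, A) x).symm
        Z (Set.range 𝓘(ℝ, A)) =ᶠ[𝓝 (extChartAt 𝓘(ℝ, A) x x)]
          fieldRep Z x ∘ (extChartAt 𝓘(ℝ, A) x).symm := by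
    filter_upwards [extChartAt_target_mem_nhds (I := 𝓘(ℝ, A)) x] with z hz
    have hz' : (extChartAt 𝓘(ℝ, A) x).symm z ∈ (chartAt A x).source := by
      simpa using (extChartAt 𝓘(ℝ, A) x).map_target hz
    rw [mpullbackWithin_apply]
    have h := isInvertible_mfderivWithin_extChartAt_symm (I := 𝓘(ℝ, A)) hz
    have h1 := (extend_eq_mfderiv_symm hz' _).symm.trans
      (extend_mvfderiv_extChartAt hz' (Z ((extChartAt 𝓘(ℝ, A) x).symm z)))
    rw [(extChartAt 𝓘(ℝ, A) x).right_inv hz] at h1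
    rw [modelWithCornersSelf_coe, Set.range_id, mfderivWithin_univ] at h ⊢
    refine (congrArg _ h1.symm).trans ?_
    exact congrArg (fun T ↦ T (mvfderiv 𝓘(ℝ, A) (extChartAt 𝓘(ℝ, A) x)
      ((extChartAt 𝓘(ℝ, A) x).symm z) (Z ((extChartAt 𝓘(ℝ, A) x).symm z)))) h.inverse_comp_self
  have hX' := key X
  have hY' := key Y
  have eX := mvfderiv_eq_fderiv_comp_symm (mdifferentiableAt_fieldRep hX)
  have eY := mvfderiv_eq_fderiv_comp_symm (mdifferentiableAt_fieldRep hY)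
  rw [eX, eY, ← mlieBracketWithin_univ, mlieBracketWithin_apply]
  simp only [Set.preimage_univ, Set.univ_inter]
  rw [modelWithCornersSelf_coe, Set.range_id] at hX' hY' ⊢
  have hb := (congrFun (lieBracketWithin_univ (𝕜 := ℝ)) _).trans
    (hX'.lieBracket_vectorField_eq hY')
  have hv (Z : Π y : S, TangentSpace 𝓘(ℝ, A) y) :
      (fieldRep Z x ∘ (extChartAt 𝓘(ℝ, A) x).symm) (extChartAt 𝓘(ℝ, A) x x) = Z x := by
    rw [Function.comp_apply, extChartAt_to_inv]
    exact fieldRep_self Z x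
  have hinv : (mfderiv 𝓘(ℝ, A) 𝓘(ℝ, A) (extChartAt 𝓘(ℝ, A) x) x : A →L[ℝ] A).inverse =
      ContinuousLinearMap.id ℝ A :=
    (congrArg ContinuousLinearMap.inverse
      (mfderiv_extChartAt_self (I := 𝓘(ℝ, A)) (x := x))).trans ContinuousLinearMap.inverse_id
  refine (congrArg (fun T : A →L[ℝ] A ↦ T _) hinv).trans ?_
  refine hb.trans ?_
  exact congrArg₂ (fun a b ↦
    fderiv ℝ (fieldRep Y x ∘ (extChartAt 𝓘(ℝ, A) x).symm) (extChartAt 𝓘(ℝ, A) x x) a -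
    fderiv ℝ (fieldRep X x ∘ (extChartAt 𝓘(ℝ, A) x).symm) (extChartAt 𝓘(ℝ, A) x x) b) (hv X) (hv Y)

lemma contDiffAt_comp_symm {ψ : S → W} {x : S} (hψ : ContMDiffAt 𝓘(ℝ, A) 𝓘(ℝ, W) ∞ ψ x) :
    ContDiffAt ℝ ∞ (ψ ∘ (extChartAt 𝓘(ℝ, A) x).symm) (extChartAt 𝓘(ℝ, A) x x) := by
  have h := ((contMDiffAt_iff (f := ψ) (x := x)).1 hψ).2
  rw [modelWithCornersSelf_coe, Set.range_id, contDiffWithinAt_univ] at h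
  exact h

lemma differentiableAt_fderiv_comp_symm {ψ : S → W} {x : S}
    (hψ : ContMDiffAt 𝓘(ℝ, A) 𝓘(ℝ, W) ∞ ψ x) :
    DifferentiableAt ℝ (fderiv ℝ (ψ ∘ (extChartAt 𝓘(ℝ, A) x).symm))
      (extChartAt 𝓘(ℝ, A) x x) :=
  ((contDiffAt_comp_symm hψ).fderiv_right (m := 1)
    (WithTop.coe_le_coe.2 le_top)).differentiableAt (by simp)

lemma mvfderiv_apply_field_eventuallyEq {ψ : S → W} {x : S}
    (hψ : ContMDiffAt 𝓘(ℝ, A) 𝓘(ℝ, W) ∞ ψ x) (Y : Π y : S, TangentSpace 𝓘(ℝ, A) y) :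
    (fun y ↦ (mvfderiv 𝓘(ℝ, A) ψ y : A →L[ℝ] W) (Y y)) =ᶠ[𝓝 x] fun y ↦
      ContinuousLinearMap.id ℝ (A →L[ℝ] W) (fderiv ℝ (ψ ∘ (extChartAt 𝓘(ℝ, A) x).symm)
        (extChartAt 𝓘(ℝ, A) x y)) (fieldRep Y x y) := by
  filter_upwards [eventually_mem_chart_source (A := A) x,
    (contMDiffAt_iff_contMDiffAt_nhds (by simp)).1 (hψ.of_le two_le_infty)] with y hy hy'
  exact mvfderiv_apply_field hy (hy'.mdifferentiableAt (by simp)) Y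

lemma mdifferentiableAt_mvfderiv_apply_field {ψ : S → W} {x : S}
    (hψ : ContMDiffAt 𝓘(ℝ, A) 𝓘(ℝ, W) ∞ ψ x) {Y : Π y : S, TangentSpace 𝓘(ℝ, A) y}
    (hY : MDifferentiableAt 𝓘(ℝ, A) 𝓘(ℝ, A).tangent
      (fun y ↦ (⟨y, Y y⟩ : TangentBundle 𝓘(ℝ, A) S)) x) :
    MDifferentiableAt 𝓘(ℝ, A) 𝓘(ℝ, W)
      (fun y ↦ (mvfderiv 𝓘(ℝ, A) ψ y : A →L[ℝ] W) (Y y)) x := by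
  refine MDifferentiableAt.congr_of_eventuallyEq ?_ (mvfderiv_apply_field_eventuallyEq hψ Y)
  have h := (differentiableAt_fderiv_comp_symm hψ).mdifferentiableAt.comp x
    (mdifferentiableAt_extChartAt (I := 𝓘(ℝ, A)) (mem_chart_source A x))
  exact MDifferentiableAt.clm_apply h (mdifferentiableAt_fieldRep hY)

lemma mvfderiv_mvfderiv_apply_field {ψ : S → W} {x : S}
    (hψ : ContMDiffAt 𝓘(ℝ, A) 𝓘(ℝ, W) ∞ ψ x) {Y : Π y : S, TangentSpace 𝓘(ℝ, A) y}
    (hY : MDifferentiableAt 𝓘(ℝ, A) 𝓘(ℝ, A).tangent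
      (fun y ↦ (⟨y, Y y⟩ : TangentBundle 𝓘(ℝ, A) S)) x) (u : A) :
    (mvfderiv 𝓘(ℝ, A) (fun y ↦ (mvfderiv 𝓘(ℝ, A) ψ y : A →L[ℝ] W) (Y y)) x : A →L[ℝ] W) u =
      fderiv ℝ (fderiv ℝ (ψ ∘ (extChartAt 𝓘(ℝ, A) x).symm)) (extChartAt 𝓘(ℝ, A) x x) u (Y x) +
      (mvfderiv 𝓘(ℝ, A) ψ x : A →L[ℝ] W)
        ((mvfderiv 𝓘(ℝ, A) (fieldRep Y x) x : A →L[ℝ] A) u) := by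
  have h := (differentiableAt_fderiv_comp_symm hψ)
  have h' := h.mdifferentiableAt.comp x
    (mdifferentiableAt_extChartAt (I := 𝓘(ℝ, A)) (mem_chart_source A x))
  rw [(mvfderiv_apply_field_eventuallyEq hψ Y).mvfderiv_eq]
  refine (mvfderiv_clm_apply₂ (ContinuousLinearMap.id ℝ (A →L[ℝ] W)) h'
    (mdifferentiableAt_fieldRep hY) u).trans ?_
  refine congrArg₂ (· + ·) ?_ ?_
  · refine congrArg₂ (fun (T : A →L[ℝ] A →L[ℝ] W) a ↦ T u a) ?_ (fieldRep_self Y x)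
    exact mvfderiv_comp_extChartAt h
  · rw [mvfderiv_eq_fderiv_comp_symm (hψ.mdifferentiableAt (by simp))]
    rfl

/-- The Lie bracket of vector fields is the commutator of the corresponding derivations. -/
lemma mvfderiv_mlieBracket {ψ : S → W} {x : S} (hψ : ContMDiffAt 𝓘(ℝ, A) 𝓘(ℝ, W) ∞ ψ x)
    {X Y : Π y : S, TangentSpace 𝓘(ℝ, A) y}
    (hX : MDifferentiableAt 𝓘(ℝ, A) 𝓘(ℝ, A).tangent
      (fun y ↦ (⟨y, X y⟩ : TangentBundle 𝓘(ℝ, A) S)) x)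
    (hY : MDifferentiableAt 𝓘(ℝ, A) 𝓘(ℝ, A).tangent
      (fun y ↦ (⟨y, Y y⟩ : TangentBundle 𝓘(ℝ, A) S)) x) :
    (mvfderiv 𝓘(ℝ, A) (fun y ↦ (mvfderiv 𝓘(ℝ, A) ψ y : A →L[ℝ] W) (Y y)) x : A →L[ℝ] W) (X x) -
      (mvfderiv 𝓘(ℝ, A) (fun y ↦ (mvfderiv 𝓘(ℝ, A) ψ y : A →L[ℝ] W) (X y)) x : A →L[ℝ] W) (Y x) =
      (mvfderiv 𝓘(ℝ, A) ψ x : A →L[ℝ] W) (mlieBracket 𝓘(ℝ, A) X Y x) := by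
  refine (congrArg₂ (· - ·) (mvfderiv_mvfderiv_apply_field hψ hY (X x))
    (mvfderiv_mvfderiv_apply_field hψ hX (Y x))).trans ?_
  have h := congrArg (mvfderiv 𝓘(ℝ, A) ψ x : A →L[ℝ] W) (mlieBracket_eq_fieldRep hX hY)
  refine Eq.trans ?_ h.symm
  -- The second-order terms of XYψ and YXψ agree; only dψ of the differentiated coefficients
  -- survives.
  have hs : fderiv ℝ (fderiv ℝ (ψ ∘ (extChartAt 𝓘(ℝ, A) x).symm)) (extChartAt 𝓘(ℝ, A) x x)
      (X x) (Y x) = fderiv ℝ (fderiv ℝ (ψ ∘ (extChartAt 𝓘(ℝ, A) x).symm))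
        (extChartAt 𝓘(ℝ, A) x x) (Y x) (X x) :=
    ((contDiffAt_comp_symm hψ).isSymmSndFDerivAt (by simpa using two_le_infty)).eq (X x) (Y x)
  have key (T : A →L[ℝ] W) (a b : W) (c d : A) (hab : a = b) : a + T c - (b + T d) = T (c - d) := by
    rw [hab, map_sub, add_sub_add_left_eq_sub]
  exact key _ _ _ _ _ hs

end Commutator

/-! ### The derivative of the adjoint action for a local group law. -/

section LocalGroup

variable {V : Type*} [NormedAddCommGroup V] [NormedSpace ℝ V] {m : V × V → V} {o : V}

/-- The derivative of the adjoint representation of a local group law `m` with unit `o`. -/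
lemma hasDerivAt_adjoint_localGroup (hm : ContDiffAt ℝ 2 m (o, o))
    (h1 : ∀ᶠ x in 𝓝 o, m (x, o) = x) (h2 : ∀ᶠ y in 𝓝 o, m (o, y) = y) {c c' : ℝ → V} {X : V} (Y : V)
    (hc : HasDerivAt c X 0) (hc' : HasDerivAt c' (-X) 0) (h0 : c 0 = o) (h0' : c' 0 = o) :
    HasDerivAt (fun t ↦ fderiv ℝ m (c t, c' t) (fderiv ℝ m (c t, o) (0, Y), 0))
      (fderiv ℝ (fderiv ℝ m) (o, o) (X, 0) (0, Y) -
        fderiv ℝ (fderiv ℝ m) (o, o) (Y, 0) (0, X)) 0 := by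
  have hd : DifferentiableAt ℝ (fderiv ℝ m) (o, o) :=
    (hm.fderiv_right (m := 1) (by norm_num)).differentiableAt (by simp)
  -- Differentiate m(x, o) = x in x. One more derivative in direction X gives `hXY`.
  have hfirst : ∀ᶠ x in 𝓝 o, ∀ Z : V, fderiv ℝ m (x, o) (Z, 0) = Z := by
    have hx : Filter.Tendsto (fun x : V ↦ (x, o)) (𝓝 o) (𝓝 (o, o)) :=
      (Continuous.prodMk_left o).continuousAt
    filter_upwards [h1.eventually_nhds, hx.eventually (hm.eventually (by simp))] with x hx1 hx2 Z
    have h3 : HasFDerivAt (fun x : V ↦ (x, o)) (ContinuousLinearMap.inl ℝ V V) x :=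
      hasFDerivAt_prodMk_left x o
    have h4 := (hx2.differentiableAt (by simp)).hasFDerivAt.comp x h3
    have h5 : HasFDerivAt (m ∘ fun x : V ↦ (x, o)) (ContinuousLinearMap.id ℝ V) x :=
      (hasFDerivAt_id x).congr_of_eventuallyEq hx1
    exact congrArg (fun T : V →L[ℝ] V ↦ T Z) (h4.unique h5)
  have hsymm := hm.isSymmSndFDerivAt (by simp)
  have hXY : fderiv ℝ (fderiv ℝ m) (o, o) (X, 0) (Y, 0) = 0 := by
    have h3 : HasFDerivAt (fun x : V ↦ (x, o)) (ContinuousLinearMap.inl ℝ V V) o :=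
      hasFDerivAt_prodMk_left o o
    have h4 := (HasFDerivAt.comp (f := fun x : V ↦ (x, o)) o hd.hasFDerivAt h3).clm_apply (hasFDerivAt_const (Y, (0 : V)) o)
    have h5 : HasFDerivAt (fun x ↦ fderiv ℝ m (x, o) (Y, (0 : V))) (0 : V →L[ℝ] V) o := by
      refine (hasFDerivAt_const Y o).congr_of_eventuallyEq ?_
      filter_upwards [hfirst] with x hx
      exact hx Y
    have h6 := congrArg (fun T : V →L[ℝ] V ↦ T X) (h4.unique h5)
    simpa using h6
  have hd1 : HasDerivAt (fun t ↦ fderiv ℝ m (c t, c' t))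
      (fderiv ℝ (fderiv ℝ m) (o, o) (X, -X)) 0 := by
    have h3 := hd.hasFDerivAt
    have h4 : (c 0, c' 0) = (o, o) := by rw [h0, h0']
    rw [← h4] at h3
    have := h3.comp_hasDerivAt (0 : ℝ) (hc.prodMk hc')
    rwa [h4] at this
  have hd2 : HasDerivAt (fun t ↦ fderiv ℝ m (c t, o))
      (fderiv ℝ (fderiv ℝ m) (o, o) (X, 0)) 0 := by
    have h3 := hd.hasFDerivAt
    have h4 : (c 0, o) = (o, o) := by rw [h0]
    rw [← h4] at h3
    have := h3.comp_hasDerivAt (0 : ℝ) (hc.prodMk (hasDerivAt_const (0 : ℝ) o))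
    rwa [h4] at this
  have hd3 : HasDerivAt (fun t ↦ ContinuousLinearMap.inl ℝ V V (fderiv ℝ m (c t, o) (0, Y)))
      (ContinuousLinearMap.inl ℝ V V (fderiv ℝ (fderiv ℝ m) (o, o) (X, 0) (0, Y))) 0 := by
    have := hd2.clm_apply (hasDerivAt_const (0 : ℝ) ((0 : V), Y))
    rw [map_zero, add_zero] at this
    exact (ContinuousLinearMap.inl ℝ V V).hasFDerivAt.comp_hasDerivAt (0 : ℝ) this
  have hsecond : fderiv ℝ m (o, o) (0, Y) = Y := by
    have h3 : HasFDerivAt (fun y : V ↦ (o, y)) (ContinuousLinearMap.inr ℝ V V) o :=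
      hasFDerivAt_prodMk_right o o
    have h4 := HasFDerivAt.comp (f := fun y : V ↦ (o, y)) o
      (hm.differentiableAt (by simp)).hasFDerivAt h3
    exact congrArg (fun T : V →L[ℝ] V ↦ T Y)
      (h4.unique ((hasFDerivAt_id o).congr_of_eventuallyEq h2))
  refine (hd1.clm_apply hd3).congr_deriv ?_
  -- The product rule gives D²m((X, -X), (Y, 0)) + D²m((X, 0), (0, Y)). In the first summand (X, 0)
  -- contributes nothing by `hXY`, which leaves -D²m((0, X), (Y, 0)).
  have hsub : (X, -X) = (X, (0 : V)) - ((0 : V), X) := by simp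
  simp only [h0, h0', hsecond, ContinuousLinearMap.inl_apply, hfirst.self_of_nhds, hsub, map_sub,
    sub_apply, hXY]
  rw [hsymm.eq (0, X) (Y, 0)]
  abel

end LocalGroup

/-! ### The Lie bracket as the derivative of Ad, and [𝔥, 𝔪] ⊆ 𝔪. -/

section LieGroupBracket

lemma hasDerivAt_extChartAt_comp {A : Type*} [NormedAddCommGroup A] [NormedSpace ℝ A]
    {S : Type*} [TopologicalSpace S] [ChartedSpace A S] {γ : ℝ → S} {p : S} (h0 : γ 0 = p) {X : A}
    (h : HasMFDerivAt 𝓘(ℝ, ℝ) 𝓘(ℝ, A) γ 0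
      (ContinuousLinearMap.toSpanSingleton ℝ X : ℝ →L[ℝ] A)) :
    HasDerivAt (fun t ↦ extChartAt 𝓘(ℝ, A) p (γ t)) X 0 := by
  subst h0
  have h1 : HasFDerivWithinAt (fun t ↦ extChartAt 𝓘(ℝ, A) (γ 0) (γ t))
    (ContinuousLinearMap.toSpanSingleton ℝ X) (Set.range 𝓘(ℝ, ℝ)) (0 : ℝ) := h.2
  rw [modelWithCornersSelf_coe, Set.range_id, hasFDerivWithinAt_univ] at h1
  exact h1.hasDerivAt.congr_deriv (by simp)

lemma Submodule.hasDerivAt_mem {A : Type*} [NormedAddCommGroup A] [NormedSpace ℝ A]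
    [FiniteDimensional ℝ A] (V : Submodule ℝ A) {c : ℝ → A} (hc : ∀ t, c t ∈ V) {X : A}
    (h : HasDerivAt c X 0) : X ∈ V := by
  refine V.closed_of_finiteDimensional.mem_of_tendsto (hasDerivAt_iff_tendsto_slope.1 h)
    (.of_forall fun t ↦ ?_)
  exact V.smul_mem _ (V.sub_mem (hc t) (hc 0))

variable {A : Type*} [NormedAddCommGroup A] [NormedSpace ℝ A]
  {G : Type*} [TopologicalSpace G] [ChartedSpace A G] [Group G]

/-- The Lie bracket of `𝔤` on the model space of `G`. -/
def modelBracket (G : Type*) [TopologicalSpace G] [ChartedSpace A G] [Group G] (X Y : A) : A :=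
  Bracket.bracket (L := GroupLieAlgebra 𝓘(ℝ, A) G) (M := GroupLieAlgebra 𝓘(ℝ, A) G) X Y

/-- The adjoint representation on the model space of `G`. -/
def modelAdjoint {G : Type*} [TopologicalSpace G] [ChartedSpace A G] [Group G] (g : G) (Y : A) : A :=
  adjointMap g Y

/-- The left-invariant vector field with value `X` at `1`. -/
def leftField (G : Type*) [TopologicalSpace G] [ChartedSpace A G] [Group G] (X : A) :
    Π g : G, TangentSpace 𝓘(ℝ, A) g :=
  mulInvariantVectorField (X : GroupLieAlgebra 𝓘(ℝ, A) G)

variable (G) in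
/-- The group law in the preferred chart at `1`. -/
def localMul (p : A × A) : A :=
  extChartAt 𝓘(ℝ, A) (1 : G)
    ((extChartAt 𝓘(ℝ, A) (1 : G)).symm p.1 * (extChartAt 𝓘(ℝ, A) (1 : G)).symm p.2)

variable (A G) in
/-- The coordinates of `1` in the preferred chart at `1`. -/
def localOne : A := extChartAt 𝓘(ℝ, A) (1 : G) 1

variable [LieGroup 𝓘(ℝ, A) ∞ G]

/-- Supplies the regularity under which `GroupLieAlgebra` carries its Lie algebra structure. -/
instance lieGroup_minSmoothness : LieGroup 𝓘(ℝ, A) (minSmoothness ℝ 3) G :=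
  LieGroup.of_le (n := ∞) (by
    rw [minSmoothness_of_isRCLikeNormedField]; exact WithTop.coe_le_coe.2 le_top)

lemma localOne_symm : (extChartAt 𝓘(ℝ, A) (1 : G)).symm (localOne A G) = 1 :=
  extChartAt_to_inv (I := 𝓘(ℝ, A)) (1 : G)

lemma contDiffAt_localMul : ContDiffAt ℝ ∞ (localMul (A := A) G) (localOne A G, localOne A G) := by
  have hs : ContMDiffAt 𝓘(ℝ, A) 𝓘(ℝ, A) ∞ (extChartAt 𝓘(ℝ, A) (1 : G)).symm (localOne A G) :=
    (contMDiffOn_extChartAt_symm (1 : G)).contMDiffAt (extChartAt_target_mem_nhds (1 : G))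
  have h1 : ContMDiffAt 𝓘(ℝ, A × A) 𝓘(ℝ, A) ∞
      (fun p : A × A ↦ (extChartAt 𝓘(ℝ, A) (1 : G)).symm p.1) (localOne A G, localOne A G) :=
    ContMDiffAt.comp (g := (extChartAt 𝓘(ℝ, A) (1 : G)).symm) (f := Prod.fst) _ hs
      contDiff_fst.contMDiff.contMDiffAt
  have h2 : ContMDiffAt 𝓘(ℝ, A × A) 𝓘(ℝ, A) ∞
      (fun p : A × A ↦ (extChartAt 𝓘(ℝ, A) (1 : G)).symm p.2) (localOne A G, localOne A G) :=
    ContMDiffAt.comp (g := (extChartAt 𝓘(ℝ, A) (1 : G)).symm) (f := Prod.snd) _ hs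
      contDiff_snd.contMDiff.contMDiffAt
  have h3 := h1.mul h2
  rw [← contMDiffAt_iff_contDiffAt]
  refine ContMDiffAt.comp _ (I' := 𝓘(ℝ, A)) (contMDiffAt_extChartAt' ?_) h3
  rw [localOne_symm, one_mul]
  exact mem_chart_source A (1 : G)

lemma localMul_one_right : ∀ᶠ x in 𝓝 (localOne A G), localMul G (x, localOne A G) = x := by
  filter_upwards [extChartAt_target_mem_nhds (I := 𝓘(ℝ, A)) (1 : G)] with x hx
  simp only [localMul, localOne_symm, mul_one]
  exact (extChartAt 𝓘(ℝ, A) (1 : G)).right_inv hx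

lemma localMul_one_left : ∀ᶠ x in 𝓝 (localOne A G), localMul G (localOne A G, x) = x := by
  filter_upwards [extChartAt_target_mem_nhds (I := 𝓘(ℝ, A)) (1 : G)] with x hx
  simp only [localMul, localOne_symm, one_mul]
  exact (extChartAt 𝓘(ℝ, A) (1 : G)).right_inv hx

lemma eventually_differentiableAt_localMul :
    ∀ᶠ p in 𝓝 (localOne A G, localOne A G), DifferentiableAt ℝ (localMul (A := A) G) p := by
  filter_upwards [((contDiffAt_localMul (A := A) (G := G)).of_le two_le_infty).eventually (by simp)]
    with p hp
  exact hp.differentiableAt (by simp)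

lemma tendsto_extChartAt_one :
    Filter.Tendsto (extChartAt 𝓘(ℝ, A) (1 : G)) (𝓝 1) (𝓝 (localOne A G)) :=
  continuousAt_extChartAt (I := 𝓘(ℝ, A)) (1 : G)

/-- The left-invariant field is the derivative of k ↦ yk at 1, that is, the partial derivative of
the local group law in its second variable. -/
lemma fieldRep_leftField (Y : A) : ∀ᶠ y in 𝓝 (1 : G),
    fieldRep (leftField G Y) 1 y =
      fderiv ℝ (localMul G) (extChartAt 𝓘(ℝ, A) (1 : G) y, localOne A G) ((0 : A), Y) := by
  have ht : Filter.Tendsto (fun y : G ↦ (extChartAt 𝓘(ℝ, A) (1 : G) y, localOne A G)) (𝓝 1)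
      (𝓝 (localOne A G, localOne A G)) :=
    (tendsto_extChartAt_one (A := A) (G := G)).prodMk_nhds tendsto_const_nhds
  filter_upwards [eventually_mem_chart_source (A := A) (1 : G),
    ht.eventually eventually_differentiableAt_localMul] with y hy hy'
  have h1 : MDifferentiableAt 𝓘(ℝ, A) 𝓘(ℝ, A) (extChartAt 𝓘(ℝ, A) (1 : G)) y :=
    mdifferentiableAt_extChartAt hy
  have h2 : MDifferentiableAt 𝓘(ℝ, A) 𝓘(ℝ, A) (fun k : G ↦ y * k) 1 :=
    (contMDiff_mul_left (n := ∞) (a := y) (x := (1 : G))).mdifferentiableAt (by simp)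
  have h1' : MDifferentiableAt 𝓘(ℝ, A) 𝓘(ℝ, A) (extChartAt 𝓘(ℝ, A) (1 : G)) (y * 1) := by
    rwa [mul_one]
  have h3 := mfderiv_comp_of_eq h1 h2 (mul_one y)
  have h4 := mvfderiv_eq_fderiv_comp_symm (h1'.comp (1 : G) h2)
  have h5 : (extChartAt 𝓘(ℝ, A) (1 : G) ∘ fun k : G ↦ y * k) ∘
      (extChartAt 𝓘(ℝ, A) (1 : G)).symm =
        localMul G ∘ fun z ↦ (extChartAt 𝓘(ℝ, A) (1 : G) y, z) := by
    funext z
    simp only [localMul, Function.comp_apply]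
    rw [(extChartAt 𝓘(ℝ, A) (1 : G)).left_inv (by simpa using hy)]
  have h6 := HasFDerivAt.comp (f := fun z ↦ (extChartAt 𝓘(ℝ, A) (1 : G) y, z)) (localOne A G)
    hy'.hasFDerivAt (hasFDerivAt_prodMk_right _ _)
  rw [h5] at h4
  have h8 := congrArg (fun p : G ↦ ((mvfderiv 𝓘(ℝ, A) (extChartAt 𝓘(ℝ, A) (1 : G)) p :
    A →L[ℝ] A)) (leftField G Y y)) (mul_one y)
  have h7 := h3.symm.trans (h4.trans h6.fderiv)
  exact h8.symm.trans ((congrArg (fun T : A →L[ℝ] A ↦ T Y) h7).trans (by simp))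

lemma leftField_one (Y : A) : leftField G Y 1 = Y := by
  have h : (fun k : G ↦ 1 * k) = id := funext one_mul
  refine (congrArg (fun k : G → G ↦ (modelDeriv A A k 1) Y) h).trans ?_
  exact congrArg (fun T : A →L[ℝ] A ↦ T Y) (mfderiv_id (I := 𝓘(ℝ, A)) (x := (1 : G)))

lemma mdifferentiableAt_leftField (X : A) (g : G) :
    MDifferentiableAt 𝓘(ℝ, A) 𝓘(ℝ, A).tangent
      (fun y ↦ (⟨y, leftField G X y⟩ : TangentBundle 𝓘(ℝ, A) G)) g :=
  mdifferentiableAt_mulInvariantVectorField _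

/-- Differentiating the coefficients from `fieldRep_leftField` in the base point produces the mixed
second derivatives of the group law; the bracket antisymmetrizes them. -/
lemma modelBracket_eq (X Y : A) :
    modelBracket G X Y =
      fderiv ℝ (fderiv ℝ (localMul G)) (localOne A G, localOne A G) (X, 0) (0, Y) -
        fderiv ℝ (fderiv ℝ (localMul G)) (localOne A G, localOne A G) (Y, 0) (0, X) := by
  have hd : DifferentiableAt ℝ (fderiv ℝ (localMul (A := A) G)) (localOne A G, localOne A G) :=
    ((contDiffAt_localMul (A := A) (G := G)).fderiv_right (m := 1)
      (WithTop.coe_le_coe.2 le_top)).differentiableAt (by simp)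
  have key (X Y : A) : (mvfderiv 𝓘(ℝ, A) (fieldRep (leftField G Y) 1) (1 : G) : A →L[ℝ] A) X =
      fderiv ℝ (fderiv ℝ (localMul G)) (localOne A G, localOne A G) (X, 0) (0, Y) := by
    have h1 := (HasFDerivAt.comp (f := fun x ↦ (x, localOne A G)) (localOne A G) hd.hasFDerivAt
      (hasFDerivAt_prodMk_left _ _)).clm_apply
        (hasFDerivAt_const ((0 : A), Y) (localOne A G))
    have h2 := mvfderiv_comp_extChartAt (x := (1 : G)) h1.differentiableAt
    refine (congrArg (fun T : A →L[ℝ] A ↦ T X)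
      ((Filter.EventuallyEq.mvfderiv_eq (fieldRep_leftField (G := G) Y)).trans
        (h2.trans h1.fderiv))).trans ?_
    simp
  refine (mlieBracket_eq_fieldRep (mdifferentiableAt_leftField X (1 : G))
    (mdifferentiableAt_leftField Y (1 : G))).trans ?_
  rw [← key X Y, ← key Y X]
  exact congrArg₂ (fun a b ↦
    (mvfderiv 𝓘(ℝ, A) (fieldRep (leftField G Y) 1) (1 : G) : A →L[ℝ] A) a -
    (mvfderiv 𝓘(ℝ, A) (fieldRep (leftField G X) 1) (1 : G) : A →L[ℝ] A) b)
    (leftField_one X) (leftField_one Y)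

/-- Near 1, conjugation is z ↦ m(m(g, z), g⁻¹) in the chart, so this is the chain rule at z = 1. -/
lemma adjointMap_eq (Y : A) : ∀ᶠ g in 𝓝 (1 : G),
    modelAdjoint g Y =
      fderiv ℝ (localMul G) (extChartAt 𝓘(ℝ, A) (1 : G) g, extChartAt 𝓘(ℝ, A) (1 : G) g⁻¹)
        (fderiv ℝ (localMul G) (extChartAt 𝓘(ℝ, A) (1 : G) g, localOne A G) ((0 : A), Y), (0 : A)) := by
  have : IsTopologicalGroup G := topologicalGroup_of_lieGroup 𝓘(ℝ, A) ∞
  have hinv : Filter.Tendsto (fun g : G ↦ g⁻¹) (𝓝 1) (𝓝 1) := by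
    simpa using (continuous_inv (G := G)).tendsto 1
  have ht : Filter.Tendsto (fun y : G ↦ (extChartAt 𝓘(ℝ, A) (1 : G) y, localOne A G)) (𝓝 1)
      (𝓝 (localOne A G, localOne A G)) :=
    (tendsto_extChartAt_one (A := A) (G := G)).prodMk_nhds tendsto_const_nhds
  have ht' : Filter.Tendsto (fun y : G ↦ (extChartAt 𝓘(ℝ, A) (1 : G) y,
      extChartAt 𝓘(ℝ, A) (1 : G) y⁻¹)) (𝓝 1) (𝓝 (localOne A G, localOne A G)) :=
    (tendsto_extChartAt_one (A := A) (G := G)).prodMk_nhds (tendsto_extChartAt_one.comp hinv)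
  filter_upwards [eventually_mem_chart_source (A := A) (1 : G),
    hinv.eventually (eventually_mem_chart_source (A := A) (1 : G)),
    ht.eventually eventually_differentiableAt_localMul,
    ht'.eventually eventually_differentiableAt_localMul] with g hg hg' hd hd'
  have hc : ContMDiff 𝓘(ℝ, A) 𝓘(ℝ, A) ∞ (fun k : G ↦ g * k * g⁻¹) :=
    (contMDiff_mul_right (n := ∞) (a := g⁻¹)).comp (contMDiff_mul_left (n := ∞) (a := g))
  have h1 := modelDeriv_eq_fderiv_chartRep hc 1
  have hg1 : g * 1 * g⁻¹ = 1 := by simp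
  have hgl := (extChartAt 𝓘(ℝ, A) (1 : G)).left_inv (x := g) (by simpa using hg)
  have hgl' := (extChartAt 𝓘(ℝ, A) (1 : G)).left_inv (x := g⁻¹) (by simpa using hg')
  have h2 : chartRep A A (fun k : G ↦ g * k * g⁻¹) 1 =ᶠ[𝓝 (localOne A G)]
      fun z ↦ localMul G (localMul G (extChartAt 𝓘(ℝ, A) (1 : G) g, z),
        extChartAt 𝓘(ℝ, A) (1 : G) g⁻¹) := by
    have hcont : Filter.Tendsto (fun z ↦ g * (extChartAt 𝓘(ℝ, A) (1 : G)).symm z)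
        (𝓝 (localOne A G)) (𝓝 g) := by
      have := (continuousAt_extChartAt_symm (I := 𝓘(ℝ, A)) (1 : G)).tendsto.const_mul g
      simpa [localOne] using this
    filter_upwards [hcont.eventually ((chartAt A (1 : G)).open_source.mem_nhds hg)] with z hz
    simp only [chartRep, localMul, Function.comp_apply, hg1, hgl, hgl']
    rw [(extChartAt 𝓘(ℝ, A) (1 : G)).left_inv (by rw [extChartAt_source]; exact hz)]
  have h3 : localMul G (extChartAt 𝓘(ℝ, A) (1 : G) g, localOne A G) =
      extChartAt 𝓘(ℝ, A) (1 : G) g := by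
    simp only [localMul, localOne_symm, hgl, mul_one]
  have h4 := HasFDerivAt.comp (f := fun z ↦ (extChartAt 𝓘(ℝ, A) (1 : G) g, z)) (localOne A G)
    hd.hasFDerivAt (hasFDerivAt_prodMk_right _ _)
  have h5 : HasFDerivAt (fun z ↦ localMul G (localMul G (extChartAt 𝓘(ℝ, A) (1 : G) g, z),
        extChartAt 𝓘(ℝ, A) (1 : G) g⁻¹)) _ (localOne A G) :=
    HasFDerivAt.comp (g := localMul G) (f := fun z ↦
      (localMul G (extChartAt 𝓘(ℝ, A) (1 : G) g, z), extChartAt 𝓘(ℝ, A) (1 : G) g⁻¹))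
      (localOne A G) (by rw [h3]; exact hd'.hasFDerivAt)
      (h4.prodMk (hasFDerivAt_const _ _))
  have h6 := h1.trans (h2.fderiv_eq.trans h5.fderiv)
  refine (congrArg (fun T : A →L[ℝ] A ↦ T Y) h6).trans ?_
  simp

/-- Arbitrary curves with velocity X are allowed, since 𝔥 is described by velocities of curves in H
and not by one-parameter subgroups. -/
lemma hasDerivAt_adjointMap {γ : ℝ → G} (h0 : γ 0 = 1) {X : A} (h : HasMFDerivAt 𝓘(ℝ, ℝ) 𝓘(ℝ, A) γ 0
      (ContinuousLinearMap.toSpanSingleton ℝ X : ℝ →L[ℝ] A)) (Y : A) :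
    HasDerivAt (fun t ↦ modelAdjoint (γ t) Y) (modelBracket G X Y) 0 := by
  have hc := hasDerivAt_extChartAt_comp h0 h
  have hγ : ContinuousAt γ 0 := h.1
  have hm := (contDiffAt_localMul (A := A) (G := G)).of_le two_le_infty
  have hγi : MDifferentiableAt 𝓘(ℝ, ℝ) 𝓘(ℝ, A) (fun t ↦ (γ t)⁻¹) 0 :=
    ((contMDiff_inv 𝓘(ℝ, A) ∞ (γ 0)).mdifferentiableAt (by simp)).comp (0 : ℝ) h.mdifferentiableAt
  obtain ⟨X', hX'⟩ : ∃ X' : A, HasDerivAt (fun t ↦ extChartAt 𝓘(ℝ, A) (1 : G) (γ t)⁻¹) X' 0 := by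
    refine ⟨(mfderiv 𝓘(ℝ, ℝ) 𝓘(ℝ, A) (fun t ↦ (γ t)⁻¹) 0 : ℝ →L[ℝ] A) 1,
      hasDerivAt_extChartAt_comp (by simp [h0]) ?_⟩
    have e : ContinuousLinearMap.toSpanSingleton ℝ
        ((mfderiv 𝓘(ℝ, ℝ) 𝓘(ℝ, A) (fun t ↦ (γ t)⁻¹) 0 : ℝ →L[ℝ] A) 1) =
        (mfderiv 𝓘(ℝ, ℝ) 𝓘(ℝ, A) (fun t ↦ (γ t)⁻¹) 0 : ℝ →L[ℝ] A) := by
      ext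
      exact one_smul ℝ _
    exact (congrArg (fun T : ℝ →L[ℝ] A ↦
      HasMFDerivAt 𝓘(ℝ, ℝ) 𝓘(ℝ, A) (fun t ↦ (γ t)⁻¹) 0 T) e).mpr hγi.hasMFDerivAt
  have hγ1 : Filter.Tendsto γ (𝓝 0) (𝓝 1) := by simpa [h0] using hγ.tendsto
  have hγ1' : Filter.Tendsto (fun t ↦ (γ t)⁻¹) (𝓝 0) (𝓝 1) := by
    simpa [h0] using hγi.continuousAt.tendsto
  have e0 : extChartAt 𝓘(ℝ, A) (1 : G) (γ 0) = localOne A G := by rw [h0, localOne]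
  have e0' : extChartAt 𝓘(ℝ, A) (1 : G) (γ 0)⁻¹ = localOne A G := by rw [h0, inv_one, localOne]
  have hd := (hm.differentiableAt (by simp)).hasFDerivAt
  -- Differentiate m(γ, γ⁻¹) = 1 at t = 0: both partial derivatives of m at the unit are the
  -- identity, so X + X' = 0.
  have hX : X' = -X := by
    have h3 : HasDerivAt (fun t ↦ localMul G (extChartAt 𝓘(ℝ, A) (1 : G) (γ t),
        extChartAt 𝓘(ℝ, A) (1 : G) (γ t)⁻¹)) (fderiv ℝ (localMul G)
          (localOne A G, localOne A G) (X, X')) 0 :=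
      HasFDerivAt.comp_hasDerivAt (l := localMul G) (f := fun t ↦ (extChartAt 𝓘(ℝ, A) (1 : G) (γ t),
        extChartAt 𝓘(ℝ, A) (1 : G) (γ t)⁻¹)) (0 : ℝ) (by rw [e0, e0']; exact hd) (hc.prodMk hX')
    have h4 : HasDerivAt (fun t ↦ localMul G (extChartAt 𝓘(ℝ, A) (1 : G) (γ t),
        extChartAt 𝓘(ℝ, A) (1 : G) (γ t)⁻¹)) 0 0 := by
      refine (hasDerivAt_const (0 : ℝ) (localOne A G)).congr_of_eventuallyEq ?_
      filter_upwards [hγ1.eventually (eventually_mem_chart_source (A := A) (1 : G)),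
        hγ1'.eventually (eventually_mem_chart_source (A := A) (1 : G))] with t ht ht'
      simp only [localMul]
      rw [(extChartAt 𝓘(ℝ, A) (1 : G)).left_inv (by simpa using ht),
        (extChartAt 𝓘(ℝ, A) (1 : G)).left_inv (by simpa using ht'), mul_inv_cancel, localOne]
    have h5 := h3.unique h4
    have h6 := HasFDerivAt.comp (f := fun x : A ↦ (x, localOne A G)) _ hd
      (hasFDerivAt_prodMk_left _ _) |>.unique
        ((hasFDerivAt_id (𝕜 := ℝ) (localOne A G)).congr_of_eventuallyEq localMul_one_right)
    have h7 := HasFDerivAt.comp (f := fun x : A ↦ (localOne A G, x)) _ hd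
      (hasFDerivAt_prodMk_right _ _) |>.unique
        ((hasFDerivAt_id (𝕜 := ℝ) (localOne A G)).congr_of_eventuallyEq localMul_one_left)
    have h8 : (X, X') = ContinuousLinearMap.inl ℝ A A X + ContinuousLinearMap.inr ℝ A A X' := by simp
    rw [h8, map_add, ← ContinuousLinearMap.comp_apply, ← ContinuousLinearMap.comp_apply, h6, h7] at h5
    exact (neg_eq_of_add_eq_zero_right h5).symm
  rw [hX] at hX'
  have key := hasDerivAt_adjoint_localGroup hm localMul_one_right localMul_one_left Y hc hX' e0 e0'
  rw [modelBracket_eq]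
  exact key.congr_of_eventuallyEq (hγ1.eventually (adjointMap_eq Y))

variable {H : Subgroup G} {𝔥 𝔪 : Submodule ℝ (GroupLieAlgebra 𝓘(ℝ, A) G)}

/-- `[𝔥, 𝔪] ⊆ 𝔪` for a reductive decomposition. -/
lemma IsSymmetricDecomposition.modelBracket_mem [FiniteDimensional ℝ A]
    (hs : IsSymmetricDecomposition H 𝔥 𝔪) {X Y : A} (hX : X ∈ 𝔥) (hY : Y ∈ 𝔪) :
    modelBracket G X Y ∈ 𝔪 := by
  obtain ⟨γ, h0, hγ, hd⟩ : X ∈ subgroupLieAlgebra (A := A) H := hs.lieAlgebra ▸ hX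
  exact Submodule.hasDerivAt_mem (A := A) 𝔪 (fun t ↦ hs.reductive (γ t) (hγ t) Y hY)
    (hasDerivAt_adjointMap h0 hd Y)

end LieGroupBracket

/-! ### Submersions: surjective differential, and curves in the fibres. -/

section Submersion

variable {A : Type*} [NormedAddCommGroup A] [NormedSpace ℝ A]
  {S : Type*} [TopologicalSpace S] [ChartedSpace A S]
  {B : Type*} [NormedAddCommGroup B] [NormedSpace ℝ B]
  {N : Type*} [TopologicalSpace N] [ChartedSpace B N]

lemma modelDeriv_comp_of_eq {C : Type*} [NormedAddCommGroup C] [NormedSpace ℝ C]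
    {K : Type*} [TopologicalSpace K] [ChartedSpace C K] {g : N → K} {φ : S → N} {x : S} {y : N}
    (hg : MDifferentiableAt 𝓘(ℝ, B) 𝓘(ℝ, C) g y) (hφ : MDifferentiableAt 𝓘(ℝ, A) 𝓘(ℝ, B) φ x)
    (hy : φ x = y) (u : A) :
    modelDeriv A C (g ∘ φ) x u = modelDeriv B C g y (modelDeriv A B φ x u) := by
  subst hy
  exact congrArg (fun T : A →L[ℝ] C ↦ T u) (mfderiv_comp x hg hφ)

lemma modelDeriv_const (p : N) (x : S) : modelDeriv A B (fun _ ↦ p) x = 0 :=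
  mfderiv_const

lemma Filter.EventuallyEq.modelDeriv_eq {φ φ' : S → N} {x : S} (h : φ =ᶠ[𝓝 x] φ') :
    modelDeriv A B φ x = modelDeriv A B φ' x :=
  h.mfderiv_eq

variable [IsManifold 𝓘(ℝ, A) ∞ S] [IsManifold 𝓘(ℝ, B) ∞ N]

lemma mdifferentiable_of_mem_maximalAtlas {e : OpenPartialHomeomorph S A}
    (he : e ∈ IsManifold.maximalAtlas 𝓘(ℝ, A) ∞ S) : e.MDifferentiable 𝓘(ℝ, A) 𝓘(ℝ, A) :=
  ⟨(contMDiffOn_of_mem_maximalAtlas he).mdifferentiableOn (by simp),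
    (contMDiffOn_symm_of_mem_maximalAtlas he).mdifferentiableOn (by simp)⟩

variable {φ : S → N} {x : S}

lemma Manifold.IsSubmersionAt.codChart_apply
    (h : Manifold.IsSubmersionAt 𝓘(ℝ, A) 𝓘(ℝ, B) ∞ φ x) {z : A} (hz : z ∈ h.domChart.target) :
    h.codChart (φ (h.domChart.symm z)) = (h.equiv z).1 := by
  have hz' : z ∈ (h.domChart.extend 𝓘(ℝ, A)).target := by simpa using hz
  simpa using h.writtenInCharts hz'

/-- The differential of a submersion in adapted charts is a linear projection. -/
lemma Manifold.IsSubmersionAt.modelDeriv_writtenInCharts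
    (h : Manifold.IsSubmersionAt 𝓘(ℝ, A) 𝓘(ℝ, B) ∞ φ x) (a : A) :
    modelDeriv B B h.codChart (φ x) (modelDeriv A B φ x a) =
      (h.equiv (modelDeriv A A h.domChart x a)).1 := by
  have hx := h.mem_domChart_source
  have h1 : MDifferentiableAt 𝓘(ℝ, A) 𝓘(ℝ, A) h.domChart x :=
    (mdifferentiable_of_mem_maximalAtlas h.domChart_mem_maximalAtlas).mdifferentiableAt hx
  have hφ : MDifferentiableAt 𝓘(ℝ, A) 𝓘(ℝ, B) φ x := h.contMDiffAt.mdifferentiableAt (by simp)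
  have h2 : MDifferentiableAt 𝓘(ℝ, B) 𝓘(ℝ, B) h.codChart (φ x) :=
    (mdifferentiable_of_mem_maximalAtlas h.codChart_mem_maximalAtlas).mdifferentiableAt
      h.mem_codChart_source
  let p : A →L[ℝ] B := (ContinuousLinearMap.fst ℝ B h.complement).comp
    (h.equiv : A →L[ℝ] B × h.complement)
  have h3 : h.codChart ∘ φ =ᶠ[𝓝 x] p ∘ h.domChart := by
    filter_upwards [h.domChart.open_source.mem_nhds hx] with y hy
    have h4 := h.codChart_apply (h.domChart.map_source hy)
    rw [h.domChart.left_inv hy] at h4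
    exact h4
  rw [← modelDeriv_comp_of_eq h2 hφ rfl, h3.modelDeriv_eq,
    modelDeriv_comp_of_eq p.mdifferentiableAt h1 rfl]
  exact congrArg (fun T : A →L[ℝ] B ↦ T (modelDeriv A A h.domChart x a)) p.mfderiv_eq

lemma Manifold.IsSubmersionAt.modelDeriv_surjective
    (h : Manifold.IsSubmersionAt 𝓘(ℝ, A) 𝓘(ℝ, B) ∞ φ x) :
    Function.Surjective (modelDeriv A B φ x) := by
  intro b
  obtain ⟨a, ha⟩ := (mdifferentiable_of_mem_maximalAtlas
    h.domChart_mem_maximalAtlas).mfderiv_surjective h.mem_domChart_source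
      (h.equiv.symm (modelDeriv B B h.codChart (φ x) b, 0))
  have ha' : modelDeriv A A h.domChart x a = _ := ha
  refine ⟨a, (mdifferentiable_of_mem_maximalAtlas
    h.codChart_mem_maximalAtlas).mfderiv_injective h.mem_codChart_source ?_⟩
  refine (h.modelDeriv_writtenInCharts a).trans ?_
  rw [ha', h.equiv.apply_symm_apply]
  rfl

/-- A vector in the kernel of the differential of a submersion is tangent to a curve in the
fibre. -/
lemma Manifold.IsSubmersionAt.exists_curve
    (h : Manifold.IsSubmersionAt 𝓘(ℝ, A) 𝓘(ℝ, B) ∞ φ x) {a : A} (ha : modelDeriv A B φ x a = 0) :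
    ∃ γ : ℝ → S, γ 0 = x ∧ (∀ t, φ (γ t) = φ x) ∧ HasMFDerivAt 𝓘(ℝ, ℝ) 𝓘(ℝ, A) γ 0
      (ContinuousLinearMap.toSpanSingleton ℝ a : ℝ →L[ℝ] A) := by
  classical
  have hx := h.mem_domChart_source
  have hz := h.domChart.map_source hx
  have hD := mdifferentiable_of_mem_maximalAtlas h.domChart_mem_maximalAtlas
  set w := modelDeriv A A h.domChart x a with hw
  have hw1 : (h.equiv w).1 = 0 := by rw [hw, ← h.modelDeriv_writtenInCharts a, ha, map_zero]
  set l : ℝ → A := fun t ↦ h.domChart x + t • w with hl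
  have hl0 : l 0 = h.domChart x := by simp [hl]
  have hld : HasFDerivAt l (ContinuousLinearMap.toSpanSingleton ℝ w) 0 :=
    (ContinuousLinearMap.toSpanSingleton ℝ w).hasFDerivAt.const_add (h.domChart x)
  have hlt : ∀ᶠ t in 𝓝 (0 : ℝ), l t ∈ h.domChart.target :=
    hld.continuousAt.eventually (h.domChart.open_target.mem_nhds (hl0 ▸ hz))
  -- In adapted charts φ is a linear projection, so the straight line in the kernel direction w
  -- stays in the fibre. Outside the chart the curve is set to x, which is also in the fibre, so
  -- that it is defined for all t.
  refine ⟨fun t ↦ if l t ∈ h.domChart.target then h.domChart.symm (l t) else x, ?_, fun t ↦ ?_, ?_⟩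
  · beta_reduce
    rw [if_pos (hl0 ▸ hz), hl0, h.domChart.left_inv hx]
  · by_cases ht : l t ∈ h.domChart.target
    · simp only [if_pos ht]
      refine h.codChart.injOn (h.source_subset_preimage_source (h.domChart.map_target ht))
        h.mem_codChart_source ?_
      have h5 := h.codChart_apply hz
      rw [h.domChart.left_inv hx] at h5
      rw [h.codChart_apply ht, h5]
      simp [hl, hw1]
    · simp only [if_neg ht]
  · have h6 : MDifferentiableAt 𝓘(ℝ, A) 𝓘(ℝ, A) h.domChart.symm (l 0) :=
      hD.mdifferentiableAt_symm (hl0 ▸ hz)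
    have h7 : HasMFDerivAt 𝓘(ℝ, ℝ) 𝓘(ℝ, A) (h.domChart.symm ∘ l) 0 _ :=
      h6.hasMFDerivAt.comp (0 : ℝ) hld.hasMFDerivAt
    have h8 : ((modelDeriv A A h.domChart.symm (l 0)).comp
        (ContinuousLinearMap.toSpanSingleton ℝ w) : ℝ →L[ℝ] A) =
        ContinuousLinearMap.toSpanSingleton ℝ a := by
      ext
      simp only [ContinuousLinearMap.comp_apply, ContinuousLinearMap.toSpanSingleton_apply, one_smul]
      rw [hl0]
      exact congrArg (fun T : A →L[ℝ] A ↦ T a) (hD.symm_comp_deriv hx)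
    have h9 := (congrArg (fun T : ℝ →L[ℝ] A ↦
      HasMFDerivAt 𝓘(ℝ, ℝ) 𝓘(ℝ, A) (h.domChart.symm ∘ l) 0 T) h8).mp h7
    refine h9.congr_of_eventuallyEq ?_
    filter_upwards [hlt] with t ht
    simp [ht]

end Submersion

/-! ### The coefficients of a metric and their derivatives. -/

section MetricRep

variable {B : Type*} [NormedAddCommGroup B] [NormedSpace ℝ B]
  {N : Type*} [TopologicalSpace N] [ChartedSpace B N] [IsManifold 𝓘(ℝ, B) ∞ N]

/-- The coefficients at `q` of a metric in the preferred chart at `p`. -/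
def metricRep (h : PseudoRiemannianMetric B N) (p q : N) : B →L[ℝ] B →L[ℝ] ℝ :=
  ((trivializationAt (B →L[ℝ] B →L[ℝ] ℝ)
    (fun x : N ↦ TangentSpace 𝓘(ℝ, B) x →L[ℝ] TangentSpace 𝓘(ℝ, B) x →L[ℝ] ℝ) p)
      ⟨q, h.inner q⟩).2

lemma contMDiffAt_metricRep (h : PseudoRiemannianMetric B N) (p : N) :
    ContMDiffAt 𝓘(ℝ, B) 𝓘(ℝ, B →L[ℝ] B →L[ℝ] ℝ) ∞ (metricRep h p) p :=
  (contMDiffAt_section _).1 (h.contMDiff p)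

lemma symmL_eq_extend {p q : N} (hq : q ∈ (chartAt B p).source) (a : B) :
    (trivializationAt B (TangentSpace 𝓘(ℝ, B) : N → Type _) p).symmL ℝ q a =
      extend (x := p) B a q := by
  have h := congrArg (fun T ↦ T a) (TangentBundle.symmL_trivializationAt (I := 𝓘(ℝ, B)) hq)
  rw [modelWithCornersSelf_coe, Set.range_id, mfderivWithin_univ] at h
  exact h.trans (extend_eq_mfderiv_symm hq _).symm

lemma metricRep_apply (h : PseudoRiemannianMetric B N) {p q : N} (hq : q ∈ (chartAt B p).source)
    (a b : B) :
    metricRep h p q a b = h.inner q (extend (x := p) B a q) (extend (x := p) B b q) := by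
  have hy' : q ∈ (trivializationAt (B →L[ℝ] ℝ)
      (fun x : N ↦ TangentSpace 𝓘(ℝ, B) x →L[ℝ] ℝ) p).baseSet := by
    rw [hom_trivializationAt_baseSet]
    exact ⟨hq, trivial⟩
  simp only [metricRep, hom_trivializationAt_apply, ContinuousLinearMap.inCoordinates,
    ContinuousLinearMap.comp_apply, Trivialization.continuousLinearMapAt_apply]
  rw [Trivialization.coe_linearMapAt_of_mem _ hy']
  simp only [hom_trivializationAt_apply, ContinuousLinearMap.inCoordinates]
  simp only [ContinuousLinearMap.comp_apply]
  simp
  exact congrArg₂ (fun v w ↦ h.inner q v w) (symmL_eq_extend hq a) (symmL_eq_extend hq b)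

lemma metricRep_self (h : PseudoRiemannianMetric B N) (p : N) (a b : B) :
    metricRep h p p a b = h.modelInner p a b :=
  (metricRep_apply h (mem_chart_source B p) a b).trans
    (congrArg₂ (fun v w : B ↦ h.modelInner p v w)
      (extend_apply_self B (E := (TangentSpace 𝓘(ℝ, B) : N → Type _)) (x := p) a)
      (extend_apply_self B (E := (TangentSpace 𝓘(ℝ, B) : N → Type _)) (x := p) b))

-- Metric compatibility on coordinate fields, rewritten for the metric as one function with values
-- in bilinear forms, so that it can later be composed with the projection G → G/H.
set_option synthInstance.maxHeartbeats 200000 in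
lemma mvfderiv_metricRep [FiniteDimensional ℝ B] {h : PseudoRiemannianMetric B N}
    {nabla : CovariantDerivative 𝓘(ℝ, B) B (TangentSpace 𝓘(ℝ, B) : N → Type _)}
    (hn : IsLeviCivita h nabla) (p : N) (w a b : B) :
    (mvfderiv 𝓘(ℝ, B) (metricRep h p) p : B →L[ℝ] B →L[ℝ] B →L[ℝ] ℝ) w a b =
      h.modelInner p (christoffel nabla p w a) b + h.modelInner p a (christoffel nabla p w b) := by
  have hd : MDifferentiableAt 𝓘(ℝ, B) 𝓘(ℝ, B →L[ℝ] B →L[ℝ] ℝ) (metricRep h p) p :=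
    (contMDiffAt_metricRep h p).mdifferentiableAt (by simp)
  have h1 := mvfderiv_clm_apply₂ (ContinuousLinearMap.id ℝ (B →L[ℝ] B →L[ℝ] ℝ)) hd
    (mdifferentiableAt_const (c := a)) w
  have hd1 : MDifferentiableAt 𝓘(ℝ, B) 𝓘(ℝ, B →L[ℝ] ℝ) (fun q ↦ metricRep h p q a) p :=
    hd.clm_apply mdifferentiableAt_const
  have h2 := mvfderiv_clm_apply₂ (ContinuousLinearMap.id ℝ (B →L[ℝ] ℝ)) hd1
    (mdifferentiableAt_const (c := b)) w
  rw [mvfderiv_const] at h1 h2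
  have h3 : (fun q ↦ metricRep h p q a b) =ᶠ[𝓝 p]
      fun q ↦ h.inner q (extend (x := p) B a q) (extend (x := p) B b q) := by
    filter_upwards [eventually_mem_chart_source (A := B) p] with q hq
    exact metricRep_apply h hq a b
  have h4 := (congrArg (fun T : B →L[ℝ] ℝ ↦ T w) h3.mvfderiv_eq).trans
    (hn.mvfderiv_inner_extend p w a b)
  refine Eq.trans ?_ h4
  refine Eq.trans ?_ (h2.trans (congrArg₂ (· + ·) (congrArg (fun T : B →L[ℝ] ℝ ↦ T b) h1) rfl)).symm
  have key (r : ℝ) (T : B →L[ℝ] B →L[ℝ] ℝ) : r = r + T 0 b + T a 0 := by simp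
  exact key _ (metricRep h p p)

end MetricRep

/-! ### Left-invariant sections of π^*T(G/H) and the kernel of dπ. -/

section HomogeneousSpace

variable {A : Type*} [NormedAddCommGroup A] [NormedSpace ℝ A]
  {G : Type*} [TopologicalSpace G] [ChartedSpace A G] [Group G]
  {B : Type*} [NormedAddCommGroup B] [NormedSpace ℝ B] {H : Subgroup G}
  [ChartedSpace B (G ⧸ H)]

variable (A B H) in
/-- The derivative of `k ↦ g k H` at `1`. -/
def orbitDeriv (g : G) : A →L[ℝ] B :=
  modelDeriv A B (fun k ↦ (QuotientGroup.mk (g * k) : G ⧸ H)) 1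

variable (A B H) in
/-- The projection `G → G/H` in the preferred chart at `g H`. -/
def projRep (g : G) : G → B :=
  extChartAt 𝓘(ℝ, B) (QuotientGroup.mk g : G ⧸ H) ∘ QuotientGroup.mk

variable (B H) in
/-- The derivative of `projRep` along left-invariant fields. -/
def orbitRep (g k : G) (X : A) : B :=
  (mvfderiv 𝓘(ℝ, A) (projRep B H g) k : A →L[ℝ] B) (leftField G X k)

variable [LieGroup 𝓘(ℝ, A) ∞ G] [IsManifold 𝓘(ℝ, B) ∞ (G ⧸ H)]
  (hπ : Manifold.IsSubmersion 𝓘(ℝ, A) 𝓘(ℝ, B) ∞ (QuotientGroup.mk : G → G ⧸ H))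

lemma mdifferentiableAt_leftMul (g k : G) :
    MDifferentiableAt 𝓘(ℝ, A) 𝓘(ℝ, A) (fun l : G ↦ g * l) k :=
  (contMDiff_mul_left (n := ∞) (a := g) (x := k)).mdifferentiableAt (by simp)

include hπ

lemma mdifferentiableAt_quotientMk (g : G) :
    MDifferentiableAt 𝓘(ℝ, A) 𝓘(ℝ, B) (QuotientGroup.mk : G → G ⧸ H) g :=
  (hπ.contMDiff g).mdifferentiableAt (by simp)

lemma mdifferentiableAt_quotientMk_mul (g k : G) :
    MDifferentiableAt 𝓘(ℝ, A) 𝓘(ℝ, B) (fun l ↦ (QuotientGroup.mk (g * l) : G ⧸ H)) k :=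
  (mdifferentiableAt_quotientMk hπ (g * k)).comp k (mdifferentiableAt_leftMul g k)

lemma orbitDeriv_apply (g : G) (X : A) :
    orbitDeriv A B H g X = modelDeriv A B (QuotientGroup.mk : G → G ⧸ H) g (leftField G X g) :=
  modelDeriv_comp_of_eq (mdifferentiableAt_quotientMk hπ g) (mdifferentiableAt_leftMul g 1)
    (mul_one g) X

lemma contMDiffAt_projRep (g : G) : ContMDiffAt 𝓘(ℝ, A) 𝓘(ℝ, B) ∞ (projRep B H g) g :=
  (contMDiffAt_extChartAt (I := 𝓘(ℝ, B))).comp g (hπ.contMDiff g)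

lemma orbitRep_eq {g k : G}
    (hk : (QuotientGroup.mk k : G ⧸ H) ∈ (chartAt B (QuotientGroup.mk g : G ⧸ H)).source) (X : A) :
    orbitRep B H g k X =
      modelDeriv B B (extChartAt 𝓘(ℝ, B) (QuotientGroup.mk g : G ⧸ H)) (QuotientGroup.mk k : G ⧸ H)
        (orbitDeriv A B H k X) := by
  rw [orbitDeriv_apply hπ]
  exact modelDeriv_comp_of_eq (mdifferentiableAt_extChartAt hk)
    (mdifferentiableAt_quotientMk hπ k) rfl _

lemma orbitRep_self (g : G) (X : A) : orbitRep B H g g X = orbitDeriv A B H g X := by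
  rw [orbitRep_eq hπ (mem_chart_source B _)]
  exact congrArg (fun T : B →L[ℝ] B ↦ T _) (mfderiv_extChartAt_self (I := 𝓘(ℝ, B)))

lemma orbitDeriv_surjective (g : G) : Function.Surjective (orbitDeriv A B H g) := by
  intro b
  obtain ⟨a, rfl⟩ := (hπ.isSubmersionAt g).modelDeriv_surjective b
  refine ⟨modelDeriv A A (fun k ↦ g⁻¹ * k) g a, ?_⟩
  have h1 : (QuotientGroup.mk : G → G ⧸ H) =
      (fun k ↦ QuotientGroup.mk (g * k)) ∘ fun k ↦ g⁻¹ * k := by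
    funext k
    simp
  conv_rhs => rw [h1]
  exact (modelDeriv_comp_of_eq (mdifferentiableAt_quotientMk_mul hπ g 1)
    (mdifferentiableAt_leftMul g⁻¹ g) (inv_mul_cancel g) a).symm

/-- The map k ↦ gkH is constant along curves in H. -/
lemma orbitDeriv_eq_zero_of_mem (g : G) {X : A} (hX : X ∈ subgroupLieAlgebra (A := A) H) :
    orbitDeriv A B H g X = 0 := by
  obtain ⟨γ, h0, hγ, hd⟩ := hX
  have h1 := modelDeriv_comp_of_eq (mdifferentiableAt_quotientMk_mul hπ g 1) hd.mdifferentiableAt h0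
    (1 : ℝ)
  have h2 : (fun l ↦ (QuotientGroup.mk (g * l) : G ⧸ H)) ∘ γ = fun _ ↦ QuotientGroup.mk g := by
    funext t
    exact QuotientGroup.mk_mul_of_mem g (hγ t)
  rw [h2, modelDeriv_const] at h1
  have h3 : modelDeriv ℝ A γ 0 1 = X :=
    (congrArg (fun T : ℝ →L[ℝ] A ↦ T 1) hd.mfderiv).trans (one_smul ℝ _)
  rw [h3] at h1
  exact h1.symm

/-- A vector in the kernel of dπ at 1 is the velocity of a curve in the fibre through 1, and that
fibre is H. -/
lemma mem_of_orbitDeriv_one_eq_zero {X : A} (hX : orbitDeriv A B H 1 X = 0) :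
    X ∈ subgroupLieAlgebra (A := A) H := by
  rw [orbitDeriv_apply hπ, leftField_one] at hX
  obtain ⟨γ, h0, hγ, hd⟩ := (hπ.isSubmersionAt 1).exists_curve hX
  refine ⟨γ, h0, fun t ↦ ?_, hd⟩
  have := QuotientGroup.eq.1 (hγ t).symm
  simpa using this

variable {h : PseudoRiemannianMetric B (G ⧸ H)}

/-- Translation by g is an isometry and carries `orbitDeriv 1 X` to `orbitDeriv g X`, so scalar
products of left-invariant sections are constant on G. -/
lemma PseudoRiemannianMetric.IsInvariant.orbitDeriv_left (hinv : h.IsInvariant) (g : G) (X Y : A) :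
    h.modelInner (QuotientGroup.mk g) (orbitDeriv A B H g X) (orbitDeriv A B H g Y) =
      h.modelInner (QuotientGroup.mk 1) (orbitDeriv A B H 1 X) (orbitDeriv A B H 1 Y) := by
  have h1 (u v : B) : h.modelInner (QuotientGroup.mk g)
      (modelDeriv B B (fun q : G ⧸ H ↦ g • q) (QuotientGroup.mk 1) u)
      (modelDeriv B B (fun q : G ⧸ H ↦ g • q) (QuotientGroup.mk 1) v) =
      h.modelInner (QuotientGroup.mk 1) u v := by
    have h2 : g • (QuotientGroup.mk 1 : G ⧸ H) = QuotientGroup.mk g := by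
      rw [MulAction.Quotient.smul_mk, smul_eq_mul, mul_one]
    have h3 : h.modelInner (g • (QuotientGroup.mk 1 : G ⧸ H)) 
      (modelDeriv B B (fun q : G ⧸ H ↦ g • q) (QuotientGroup.mk 1) u)
      (modelDeriv B B (fun q : G ⧸ H ↦ g • q) (QuotientGroup.mk 1) v) =
      h.modelInner (QuotientGroup.mk 1) u v := hinv g (QuotientGroup.mk 1) u v
    rwa [h2] at h3
  by_cases hd : MDifferentiableAt 𝓘(ℝ, B) 𝓘(ℝ, B) (fun q : G ⧸ H ↦ g • q) (QuotientGroup.mk 1)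
  · have h2 (X : A) : modelDeriv B B (fun q : G ⧸ H ↦ g • q) (QuotientGroup.mk 1)
        (orbitDeriv A B H 1 X) = orbitDeriv A B H g X := by
      refine (modelDeriv_comp_of_eq hd (mdifferentiableAt_quotientMk_mul hπ 1 1)
        (by rw [mul_one]) X).symm.trans ?_
      have h3 : (fun q : G ⧸ H ↦ g • q) ∘ (fun l ↦ (QuotientGroup.mk (1 * l) : G ⧸ H)) =
          fun l ↦ QuotientGroup.mk (g * l) := by
        funext l
        rw [Function.comp_apply, one_mul, MulAction.Quotient.smul_mk, smul_eq_mul]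
      rw [h3, orbitDeriv]
    rw [← h2, ← h2, h1]
  -- A non-differentiable map has differential `0` by convention. Invariance would then make the
  -- nondegenerate scalar product at the base point vanish, so the tangent space is trivial and both
  -- sides are zero.
  · have h2 : modelDeriv B B (fun q : G ⧸ H ↦ g • q) (QuotientGroup.mk 1) = 0 :=
      mfderiv_zero_of_not_mdifferentiableAt hd
    have h3 (u : B) : u = 0 := h.nondegenerate (QuotientGroup.mk 1) u fun v ↦ by
      refine (h1 u v).symm.trans ?_
      rw [h2]
      simp
    rw [h3 (orbitDeriv A B H g X), h3 (orbitDeriv A B H 1 X), map_zero, map_zero]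
    rfl

/-- Invariance turns a kernel vector at g into a vector at the base point orthogonal to every
`orbitDeriv 1 Y`. These exhaust the tangent space, so nondegeneracy moves the kernel from g to 1. -/
lemma PseudoRiemannianMetric.IsInvariant.mem_of_orbitDeriv_eq_zero (hinv : h.IsInvariant) {g : G}
    {X : A} (hX : orbitDeriv A B H g X = 0) : X ∈ subgroupLieAlgebra (A := A) H := by
  refine mem_of_orbitDeriv_one_eq_zero hπ ?_
  refine h.nondegenerate (QuotientGroup.mk 1) (orbitDeriv A B H 1 X) fun (v : B) ↦ ?_
  obtain ⟨Y, rfl⟩ := orbitDeriv_surjective hπ 1 v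
  refine (hinv.orbitDeriv_left hπ g X Y).symm.trans ?_
  rw [hX, map_zero]
  rfl

end HomogeneousSpace

/-! ### The Levi-Civita connection on left-invariant sections. -/

section Orbit

variable {A : Type*} [NormedAddCommGroup A] [NormedSpace ℝ A]
  {G : Type*} [TopologicalSpace G] [ChartedSpace A G] [Group G]
  {B : Type*} [NormedAddCommGroup B] [NormedSpace ℝ B] {H : Subgroup G}
  [ChartedSpace B (G ⧸ H)] [LieGroup 𝓘(ℝ, A) ∞ G] [IsManifold 𝓘(ℝ, B) ∞ (G ⧸ H)]

/-- The covariant derivative, along the left-invariant field `X`, of the left-invariant field `Y`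
regarded as a section of `π^*T(G/H)`. -/
def orbitSecond (nabla : CovariantDerivative 𝓘(ℝ, B) B (TangentSpace 𝓘(ℝ, B) : G ⧸ H → Type _))
    (g : G) (X Y : A) : B :=
  (mvfderiv 𝓘(ℝ, A) (fun k ↦ orbitRep B H g k Y) g : A →L[ℝ] B) (leftField G X g) +
    christoffel nabla (QuotientGroup.mk g) (orbitDeriv A B H g X) (orbitDeriv A B H g Y)

variable {nabla : CovariantDerivative 𝓘(ℝ, B) B (TangentSpace 𝓘(ℝ, B) : G ⧸ H → Type _)}

lemma leftField_add (X Y : A) (g : G) :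
    (leftField G (X + Y) g : A) = leftField G X g + leftField G Y g :=
  map_add (modelDeriv A A (fun k : G ↦ g * k) 1) X Y

lemma orbitSecond_add_left (g : G) (X X' Y : A) :
    orbitSecond nabla g (X + X') Y = orbitSecond nabla g X Y + orbitSecond nabla g X' Y := by
  have h1 := (congrArg (mvfderiv 𝓘(ℝ, A) (fun k ↦ orbitRep B H g k Y) g : A →L[ℝ] B)
    (leftField_add X X' g)).trans (map_add _ _ _)
  have h2 := christoffel_add_left nabla (QuotientGroup.mk g) (orbitDeriv A B H g X)
    (orbitDeriv A B H g X') (orbitDeriv A B H g Y)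
  rw [← map_add] at h2
  exact (congrArg₂ (· + ·) h1 h2).trans (add_add_add_comm _ _ _ _)

variable (hπ : Manifold.IsSubmersion 𝓘(ℝ, A) 𝓘(ℝ, B) ∞ (QuotientGroup.mk : G → G ⧸ H))
include hπ

/-- Torsion-freeness pulled back to G: the Christoffel terms cancel by symmetry, and the commutator
of X and Y acting on π in a chart is left. -/
lemma orbitSecond_sub [CompleteSpace A] [FiniteDimensional ℝ B] (ht : nabla.torsion = 0) (g : G) (X Y : A) :
    orbitSecond nabla g X Y - orbitSecond nabla g Y X =
      orbitDeriv A B H g (modelBracket G X Y) := by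
  have h1 := mvfderiv_mlieBracket (contMDiffAt_projRep hπ g) (mdifferentiableAt_leftField X g)
    (mdifferentiableAt_leftField Y g)
  have h2 : (mlieBracket 𝓘(ℝ, A) (leftField G X) (leftField G Y) g : A) =
      leftField G (modelBracket G X Y) g :=
    (congrFun (mulInvariantVector_mlieBracket (I := 𝓘(ℝ, A)) (G := G) X Y) g).symm
  have h3 := h1.trans (congrArg (mvfderiv 𝓘(ℝ, A) (projRep B H g) g : A →L[ℝ] B) h2)
  have h4 := h3.trans (orbitRep_self hπ g (modelBracket G X Y))
  have h5 := christoffel_symm nabla ht (QuotientGroup.mk g) (orbitDeriv A B H g X)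
    (orbitDeriv A B H g Y)
  have key (a b c d : B) (hcd : c = d) : a + c - (b + d) = a - b := by
    rw [hcd, add_sub_add_right_eq_sub]
  exact (key _ _ _ _ h5).trans h4

lemma mdifferentiableAt_orbitRep (g : G) (Y : A) :
    MDifferentiableAt 𝓘(ℝ, A) 𝓘(ℝ, B) (fun k ↦ orbitRep B H g k Y) g :=
  mdifferentiableAt_mvfderiv_apply_field (contMDiffAt_projRep hπ g) (mdifferentiableAt_leftField Y g)

lemma eventually_mk_mem_chart_source (g : G) : ∀ᶠ k in 𝓝 g,
    (QuotientGroup.mk k : G ⧸ H) ∈ (chartAt B (QuotientGroup.mk g : G ⧸ H)).source :=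
  (hπ.contMDiff g).continuousAt.eventually (eventually_mem_chart_source (A := B) _)

lemma PseudoRiemannianMetric.IsInvariant.metricRep_orbitRep {h : PseudoRiemannianMetric B (G ⧸ H)}
    (hinv : h.IsInvariant) (g : G) (Y Z : A) : ∀ᶠ k in 𝓝 g,
    metricRep h (QuotientGroup.mk g) (QuotientGroup.mk k) (orbitRep B H g k Y)
      (orbitRep B H g k Z) =
      h.modelInner (QuotientGroup.mk 1) (orbitDeriv A B H 1 Y) (orbitDeriv A B H 1 Z) := by
  filter_upwards [eventually_mk_mem_chart_source hπ g] with k hk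
  refine (metricRep_apply h hk _ _).trans (Eq.trans ?_ (hinv.orbitDeriv_left hπ k Y Z))
  have e (X : A) : (extend (x := (QuotientGroup.mk g : G ⧸ H)) B (orbitRep B H g k X)
      (QuotientGroup.mk k) : TangentSpace 𝓘(ℝ, B) (QuotientGroup.mk k : G ⧸ H)) = orbitDeriv A B H k X := by
    rw [orbitRep_eq hπ hk X]
    exact extend_mvfderiv_extChartAt hk _
  exact congrArg₂ (fun a b : B ↦ h.modelInner (QuotientGroup.mk k) a b) (e Y) (e Z)

-- Differentiate the constant function ⟨Y, Z⟩ along X. The product rule yields two derivatives of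
-- sections and one of the metric coefficients, and metric compatibility converts the latter into
-- the missing Christoffel terms.
set_option synthInstance.maxHeartbeats 200000 in
lemma IsLeviCivita.orbitSecond_skew [FiniteDimensional ℝ B] {h : PseudoRiemannianMetric B (G ⧸ H)}
    (hn : IsLeviCivita h nabla) (hinv : h.IsInvariant) (g : G) (X Y Z : A) :
    h.modelInner (QuotientGroup.mk g) (orbitSecond nabla g X Y) (orbitDeriv A B H g Z) +
      h.modelInner (QuotientGroup.mk g) (orbitDeriv A B H g Y) (orbitSecond nabla g X Z) = 0 := by
  have hm : MDifferentiableAt 𝓘(ℝ, B) 𝓘(ℝ, B →L[ℝ] B →L[ℝ] ℝ)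
      (metricRep h (QuotientGroup.mk g)) (QuotientGroup.mk g : G ⧸ H) :=
    (contMDiffAt_metricRep h _).mdifferentiableAt (by simp)
  have hmk := mdifferentiableAt_quotientMk hπ g
  have hd : MDifferentiableAt 𝓘(ℝ, A) 𝓘(ℝ, B →L[ℝ] B →L[ℝ] ℝ)
      (fun k ↦ metricRep h (QuotientGroup.mk g) (QuotientGroup.mk k : G ⧸ H)) g := hm.comp g hmk
  have h1 := mvfderiv_clm_apply₂ (ContinuousLinearMap.id ℝ (B →L[ℝ] B →L[ℝ] ℝ)) hd
    (mdifferentiableAt_orbitRep hπ g Y) (leftField G X g)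
  have hd1 : MDifferentiableAt 𝓘(ℝ, A) 𝓘(ℝ, B →L[ℝ] ℝ) (fun k ↦ metricRep h (QuotientGroup.mk g)
      (QuotientGroup.mk k : G ⧸ H) (orbitRep B H g k Y)) g :=
    hd.clm_apply (mdifferentiableAt_orbitRep hπ g Y)
  have h2 := mvfderiv_clm_apply₂ (ContinuousLinearMap.id ℝ (B →L[ℝ] ℝ)) hd1
    (mdifferentiableAt_orbitRep hπ g Z) (leftField G X g)
  have h3 := (congrArg (fun T : A →L[ℝ] ℝ ↦ T (leftField G X g))
    (Filter.EventuallyEq.mvfderiv_eq (hinv.metricRep_orbitRep hπ g Y Z))).symm.trans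
      (h2.trans (congrArg₂ (· + ·) (congrArg (fun T : B →L[ℝ] ℝ ↦ T (orbitRep B H g g Z)) h1) rfl))
  have h4 : (mvfderiv 𝓘(ℝ, A) (fun k ↦ metricRep h (QuotientGroup.mk g)
      (QuotientGroup.mk k : G ⧸ H)) g : A →L[ℝ] B →L[ℝ] B →L[ℝ] ℝ) (leftField G X g) =
      (mvfderiv 𝓘(ℝ, B) (metricRep h (QuotientGroup.mk g)) (QuotientGroup.mk g : G ⧸ H) :
        B →L[ℝ] B →L[ℝ] B →L[ℝ] ℝ) (orbitDeriv A B H g X) :=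
    (modelDeriv_comp_of_eq hm hmk rfl (leftField G X g)).trans
      (congrArg (modelDeriv B (B →L[ℝ] B →L[ℝ] ℝ) (metricRep h (QuotientGroup.mk g))
        (QuotientGroup.mk g : G ⧸ H)) (orbitDeriv_apply hπ g X).symm)
  have h5 := mvfderiv_metricRep hn (QuotientGroup.mk g) (orbitDeriv A B H g X)
    (orbitDeriv A B H g Y) (orbitDeriv A B H g Z)
  have h6 := congrArg (fun T : B →L[ℝ] B →L[ℝ] ℝ ↦ T (orbitRep B H g g Y) (orbitRep B H g g Z)) h4
  have h7 : (mvfderiv 𝓘(ℝ, A) (fun _ : G ↦ h.modelInner (QuotientGroup.mk 1)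
      (orbitDeriv A B H 1 Y) (orbitDeriv A B H 1 Z)) g : A →L[ℝ] ℝ) = 0 := mvfderiv_const _
  have h8 := (congrArg (fun T : A →L[ℝ] ℝ ↦ T (leftField G X g)) h7).symm.trans h3
  have e1 := (h6.trans (congrArg₂ (fun a b ↦ (mvfderiv 𝓘(ℝ, B) (metricRep h (QuotientGroup.mk g))
    (QuotientGroup.mk g : G ⧸ H) : B →L[ℝ] B →L[ℝ] B →L[ℝ] ℝ) (orbitDeriv A B H g X) a b)
      (orbitRep_self hπ g Y) (orbitRep_self hπ g Z))).trans h5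
  have e2 (b : B) := (metricRep_self h (QuotientGroup.mk g) b (orbitRep B H g g Z)).trans
    (congrArg (h.modelInner (QuotientGroup.mk g) b) (orbitRep_self hπ g Z))
  have e3 (b : B) := (metricRep_self h (QuotientGroup.mk g) (orbitRep B H g g Y) b).trans
    (congrArg (fun a ↦ h.modelInner (QuotientGroup.mk g) a b) (orbitRep_self hπ g Y))
  have key (I : B →L[ℝ] B →L[ℝ] ℝ) (a b c a' b' c' : B) (r s t : ℝ) (h0 : 0 = r + s + t)
      (hr : r = I b c' + I c b') (hs : s = I a c') (ht : t = I c a') :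
      I (a + b) c' + I c (a' + b') = 0 := by
    simp only [map_add, add_apply]
    linarith
  exact key _ _ _ _ _ _ _ _ _ _ h8 e1 (e2 _) (e3 _)

lemma orbitRep_eventually_zero (g : G) {X : A} (hX : X ∈ subgroupLieAlgebra (A := A) H) :
    ∀ᶠ k in 𝓝 g, orbitRep B H g k X = 0 := by
  filter_upwards [eventually_mk_mem_chart_source hπ g] with k hk
  rw [orbitRep_eq hπ hk, orbitDeriv_eq_zero_of_mem hπ k hX, map_zero]

/-- The section belonging to X in 𝔥 vanishes identically, hence ∇_Y X = 0 and the torsion identity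
gives ∇_X Y. -/
lemma orbitSecond_of_mem_left [CompleteSpace A] [FiniteDimensional ℝ B] (ht : nabla.torsion = 0) (g : G) {X : A}
    (hX : X ∈ subgroupLieAlgebra (A := A) H) (Y : A) :
    orbitSecond nabla g X Y = orbitDeriv A B H g (modelBracket G X Y) := by
  have h1 : orbitSecond nabla g Y X = 0 := by
    rw [orbitSecond, orbitDeriv_eq_zero_of_mem hπ g hX, christoffel_zero_right, add_zero]
    have h2 : (fun k ↦ orbitRep B H g k X) =ᶠ[𝓝 g] fun _ ↦ (0 : B) :=
      orbitRep_eventually_zero hπ g hX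
    exact congrArg (fun T : A →L[ℝ] B ↦ T (leftField G Y g))
      (h2.mvfderiv_eq.trans (mvfderiv_const _))
  rw [← orbitSecond_sub hπ ht, h1, sub_zero]

variable {𝔥 𝔪 : Submodule ℝ (GroupLieAlgebra 𝓘(ℝ, A) G)}

lemma IsSymmetricDecomposition.orbitDeriv_eq_zero (hs : IsSymmetricDecomposition H 𝔥 𝔪) (g : G)
    {X : A} (hX : X ∈ 𝔥) : orbitDeriv A B H g X = 0 :=
  orbitDeriv_eq_zero_of_mem hπ g (hs.lieAlgebra ▸ hX : X ∈ subgroupLieAlgebra (A := A) H)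

lemma IsSymmetricDecomposition.exists_orbitDeriv_eq (hs : IsSymmetricDecomposition H 𝔥 𝔪) (g : G)
    (b : B) : ∃ X : A, X ∈ 𝔪 ∧ orbitDeriv A B H g X = b := by
  obtain ⟨Y, rfl⟩ := orbitDeriv_surjective hπ g b
  obtain ⟨y, hy, z, hz, hyz⟩ := Submodule.mem_sup.1 (Submodule.eq_top_iff'.1
    hs.isCompl.sup_eq_top (Y : GroupLieAlgebra 𝓘(ℝ, A) G))
  have h1 := (orbitDeriv A B H g).map_add y z
  refine ⟨z, hz, ?_⟩
  have h2 : orbitDeriv A B H g Y = _ := (congrArg (orbitDeriv A B H g) hyz).symm.trans h1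
  rw [h2, hs.orbitDeriv_eq_zero hπ g hy, zero_add]

/-- On a symmetric space the horizontal left-invariant fields are parallel in horizontal
directions. -/
lemma IsLeviCivita.orbitSecond_eq_zero [CompleteSpace A] [FiniteDimensional ℝ B]
    {h : PseudoRiemannianMetric B (G ⧸ H)} (hn : IsLeviCivita h nabla) (hinv : h.IsInvariant)
    (hs : IsSymmetricDecomposition H 𝔥 𝔪) (g : G) {X Y : A} (hX : X ∈ 𝔪) (hY : Y ∈ 𝔪) :
    orbitSecond nabla g X Y = 0 := by
  have hsymm {X Y : A} (hX : X ∈ 𝔪) (hY : Y ∈ 𝔪) :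
      orbitSecond nabla g X Y = orbitSecond nabla g Y X := by
    refine sub_eq_zero.1 ((orbitSecond_sub hπ hn.torsion_eq_zero g X Y).trans ?_)
    exact hs.orbitDeriv_eq_zero hπ g (hs.symmetric X hX Y hY)
  refine h.nondegenerate (QuotientGroup.mk g) _ fun (v : B) ↦ ?_
  obtain ⟨Z, hZ, rfl⟩ := hs.exists_orbitDeriv_eq hπ g v
  let T (X Y Z : A) : ℝ :=
    h.modelInner (QuotientGroup.mk g) (orbitSecond nabla g X Y) (orbitDeriv A B H g Z)
  have hskew (X Y Z : A) : T X Y Z = -T X Z Y := by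
    have h1 := hn.orbitSecond_skew hπ hinv g X Y Z
    have h2 : h.modelInner (QuotientGroup.mk g) (orbitDeriv A B H g Y) (orbitSecond nabla g X Z) =
      T X Z Y := h.symm _ _ _
    rw [h2] at h1
    exact eq_neg_of_add_eq_zero_left h1
  have hT {X Y : A} (Z : A) (hX : X ∈ 𝔪) (hY : Y ∈ 𝔪) : T X Y Z = T Y X Z := by
    simp only [T, hsymm hX hY]
  have : T X Y Z = 0 := by
    -- The braid argument: T(X,Y,Z) = -T(X,Z,Y) = -T(Z,X,Y) = T(Z,Y,X) = T(Y,Z,X) = -T(Y,X,Z) =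
    -- -T(X,Y,Z).
    linarith [hskew X Y Z, hT Y hX hZ, hskew Z X Y, hT X hZ hY, hskew Y Z X, hT Z hX hY]
  exact this

end Orbit

/-! ### Differentiability of operator-valued maps. -/

section PointwiseDifferentiability

variable {A : Type*} [NormedAddCommGroup A] [NormedSpace ℝ A]
  {S : Type*} [TopologicalSpace S] [ChartedSpace A S] [IsManifold 𝓘(ℝ, A) ∞ S]
  {V W : Type*} [NormedAddCommGroup V] [NormedSpace ℝ V] [NormedAddCommGroup W] [NormedSpace ℝ W]

/-- In finite dimension a linear map is the tuple of its values on a basis. This is needed for left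
translation and dπ, whose regularity is known one vector at a time. -/
lemma differentiableAt_clm_of_apply [FiniteDimensional ℝ V] {Φ : A → V →L[ℝ] W} {x : A}
    (h : ∀ v, DifferentiableAt ℝ (fun y ↦ Φ y v) x) : DifferentiableAt ℝ Φ x := by
  let d := Module.finrank ℝ V
  have hd : d = Module.finrank ℝ (Fin d → ℝ) := (Module.finrank_fin_fun ℝ).symm
  let e₁ := ContinuousLinearEquiv.ofFinrankEq hd
  let e₂ := (e₁.arrowCongr (1 : W ≃L[ℝ] W)).trans (ContinuousLinearEquiv.piRing (Fin d))
  rw [← Function.id_comp Φ, ← e₂.symm_comp_self]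
  exact e₂.symm.differentiableAt.comp x (differentiableAt_pi.2 fun i ↦ h _)

lemma mdifferentiableAt_clm_of_apply [FiniteDimensional ℝ V] {Φ : S → V →L[ℝ] W} {x : S}
    (h : ∀ v, MDifferentiableAt 𝓘(ℝ, A) 𝓘(ℝ, W) (fun y ↦ Φ y v) x) :
    MDifferentiableAt 𝓘(ℝ, A) 𝓘(ℝ, V →L[ℝ] W) Φ x := by
  have h1 : DifferentiableAt ℝ (Φ ∘ (extChartAt 𝓘(ℝ, A) x).symm) (extChartAt 𝓘(ℝ, A) x x) :=
    differentiableAt_clm_of_apply fun v ↦ (h v).differentiableAt_comp_symm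
  refine (h1.mdifferentiableAt.comp x (mdifferentiableAt_extChartAt (I := 𝓘(ℝ, A))
    (mem_chart_source A x))).congr_of_eventuallyEq ?_
  filter_upwards [eventually_mem_chart_source (A := A) x] with y hy
  simp only [Function.comp_apply]
  rw [(extChartAt 𝓘(ℝ, A) x).left_inv (by simpa using hy)]

lemma mvfderiv_clm_comp (L : V →L[ℝ] W) {a : S → V} {x : S}
    (ha : MDifferentiableAt 𝓘(ℝ, A) 𝓘(ℝ, V) a x) (u : A) :
    (mvfderiv 𝓘(ℝ, A) (fun y ↦ L (a y)) x : A →L[ℝ] W) u =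
      L ((mvfderiv 𝓘(ℝ, A) a x : A →L[ℝ] V) u) := by
  refine (modelDeriv_comp_of_eq L.mdifferentiableAt ha rfl u).trans ?_
  exact congrArg (fun T : V →L[ℝ] W ↦ T (modelDeriv A V a x u)) L.mfderiv_eq

lemma mdifferentiableAt_clm_comp (L : V →L[ℝ] W) {a : S → V} {x : S}
    (ha : MDifferentiableAt 𝓘(ℝ, A) 𝓘(ℝ, V) a x) :
    MDifferentiableAt 𝓘(ℝ, A) 𝓘(ℝ, W) (fun y ↦ L (a y)) x :=
  L.mdifferentiableAt.comp x ha

end PointwiseDifferentiability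

/-! ### The pulled-back Maurer-Cartan form and its differentiability. -/

section Framing

variable {A : Type*} [NormedAddCommGroup A] [NormedSpace ℝ A]
  {G : Type*} [TopologicalSpace G] [ChartedSpace A G] [Group G]
  {C : Type*} [NormedAddCommGroup C] [NormedSpace ℝ C]
  {M : Type*} [TopologicalSpace M] [ChartedSpace C M]

variable (A C) in
/-- The pull-back of the Maurer-Cartan form on the model spaces. -/
def modelForm (F : M → G) (x : M) : C →L[ℝ] A :=
  (modelDeriv A A (fun k ↦ (F x)⁻¹ * k) (F x)).comp (modelDeriv C A F x)

variable [LieGroup 𝓘(ℝ, A) ∞ G]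

lemma leftField_modelDeriv_inv (g : G) (w : A) :
    (leftField G (modelDeriv A A (fun k ↦ g⁻¹ * k) g w) g : A) = w := by
  refine (modelDeriv_comp_of_eq (mdifferentiableAt_leftMul g 1) (mdifferentiableAt_leftMul g⁻¹ g)
    (inv_mul_cancel g) w).symm.trans ?_
  have h : (fun k ↦ g * k) ∘ (fun k ↦ g⁻¹ * k) = id := by
    funext k
    simp
  rw [h]
  exact congrArg (fun T : A →L[ℝ] A ↦ T w) (mfderiv_id (I := 𝓘(ℝ, A)) (x := g))

lemma modelDeriv_inv_leftField (g : G) (X : A) :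
    modelDeriv A A (fun k ↦ g⁻¹ * k) g (leftField G X g) = X := by
  refine (modelDeriv_comp_of_eq (mdifferentiableAt_leftMul g⁻¹ g) (mdifferentiableAt_leftMul g 1)
    (mul_one g) X).symm.trans ?_
  have h : (fun k ↦ g⁻¹ * k) ∘ (fun k ↦ g * k) = id := by
    funext k
    simp
  rw [h]
  exact congrArg (fun T : A →L[ℝ] A ↦ T X) (mfderiv_id (I := 𝓘(ℝ, A)) (x := (1 : G)))

lemma leftField_modelForm (F : M → G) (x : M) (u : C) :
    (leftField G (modelForm A C F x u) (F x) : A) = modelDeriv C A F x u :=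
  leftField_modelDeriv_inv (F x) _

/-- Left translation from `1` to `g` as a linear equivalence. -/
def leftEquiv (g : G) : A ≃L[ℝ] A :=
  ContinuousLinearEquiv.equivOfInverse (modelDeriv A A (fun k ↦ g * k) 1)
    (modelDeriv A A (fun k ↦ g⁻¹ * k) g) (modelDeriv_inv_leftField g) (leftField_modelDeriv_inv g)

/-- The left-invariant fields in the preferred chart at `g`. -/
def leftRep (g k : G) : A →L[ℝ] A :=
  (modelDeriv A A (extChartAt 𝓘(ℝ, A) g) k).comp (modelDeriv A A (fun l ↦ k * l) 1)

lemma leftRep_self (g : G) : leftRep g g = ((leftEquiv g : A ≃L[ℝ] A) : A →L[ℝ] A) := by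
  ext X
  exact congrArg (fun T : A →L[ℝ] A ↦ T (modelDeriv A A (fun l ↦ g * l) 1 X))
    (mfderiv_extChartAt_self (I := 𝓘(ℝ, A)) (x := g))

variable [FiniteDimensional ℝ A]

lemma mdifferentiableAt_leftRep (g : G) :
    MDifferentiableAt 𝓘(ℝ, A) 𝓘(ℝ, A →L[ℝ] A) (leftRep (A := A) g) g :=
  mdifferentiableAt_clm_of_apply fun X ↦ mdifferentiableAt_fieldRep (mdifferentiableAt_leftField X g)

variable [IsManifold 𝓘(ℝ, C) ∞ M] {F : M → G}

/-- In charts dF is left translation applied to α, so α is recovered by applying the inverse of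
`leftRep`; inversion of linear maps is differentiable at invertible ones. -/
lemma mdifferentiableAt_modelForm_extend (hF : ContMDiff 𝓘(ℝ, C) 𝓘(ℝ, A) ∞ F) (x : M)
    (v : TangentSpace 𝓘(ℝ, C) x) :
    MDifferentiableAt 𝓘(ℝ, C) 𝓘(ℝ, A)
      (fun y ↦ modelForm A C F y (extend C v y : TangentSpace 𝓘(ℝ, C) y)) x := by
  have : CompleteSpace A := FiniteDimensional.complete ℝ A
  have hF' (y : M) : MDifferentiableAt 𝓘(ℝ, C) 𝓘(ℝ, A) F y :=
    (hF y).mdifferentiableAt (by simp)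
  have h1 : MDifferentiableAt 𝓘(ℝ, C) 𝓘(ℝ, A →L[ℝ] A) (fun y ↦ leftRep (F x) (F y)) x :=
    (mdifferentiableAt_leftRep (F x)).comp x (hF' x)
  have hi : DifferentiableAt ℝ (ContinuousLinearMap.inverse (R := ℝ) (M := A) (M₂ := A))
      (leftRep (F x) (F x)) := by
    rw [leftRep_self]
    exact (contDiffAt_map_inverse (𝕜 := ℝ) (n := 1) (leftEquiv (A := A) (F x))).differentiableAt
      (by simp)
  have h2 : MDifferentiableAt 𝓘(ℝ, C) 𝓘(ℝ, A →L[ℝ] A)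
      (fun y ↦ (leftRep (F x) (F y)).inverse) x := hi.mdifferentiableAt.comp x h1
  have h3 : MDifferentiableAt 𝓘(ℝ, C) 𝓘(ℝ, A) (fun y ↦
      (mvfderiv 𝓘(ℝ, C) (extChartAt 𝓘(ℝ, A) (F x) ∘ F) y : C →L[ℝ] A) (extend C v y)) x :=
    mdifferentiableAt_mvfderiv_apply_field
      ((contMDiffAt_extChartAt (I := 𝓘(ℝ, A))).comp x (hF x))
      (mdifferentiableAt_extend (x := x) 𝓘(ℝ, C) C v)
  refine (h2.clm_apply h3).congr_of_eventuallyEq ?_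
  -- Invertible operators form an open set, so left translation in the chart at F x remains
  -- invertible near x.
  have h4 : ∀ᶠ y in 𝓝 x, leftRep (F x) (F y) ∈
      Set.range ((↑) : (A ≃L[ℝ] A) → A →L[ℝ] A) :=
    h1.continuousAt.eventually (by
      beta_reduce
      rw [leftRep_self]
      exact ContinuousLinearEquiv.nhds (leftEquiv (F x)))
  filter_upwards [h4, (hF x).continuousAt.eventually (eventually_mem_chart_source (A := A) (F x))]
    with y ⟨e, he⟩ hy
  have h5 : (mvfderiv 𝓘(ℝ, C) (extChartAt 𝓘(ℝ, A) (F x) ∘ F) y : C →L[ℝ] A)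
      (extend C v y) =
        leftRep (F x) (F y) (modelForm A C F y (extend C v y : TangentSpace 𝓘(ℝ, C) y)) :=
    (modelDeriv_comp_of_eq (mdifferentiableAt_extChartAt hy) (hF' y) rfl _).trans
      (congrArg (modelDeriv A A (extChartAt 𝓘(ℝ, A) (F x)) (F y))
        (leftField_modelForm F y _).symm)
  rw [h5, ← he, ContinuousLinearMap.inverse_equiv]
  exact (e.symm_apply_apply _).symm

end Framing

/-! ### The second differential of f = π ∘ F in terms of the framing. -/

section HorizontalPart

variable {A : Type*} [NormedAddCommGroup A] [NormedSpace ℝ A] [FiniteDimensional ℝ A]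
  {G : Type*} [TopologicalSpace G] [ChartedSpace A G] [Group G]
  {C : Type*} [NormedAddCommGroup C] [NormedSpace ℝ C]
  {M : Type*} [TopologicalSpace M] [ChartedSpace C M] [IsManifold 𝓘(ℝ, C) ∞ M]
  {𝔥 𝔪 : Submodule ℝ (GroupLieAlgebra 𝓘(ℝ, A) G)}

/-- The projection to `𝔥` along a decomposition `𝔤 = 𝔥 ⊕ 𝔪` on the model space of `G`. -/
def modelProj (hc : IsCompl 𝔥 𝔪) : A →L[ℝ] A :=
  LinearMap.toContinuousLinearMap
    (lieToModel.toLinearMap ∘ₗ 𝔥.projection 𝔪 hc ∘ₗ lieToModel.symm.toLinearMap)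

lemma modelProj_mem (hc : IsCompl 𝔥 𝔪) (X : A) : modelProj hc X ∈ 𝔥 :=
  Submodule.projection_apply_mem hc X

lemma modelProj_add (hc : IsCompl 𝔥 𝔪) (X : A) : modelProj hc X + modelProj hc.symm X = X :=
  Submodule.projection_add_projection_eq_self hc X

/-- The coordinate vector field extending `v` in the preferred chart at `x`. -/
abbrev coordField (x : M) (v : C) (y : M) : TangentSpace 𝓘(ℝ, C) y :=
  extend (E := (TangentSpace 𝓘(ℝ, C) : M → Type _)) (x := x) C v y

/-- The horizontal part of the second derivative of a framing. -/
def framingTerm (hc : IsCompl 𝔥 𝔪) (F : M → G) (x : M) (u v : C) : A :=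
  (mvfderiv 𝓘(ℝ, C) (fun y ↦ modelProj hc.symm (modelForm A C F y
    (coordField x v y))) x : C →L[ℝ] A) u +
    modelBracket G (modelProj hc (modelForm A C F x u)) (modelProj hc.symm (modelForm A C F x v))

variable [LieGroup 𝓘(ℝ, A) ∞ G] {F : M → G}

lemma mdifferentiableAt_modelProj_modelForm (hF : ContMDiff 𝓘(ℝ, C) 𝓘(ℝ, A) ∞ F)
    (hc : IsCompl 𝔥 𝔪) (x : M) (v : C) :
    MDifferentiableAt 𝓘(ℝ, C) 𝓘(ℝ, A) (fun y ↦ modelProj hc (modelForm A C F y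
      (coordField x v y))) x :=
  mdifferentiableAt_clm_comp (modelProj hc) (mdifferentiableAt_modelForm_extend hF x v)

variable {H : Subgroup G}

/-- The derivative of an 𝔪-valued function is in 𝔪, and the bracket term is there by [𝔥, 𝔪] ⊆ 𝔪. -/
lemma IsSymmetricDecomposition.framingTerm_mem (hs : IsSymmetricDecomposition H 𝔥 𝔪)
    (hF : ContMDiff 𝓘(ℝ, C) 𝓘(ℝ, A) ∞ F) (x : M) (u v : C) :
    framingTerm hs.isCompl F x u v ∈ 𝔪 := by
  refine 𝔪.add_mem ?_ (hs.modelBracket_mem (modelProj_mem hs.isCompl _)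
    (modelProj_mem hs.isCompl.symm _))
  have h := mvfderiv_clm_comp (modelProj hs.isCompl.symm)
    (mdifferentiableAt_modelForm_extend hF x v) u
  exact (congrArg (· ∈ 𝔪) h).mpr (modelProj_mem hs.isCompl.symm _)

variable {B : Type*} [NormedAddCommGroup B] [NormedSpace ℝ B]
  [ChartedSpace B (G ⧸ H)] [IsManifold 𝓘(ℝ, B) ∞ (G ⧸ H)]

variable (H) in
/-- `orbitRep` as a continuous linear map. -/
def orbitRepMap (B : Type*) [NormedAddCommGroup B] [NormedSpace ℝ B] [ChartedSpace B (G ⧸ H)]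
    (g k : G) : A →L[ℝ] B :=
  (modelDeriv A B (projRep B H g) k).comp (modelDeriv A A (fun l ↦ k * l) 1)

variable {nabla : CovariantDerivative 𝓘(ℝ, B) B (TangentSpace 𝓘(ℝ, B) : G ⧸ H → Type _)}
  (hπ : Manifold.IsSubmersion 𝓘(ℝ, A) 𝓘(ℝ, B) ∞ (QuotientGroup.mk : G → G ⧸ H))
include hπ

lemma mdifferentiableAt_orbitRepMap (g : G) :
    MDifferentiableAt 𝓘(ℝ, A) 𝓘(ℝ, A →L[ℝ] B) (orbitRepMap (A := A) H B g) g :=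
  mdifferentiableAt_clm_of_apply fun X ↦ mdifferentiableAt_orbitRep hπ g X

lemma mvfderiv_orbitRepMap_comp {x : M} (hF : MDifferentiableAt 𝓘(ℝ, C) 𝓘(ℝ, A) F x) (u : C)
    (Y : A) :
    (mvfderiv 𝓘(ℝ, C) (fun y ↦ orbitRepMap (A := A) H B (F x) (F y)) x : C →L[ℝ] A →L[ℝ] B) u Y =
      (mvfderiv 𝓘(ℝ, A) (fun k ↦ orbitRep B H (F x) k Y) (F x) : A →L[ℝ] B)
        (leftField G (modelForm A C F x u) (F x)) := by
  have h0 : MDifferentiableAt 𝓘(ℝ, C) 𝓘(ℝ, A →L[ℝ] B) (fun y ↦ orbitRepMap (A := A) H B (F x) (F y)) x :=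
    (mdifferentiableAt_orbitRepMap hπ (F x)).comp x hF
  have h1 := mvfderiv_clm_comp (ContinuousLinearMap.apply ℝ B Y) h0 u
  have h2 := modelDeriv_comp_of_eq (mdifferentiableAt_orbitRep hπ (F x) Y) hF rfl u
  have h3 := congrArg (modelDeriv A B (fun k ↦ orbitRep B H (F x) k Y) (F x))
    (leftField_modelForm F x u)
  exact h1.symm.trans (h2.trans h3.symm)

lemma modelDeriv_mk_comp {x : M} (hF : MDifferentiableAt 𝓘(ℝ, C) 𝓘(ℝ, A) F x) (u : C) :
    modelDeriv C B (fun y ↦ (QuotientGroup.mk (F y) : G ⧸ H)) x u =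
      orbitDeriv A B H (F x) (modelForm A C F x u) :=
  (modelDeriv_comp_of_eq (mdifferentiableAt_quotientMk hπ (F x)) hF rfl u).trans
    ((congrArg (modelDeriv A B (QuotientGroup.mk : G → G ⧸ H) (F x))
      (leftField_modelForm F x u)).symm.trans (orbitDeriv_apply hπ _ _).symm)

lemma IsSymmetricDecomposition.orbitDeriv_modelProj (hs : IsSymmetricDecomposition H 𝔥 𝔪) (g : G)
    (X : A) : orbitDeriv A B H g (modelProj hs.isCompl.symm X) = orbitDeriv A B H g X := by
  conv_rhs => rw [← modelProj_add hs.isCompl X]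
  rw [map_add, hs.orbitDeriv_eq_zero hπ g (modelProj_mem hs.isCompl X), zero_add]

lemma IsLeviCivita.orbitSecond_modelProj [FiniteDimensional ℝ B]
    {h : PseudoRiemannianMetric B (G ⧸ H)} (hn : IsLeviCivita h nabla) (hinv : h.IsInvariant)
    (hs : IsSymmetricDecomposition H 𝔥 𝔪) (g : G) (X Y : A) :
    orbitSecond nabla g X (modelProj hs.isCompl.symm Y) =
      orbitDeriv A B H g (modelBracket G (modelProj hs.isCompl X)
        (modelProj hs.isCompl.symm Y)) := by
  have : CompleteSpace A := FiniteDimensional.complete ℝ A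
  have hX : modelProj hs.isCompl X ∈ subgroupLieAlgebra (A := A) H :=
    hs.lieAlgebra ▸ modelProj_mem hs.isCompl X
  conv_lhs => rw [← modelProj_add hs.isCompl X]
  rw [orbitSecond_add_left, orbitSecond_of_mem_left hπ hn.torsion_eq_zero g hX,
    hn.orbitSecond_eq_zero hπ hinv hs g (modelProj_mem hs.isCompl.symm X)
      (modelProj_mem hs.isCompl.symm Y), add_zero]

/-- The second derivative of a map to a symmetric space in terms of a framing. -/
lemma IsLeviCivita.secondDiff_mk_comp [FiniteDimensional ℝ B]
    {h : PseudoRiemannianMetric B (G ⧸ H)} (hn : IsLeviCivita h nabla) (hinv : h.IsInvariant)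
    (hs : IsSymmetricDecomposition H 𝔥 𝔪) (hF : ContMDiff 𝓘(ℝ, C) 𝓘(ℝ, A) ∞ F) (x : M) (u v : C) :
    secondDiff nabla (fun y ↦ (QuotientGroup.mk (F y) : G ⧸ H)) x u v =
      orbitDeriv A B H (F x) (framingTerm hs.isCompl F x u v) := by
  have hF' (y : M) : MDifferentiableAt 𝓘(ℝ, C) 𝓘(ℝ, A) F y :=
    (hF y).mdifferentiableAt (by simp)
  -- Near x, df of a coordinate field is the moving frame `orbitRepMap` applied to the 𝔪-part of α,
  -- as the frame annihilates 𝔥.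
  have h1 : (fun y ↦ ((trivializationAt B (TangentSpace 𝓘(ℝ, B) : G ⧸ H → Type _)
      (QuotientGroup.mk (F x) : G ⧸ H)) ⟨QuotientGroup.mk (F y), mfderiv 𝓘(ℝ, C) 𝓘(ℝ, B)
        (fun y ↦ (QuotientGroup.mk (F y) : G ⧸ H)) y
          (coordField x v y)⟩).2) =ᶠ[𝓝 x]
      fun y ↦ orbitRepMap (A := A) H B (F x) (F y) (modelProj hs.isCompl.symm (modelForm A C F y
        (coordField x v y))) := by
    filter_upwards [(hF x).continuousAt.eventually (eventually_mk_mem_chart_source hπ (F x))]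
      with y hy
    refine (trivializationAt_snd_eq_mfderiv hy _).trans ?_
    refine Eq.trans ?_ (orbitRep_eq hπ hy (modelProj hs.isCompl.symm (modelForm A C F y
        (coordField x v y)))).symm
    refine congrArg (modelDeriv B B (extChartAt 𝓘(ℝ, B) (QuotientGroup.mk (F x) : G ⧸ H))
      (QuotientGroup.mk (F y) : G ⧸ H)) ?_
    exact (modelDeriv_mk_comp hπ (hF' y) _).trans (hs.orbitDeriv_modelProj hπ _ _).symm
  have h0 : MDifferentiableAt 𝓘(ℝ, C) 𝓘(ℝ, A →L[ℝ] B) (fun y ↦ orbitRepMap (A := A) H B (F x) (F y)) x :=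
    (mdifferentiableAt_orbitRepMap hπ (F x)).comp x (hF' x)
  -- Leibniz rule: the derivative of the frame combines with the Christoffel term into
  -- `orbitSecond`, and the derivative of the coefficients is the first summand of `framingTerm`.
  have h2 := mvfderiv_clm_apply₂ (ContinuousLinearMap.id ℝ (A →L[ℝ] B)) h0
    (mdifferentiableAt_modelProj_modelForm hF hs.isCompl.symm x v) u
  have hv : (modelProj hs.isCompl.symm (modelForm A C F x
      (coordField x v x)) : A) =
      modelProj hs.isCompl.symm (modelForm A C F x v) :=
    congrArg (fun w : C ↦ modelProj hs.isCompl.symm (modelForm A C F x w))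
      (extend_apply_self C (E := (TangentSpace 𝓘(ℝ, C) : M → Type _)) (x := x) v)
  have h3 := ((congrArg ((mvfderiv 𝓘(ℝ, C) (fun y ↦ orbitRepMap (A := A) H B (F x) (F y)) x :
    C →L[ℝ] A →L[ℝ] B) u) hv).trans (mvfderiv_orbitRepMap_comp hπ (hF' x) u _))
  have h4 := (congrArg (fun T : C →L[ℝ] B ↦ T u) h1.mvfderiv_eq).trans
    (h2.trans (congrArg₂ (· + ·) h3 (orbitRep_self hπ (F x) _)))
  have h5 : christoffel nabla (QuotientGroup.mk (F x) : G ⧸ H)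
      (modelDeriv C B (fun y ↦ (QuotientGroup.mk (F y) : G ⧸ H)) x u)
      (modelDeriv C B (fun y ↦ (QuotientGroup.mk (F y) : G ⧸ H)) x
        (coordField x v x)) =
      christoffel nabla (QuotientGroup.mk (F x) : G ⧸ H)
        (orbitDeriv A B H (F x) (modelForm A C F x u))
        (orbitDeriv A B H (F x) (modelProj hs.isCompl.symm (modelForm A C F x v))) :=
    congrArg₂ (christoffel nabla (QuotientGroup.mk (F x) : G ⧸ H))
      (modelDeriv_mk_comp hπ (hF' x) u)
      ((modelDeriv_mk_comp hπ (hF' x) _).trans ((hs.orbitDeriv_modelProj hπ _ _).symm.trans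
        (congrArg (orbitDeriv A B H (F x)) hv)))
  refine (pullbackConnection_eq nabla _ _ x u).trans ((congrArg₂ (· + ·) h4 h5).trans ?_)
  have h6 := hn.orbitSecond_modelProj hπ hinv hs (F x) (modelForm A C F x u) (modelForm A C F x v)
  have key (a b c d e : B) (h : a + c = d) : a + b + c = b + d := by
    rw [← h]
    abel
  exact (key _ _ _ _ 0 h6).trans (map_add (orbitDeriv A B H (F x)) _ _).symm

end HorizontalPart

/-! ### The framing equation in terms of `framingTerm`. -/

section FramingEquation

variable {A : Type*} [NormedAddCommGroup A] [NormedSpace ℝ A] [FiniteDimensional ℝ A]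
  {G : Type*} [TopologicalSpace G] [ChartedSpace A G] [Group G] [LieGroup 𝓘(ℝ, A) ∞ G]

lemma modelBracket_smul_smul (c d : ℝ) (X Y : A) :
    modelBracket G (c • X) (d • Y) = (c * d) • modelBracket G X Y := by
  have : CompleteSpace A := FiniteDimensional.complete ℝ A
  have h1 : modelBracket G (c • X) (d • Y) = c • modelBracket G X (d • Y) :=
    smul_lie (L := GroupLieAlgebra 𝓘(ℝ, A) G) (M := GroupLieAlgebra 𝓘(ℝ, A) G) c X (d • Y)
  have h2 : modelBracket G X (d • Y) = d • modelBracket G X Y :=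
    lie_smul (L := GroupLieAlgebra 𝓘(ℝ, A) G) (M := GroupLieAlgebra 𝓘(ℝ, A) G) d X Y
  rw [h1, h2, smul_smul]

lemma mvfderiv_prodMk {C : Type*} [NormedAddCommGroup C] [NormedSpace ℝ C]
    {S : Type*} [TopologicalSpace S] [ChartedSpace C S] [IsManifold 𝓘(ℝ, C) ∞ S]
    {V W : Type*} [NormedAddCommGroup V] [NormedSpace ℝ V] [NormedAddCommGroup W] [NormedSpace ℝ W]
    {a : S → V} {b : S → W} {x : S} (ha : MDifferentiableAt 𝓘(ℝ, C) 𝓘(ℝ, V) a x)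
    (hb : MDifferentiableAt 𝓘(ℝ, C) 𝓘(ℝ, W) b x) (u : C) :
    (mvfderiv 𝓘(ℝ, C) (fun y ↦ (a y, b y)) x : C →L[ℝ] V × W) u =
      ((mvfderiv 𝓘(ℝ, C) a x : C →L[ℝ] V) u, (mvfderiv 𝓘(ℝ, C) b x : C →L[ℝ] W) u) := by
  have h := ha.prodMk_space hb
  exact Prod.ext (mvfderiv_clm_comp (ContinuousLinearMap.fst ℝ V W) h u).symm
    (mvfderiv_clm_comp (ContinuousLinearMap.snd ℝ V W) h u).symm

variable {E : Type*} [NormedAddCommGroup E] [NormedSpace ℂ E]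
  {M : Type*} [TopologicalSpace M] [ChartedSpace E M]
  {𝔥 𝔪 : Submodule ℝ (GroupLieAlgebra 𝓘(ℝ, A) G)} (hc : IsCompl 𝔥 𝔪) (F : M → G)

lemma oneZeroPart_framingComponent (x : M) (w : E) :
    oneZeroPart (framingComponent F hc) x w =
      ((1 / 2 : ℝ) • modelProj hc (modelForm A E F x w),
        (-(1 / 2) : ℝ) • modelProj hc (modelForm A E F x (Complex.I • w))) := by
  -- `iMul` sends (b, 0) to (-0, b); hence the shape of the last pair.
  have key (a b : A) : (1 / 2 : ℝ) • ((a, (0 : A)) - (-(0 : A), b)) =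
    ((1 / 2 : ℝ) • a, (-(1 / 2) : ℝ) • b) := by ext <;> simp
  exact key _ _

lemma zeroOnePart_framingComponent (x : M) (w : E) :
    zeroOnePart (framingComponent F hc) x w =
      ((1 / 2 : ℝ) • modelProj hc (modelForm A E F x w),
        (1 / 2 : ℝ) • modelProj hc (modelForm A E F x (Complex.I • w))) := by
  have key (a b : A) : (1 / 2 : ℝ) • ((a, (0 : A)) + (-(0 : A), b)) =
    ((1 / 2 : ℝ) • a, (1 / 2 : ℝ) • b) := by ext <;> simp
  exact key _ _

lemma bracketWedge_framingComponent (x : M) (Q : E → E → A)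
    (hQ : ∀ u v, Q u v = modelBracket G (modelProj hc (modelForm A E F x u))
      (modelProj hc.symm (modelForm A E F x v))) (u v : E) :
    bracketWedge G (zeroOnePart (framingComponent F hc)) (oneZeroPart (framingComponent F hc.symm))
      x u v =
      ((1 / 4 : ℝ) • (Q u v + Q (Complex.I • u) (Complex.I • v) -
          Q v u - Q (Complex.I • v) (Complex.I • u)),
        (1 / 4 : ℝ) • (Q (Complex.I • u) v - Q u (Complex.I • v) +
          Q v (Complex.I • u) - Q (Complex.I • v) u)) := by
  have key (u v : E) : complexBracket G (zeroOnePart (framingComponent F hc) x u)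
      (oneZeroPart (framingComponent F hc.symm) x v) =
      ((1 / 4 : ℝ) • (Q u v + Q (Complex.I • u) (Complex.I • v)),
        (1 / 4 : ℝ) • (Q (Complex.I • u) v - Q u (Complex.I • v))) := by
    refine (congrArg₂ (complexBracket G) (zeroOnePart_framingComponent hc F x u)
      (oneZeroPart_framingComponent hc.symm F x v)).trans ?_
    refine Prod.ext ?_ ?_
    · refine (congrArg₂ (· - ·) (modelBracket_smul_smul (G := G) _ _ _ _)
        (modelBracket_smul_smul (G := G) _ _ _ _)).trans ?_
      simp only [hQ]
      module
    · refine (congrArg₂ (· + ·) (modelBracket_smul_smul (G := G) _ _ _ _)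
        (modelBracket_smul_smul (G := G) _ _ _ _)).trans ?_
      simp only [hQ]
      module
  refine (congrArg₂ (· - ·) (key u v) (key v u)).trans ?_
  ext
  · simp only [Prod.fst_sub]
    module
  · simp only [Prod.snd_sub]
    module

variable [IsManifold 𝓘(ℂ, E) ω M]

/-- The derivative along `u` of the component in `𝔪` of `F^*θ` on the coordinate field `v`. -/
def framingDeriv (x : M) (u v : E) : A :=
  (mvfderiv 𝓘(ℝ, E) (fun y ↦ modelProj hc.symm (modelForm A E F y
    (coordField x v y : TangentSpace 𝓘(ℝ, E) y))) x : E →L[ℝ] A) u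

variable {F}

lemma framingDeriv_neg (hF : ContMDiff 𝓘(ℝ, E) 𝓘(ℝ, A) ∞ F) (x : M) (u v : E) :
    framingDeriv hc F x u (-v) = -framingDeriv hc F x u v := by
  have h1 : (fun y ↦ modelProj hc.symm (modelForm A E F y (coordField x (-v) y))) =ᶠ[𝓝 x]
      fun y ↦ (-ContinuousLinearMap.id ℝ A)
        (modelProj hc.symm (modelForm A E F y (coordField x v y))) := by
    filter_upwards [extend_smul_eventuallyEq (x := x) (-1) (v : TangentSpace 𝓘(ℝ, E) x)] with y hy
    have h2 : (coordField x (-v) y : E) = -coordField x v y :=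
      (congrArg (fun w : E ↦ (coordField x w y : E)) (neg_one_smul ℝ v).symm).trans
        (hy.symm.trans (neg_one_smul ℝ (coordField x v y : E)))
    refine (congrArg (fun w ↦ modelProj hc.symm (modelForm A E F y w)) h2).trans ?_
    refine ((congrArg (modelProj hc.symm) (map_neg (modelForm A E F y) _)).trans
      (map_neg (modelProj hc.symm) _))
  refine (congrArg (fun T : E →L[ℝ] A ↦ T u) h1.mvfderiv_eq).trans ?_
  exact mvfderiv_clm_comp (-ContinuousLinearMap.id ℝ A)
    (mdifferentiableAt_modelProj_modelForm hF hc.symm x v) u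

/-- Coordinate fields commute, so the bracket term is zero; J of a coordinate field is again a
coordinate field, so the imaginary part is also a `framingDeriv`. -/
lemma extDerivOneForm_framingComponent (hF : ContMDiff 𝓘(ℝ, E) 𝓘(ℝ, A) ∞ F) (x : M) (u v : E) :
    extDerivOneForm (oneZeroPart (framingComponent F hc.symm)) x u v =
      ((1 / 2 : ℝ) • (framingDeriv hc F x u v - framingDeriv hc F x v u),
        (1 / 2 : ℝ) • (framingDeriv hc F x v (Complex.I • u) -
          framingDeriv hc F x u (Complex.I • v))) := by
  have h1 (u v : E) : (mvfderiv 𝓘(ℝ, E) (fun y ↦ oneZeroPart (framingComponent F hc.symm) y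
      (coordField x v y)) x : E →L[ℝ] A × A) u = ((1 / 2 : ℝ) • framingDeriv hc F x u v,
        (-(1 / 2) : ℝ) • framingDeriv hc F x u (Complex.I • v)) := by
    have h2 : (fun y ↦ oneZeroPart (framingComponent F hc.symm) y (coordField x v y)) =ᶠ[𝓝 x]
        fun y ↦ (((1 / 2 : ℝ) • ContinuousLinearMap.id ℝ A)
          (modelProj hc.symm (modelForm A E F y (coordField x v y))),
            ((-(1 / 2) : ℝ) • ContinuousLinearMap.id ℝ A)
          (modelProj hc.symm (modelForm A E F y (coordField x (Complex.I • v) y)))) := by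
      filter_upwards [eventually_mem_chart_source (A := E) x] with y hy
      refine (oneZeroPart_framingComponent hc.symm F y _).trans ?_
      have h3 : complexStructure y (coordField x v y) = coordField x (Complex.I • v) y :=
        (extend_complexStructure hy v).symm
      exact congrArg (fun w ↦ ((1 / 2 : ℝ) •
        modelProj hc.symm (modelForm A E F y (coordField x v y)),
          (-(1 / 2) : ℝ) • modelProj hc.symm (modelForm A E F y w))) h3
    refine (congrArg (fun T : E →L[ℝ] A × A ↦ T u) h2.mvfderiv_eq).trans ?_
    have hd (w : E) := mdifferentiableAt_modelProj_modelForm hF hc.symm x w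
    refine (mvfderiv_prodMk (mdifferentiableAt_clm_comp _ (hd v))
      (mdifferentiableAt_clm_comp _ (hd (Complex.I • v))) u).trans ?_
    exact Prod.ext (mvfderiv_clm_comp _ (hd v) u) (mvfderiv_clm_comp _ (hd (Complex.I • v)) u)
  have h4 : oneZeroPart (framingComponent F hc.symm) x (mlieBracket 𝓘(ℝ, E)
      (extend E (u : TangentSpace 𝓘(ℝ, E) x)) (extend E (v : TangentSpace 𝓘(ℝ, E) x)) x) = 0 :=
    (congrArg _ (mlieBracket_extend (A := E) x u v)).trans (map_zero _)
  refine (congrArg₂ (· - ·) (congrArg₂ (· - ·) (h1 u v) (h1 v u)) h4).trans ?_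
  ext
  · simp only [sub_zero, Prod.fst_sub]
    module
  · simp only [sub_zero, Prod.snd_sub]
    module

/-- The derivative terms from ∂̄α'_𝔪 and the bracket terms occur with matching signs and the common
factor 1/4, so they combine into values of P. -/
lemma dbar_add_bracketWedge (hF : ContMDiff 𝓘(ℝ, E) 𝓘(ℝ, A) ∞ F) (x : M) (P : E → E → A)
    (hP : ∀ u v, P u v = framingTerm hc F x u v) (u v : E) :
    dbar (oneZeroPart (framingComponent F hc.symm)) x u v +
        bracketWedge G (zeroOnePart (framingComponent F hc))
          (oneZeroPart (framingComponent F hc.symm)) x u v =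
      ((1 / 4 : ℝ) • (P u v - P v u + P (Complex.I • u) (Complex.I • v) -
          P (Complex.I • v) (Complex.I • u)),
        (1 / 4 : ℝ) • (P (Complex.I • u) v - P u (Complex.I • v) +
          P v (Complex.I • u) - P (Complex.I • v) u)) := by
  have h1 := extDerivOneForm_framingComponent hc hF x u v
  have h2 := extDerivOneForm_framingComponent hc hF x (Complex.I • u) (Complex.I • v)
  rw [I_smul_I_smul, I_smul_I_smul, framingDeriv_neg hc hF, framingDeriv_neg hc hF] at h2
  refine (congrArg₂ (· + ·) (congrArg (fun w ↦ (1 / 2 : ℝ) • w) (congrArg₂ (· + ·) h1 h2))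
    (bracketWedge_framingComponent hc F x _ (fun _ _ ↦ rfl) u v)).trans ?_
  have hP (u v : E) : P u v = framingDeriv hc F x u v + modelBracket G
    (modelProj hc (modelForm A E F x u)) (modelProj hc.symm (modelForm A E F x v)) := hP u v
  ext
  · simp only [hP, Prod.fst_add, Prod.smul_fst]
    module
  · simp only [hP, Prod.snd_add, Prod.smul_snd]
    module

lemma framingTerm_neg (hF : ContMDiff 𝓘(ℝ, E) 𝓘(ℝ, A) ∞ F) (x : M) (u v : E) :
    framingTerm hc F x u (-v) = -framingTerm hc F x u v := by
  refine (congrArg₂ (· + ·) (framingDeriv_neg hc hF x u v) ?_).trans (neg_add _ _).symm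
  have h := modelBracket_smul_smul (G := G) 1 (-1) (modelProj hc (modelForm A E F x u))
    (modelProj hc.symm (modelForm A E F x v))
  simpa using h

/-- Symmetry of P cancels the real part and makes the imaginary part (P(Ju, v) - P(u, Jv))/2. At (u,
Jv) this is (P(Ju, Jv) + P(u, v))/2. -/
lemma framingEquation_iff (hF : ContMDiff 𝓘(ℝ, E) 𝓘(ℝ, A) ∞ F)
    (hsymm : ∀ (x : M) (u v : E), framingTerm hc F x u v = framingTerm hc F x v u) :
    FramingEquation (E := E) F hc ↔ ∀ (x : M) (u v : E),
      framingTerm hc F x u v + framingTerm hc F x (Complex.I • u) (Complex.I • v) = 0 := by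
  refine forall_congr' fun x ↦ ⟨fun h u v ↦ ?_, fun h (u : E) (v : E) ↦ ?_⟩
  · have h1 := (congrArg Prod.snd (dbar_add_bracketWedge hc hF x _ (fun _ _ ↦ rfl) u
      (Complex.I • v))).symm.trans (congrArg Prod.snd (h u (Complex.I • v)))
    simp only [I_smul_I_smul, Prod.snd_zero] at h1
    rw [hsymm x (-v) u, framingTerm_neg hc hF, hsymm x (Complex.I • v) (Complex.I • u)] at h1
    have key (a b : A) : b + a = (2 : ℝ) • (1 / 4 : ℝ) • (a - -b + a - -b) := by module
    rw [key, h1, smul_zero]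
  · refine (dbar_add_bracketWedge hc hF x _ (fun _ _ ↦ rfl) u v).trans ?_
    have h1 := h u (Complex.I • v)
    rw [I_smul_I_smul, framingTerm_neg hc hF, add_neg_eq_zero] at h1
    rw [hsymm x v u, hsymm x (Complex.I • v) (Complex.I • u), hsymm x v (Complex.I • u),
      hsymm x (Complex.I • v) u, h1]
    simp

end FramingEquation

/-! ### Comparison of the two equations. -/

section Symmetric

variable {A : Type*} [NormedAddCommGroup A] [NormedSpace ℝ A] [FiniteDimensional ℝ A]
  {G : Type*} [TopologicalSpace G] [ChartedSpace A G] [Group G] [LieGroup 𝓘(ℝ, A) ∞ G]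
  {H : Subgroup G} {B : Type*} [NormedAddCommGroup B] [NormedSpace ℝ B] [FiniteDimensional ℝ B]
  [ChartedSpace B (G ⧸ H)] [IsManifold 𝓘(ℝ, B) ∞ (G ⧸ H)]
  {𝔥 𝔪 : Submodule ℝ (GroupLieAlgebra 𝓘(ℝ, A) G)}
  {nabla : CovariantDerivative 𝓘(ℝ, B) B (TangentSpace 𝓘(ℝ, B) : G ⧸ H → Type _)}
  {h : PseudoRiemannianMetric B (G ⧸ H)}

/-- The kernel of the differential is contained in 𝔥, which meets 𝔪 only in zero. -/
lemma IsSymmetricDecomposition.eq_zero_of_orbitDeriv_eq_zero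
    (hs : IsSymmetricDecomposition H 𝔥 𝔪)
    (hπ : Manifold.IsSubmersion 𝓘(ℝ, A) 𝓘(ℝ, B) ∞ (QuotientGroup.mk : G → G ⧸ H))
    (hinv : h.IsInvariant) {g : G} {X : A} (hX : X ∈ 𝔪) (h0 : orbitDeriv A B H g X = 0) :
    X = 0 := by
  have h1 : X ∈ subgroupLieAlgebra (A := A) H := hinv.mem_of_orbitDeriv_eq_zero hπ h0
  exact Submodule.disjoint_def.1 hs.isCompl.disjoint X
    (hs.lieAlgebra.symm.subset h1) hX

variable {E : Type*} [NormedAddCommGroup E] [NormedSpace ℂ E]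
  {M : Type*} [TopologicalSpace M] [ChartedSpace E M] [IsManifold 𝓘(ℂ, E) ω M] {F : M → G}

lemma IsLeviCivita.secondDiff_oneOne_iff (hn : IsLeviCivita h nabla) (hinv : h.IsInvariant)
    (hs : IsSymmetricDecomposition H 𝔥 𝔪)
    (hπ : Manifold.IsSubmersion 𝓘(ℝ, A) 𝓘(ℝ, B) ∞ (QuotientGroup.mk : G → G ⧸ H))
    (hF : ContMDiff 𝓘(ℝ, E) 𝓘(ℝ, A) ∞ F) :
    (∀ (x : M) (u v : E), secondDiff nabla (fun y ↦ (QuotientGroup.mk (F y) : G ⧸ H)) x u v +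
      secondDiff nabla (fun y ↦ (QuotientGroup.mk (F y) : G ⧸ H)) x (Complex.I • u)
        (Complex.I • v) = 0) ↔ FramingEquation (E := E) F hs.isCompl := by
  have hP (x : M) (u v : E) := hs.framingTerm_mem hF x u v
  have hf : ContMDiff 𝓘(ℝ, E) 𝓘(ℝ, B) ∞ fun y ↦ (QuotientGroup.mk (F y) : G ⧸ H) :=
    hπ.contMDiff.comp hF
  rw [framingEquation_iff hs.isCompl hF]
  · refine forall_congr' fun x ↦ forall_congr' fun u ↦ forall_congr' fun v ↦ ?_
    rw [hn.secondDiff_mk_comp hπ hinv hs hF, hn.secondDiff_mk_comp hπ hinv hs hF, ← map_add]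
    exact ⟨hs.eq_zero_of_orbitDeriv_eq_zero hπ hinv (𝔪.add_mem (hP x u v) (hP x _ _)),
      fun h0 ↦ by rw [h0, map_zero]⟩
  -- Symmetry of `framingTerm` is the 𝔪-part of the Maurer-Cartan equation. Here it is read off from
  -- the symmetry of `secondDiff` through the injectivity of dπ on 𝔪.
  · intro x u v
    refine sub_eq_zero.1 (hs.eq_zero_of_orbitDeriv_eq_zero hπ hinv (g := F x)
      (𝔪.sub_mem (hP x u v) (hP x v u)) ?_)
    rw [map_sub, ← hn.secondDiff_mk_comp hπ hinv hs hF, ← hn.secondDiff_mk_comp hπ hinv hs hF,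
      secondDiff_symm nabla hn.torsion_eq_zero hf, sub_self]

end Symmetric

end

theorem mainTheorem9
    -- the complex manifold `M`
    {E : Type*} [NormedAddCommGroup E] [NormedSpace ℂ E] [FiniteDimensional ℂ E]
    {M : Type*} [TopologicalSpace M]
    [ChartedSpace E M] [IsManifold 𝓘(ℂ, E) ω M]
    -- the Lie group `G` and its closed subgroup `H`
    {A : Type*} [NormedAddCommGroup A] [NormedSpace ℝ A] [FiniteDimensional ℝ A]
    {G : Type*} [TopologicalSpace G]
    [ChartedSpace A G] [Group G] [LieGroup 𝓘(ℝ, A) ∞ G]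
    (H : Subgroup G) (hH : IsClosed (H : Set G))
    -- the smooth structure of `G/H`, determined by `π : G → G/H` being a smooth submersion
    {B : Type*} [NormedAddCommGroup B] [NormedSpace ℝ B] [FiniteDimensional ℝ B]
    [ChartedSpace B (G ⧸ H)] [IsManifold 𝓘(ℝ, B) ∞ (G ⧸ H)]
    (hπ : Manifold.IsSubmersion 𝓘(ℝ, A) 𝓘(ℝ, B) ∞ (QuotientGroup.mk : G → G ⧸ H))
    -- `G/H` is a pseudo-Riemannian symmetric space
    (𝔥 𝔪 : Submodule ℝ (GroupLieAlgebra 𝓘(ℝ, A) G))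
    (hsymm : IsSymmetricDecomposition H 𝔥 𝔪)
    (h : PseudoRiemannianMetric B (G ⧸ H)) (hinv : h.IsInvariant)
    (nabla : CovariantDerivative 𝓘(ℝ, B) B (TangentSpace 𝓘(ℝ, B) : G ⧸ H → Type _))
    (hnabla : IsLeviCivita h nabla)
    -- the map `f` and its framing `F`
    (f : M → G ⧸ H) (hf : ContMDiff 𝓘(ℝ, E) 𝓘(ℝ, B) ∞ f)
    (F : M → G) (hF : ContMDiff 𝓘(ℝ, E) 𝓘(ℝ, A) ∞ F)
    (hfF : ∀ x, f x = QuotientGroup.mk (F x)) :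
    (IsPluriharmonic (E := E) nabla f ↔ FramingEquation (E := E) F hsymm.isCompl) ∧
      ∀ D : CovariantDerivative 𝓘(ℝ, E) E (TangentSpace 𝓘(ℝ, E) : M → Type _),
        IsNijenhuisType D →
          (IsGeneralizedPluriharmonic D nabla f ↔ FramingEquation (E := E) F hsymm.isCompl) := by
  obtain rfl : f = fun y ↦ (QuotientGroup.mk (F y) : G ⧸ H) := funext hfF
  have key := hnabla.secondDiff_oneOne_iff hinv hsymm hπ hF
  exact ⟨(isPluriharmonic_iff hnabla.torsion_eq_zero hf).trans key,
    fun D hD ↦ (isGeneralizedPluriharmonic_iff hD nabla _).trans key⟩
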